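/- For integers $0 \le a \le m$ and $0 \le b \le n$, let $\mathcal{B}_{m,n}(a,b)$ be the bipartite rigidity matroid, i.e. the matroid on the ground set $[m]\times[n]$ given by the columns of the following $(an+bm)\times mn$ matrix over the field $\mathbb{C}(x_{ij},y_{k\ell})$ of rational functions in the variables $x_{ij}$, $(i,j)\in[m]\times[a]$, and $y_{k\ell}$, $(k,\ell)\in[n]\times[b]$. The rows are labeled by the disjoint union of $[a]\times[n]$ and $[b]\times[m]$ and the columns by $[m]\times[n]$. The row labeled by $(j,k)\in[a]\times[n]$ has the entry $x_{pj}$ in the column $(p,k)$ for each $p\in[m]$, and $0$ in all other columns. The row labeled by $(\ell,i)\in[b]\times[m]$ has the entry $y_{q\ell}$ in the column $(i,q)$ for each $q\in[n]$, and $0$ in all other columns. A subset of $[m]\times[n]$ is independent if the corresponding columns are linearly independent. **Theorem.** There is a deterministic algorithm (a single deterministic Turing machine) and a polynomial $p$ such that, for all integers $0\le a\le m$ and $0\le b\le n$ with $m-a\le 3$ and all subsets $X\subseteq[m]\times[n]$, the algorithm, given $(m,n,a,b,X)$ as input, outputs the rank of $X$ in $\mathcal{B}_{m,n}(a,b)$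 after at most $p(m+n)$ steps. -/

import Mathlib

open Computability (Γ')

/-- The column matroid of a matrix `A` over a field: the ground set is the (finite) set of all
column labels, and a set of labels is independent if and only if the columns of `A` with these
labels are linearly independent (as a family, so that equal columns are parallel elements). -/
def columnMatroid {K R C : Type*} [Field K] [Finite C] (A : Matrix R C K) : Matroid C :=
  (IndepMatroid.ofFinite (E := Set.univ) Set.finite_univ
    (fun S : Set C => LinearIndepOn K A.col S)
    (linearIndepOn_empty K A.col)
    (fun _ _ hJ hIJ => hJ.mono hIJ)
    (by
      intro I J hI hJ hlt
      by_contra! hcon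
      have hsub : A.col '' J ⊆ (Submodule.span K (A.col '' I) : Set (R → K)) := by
        rintro _ ⟨e, he, rfl⟩
        by_cases heI : e ∈ I
        · exact Submodule.subset_span (Set.mem_image_of_mem _ heI)
        · by_contra hne
          exact hcon e he heI ((linearIndepOn_insert heI).2 ⟨hI, hne⟩)
      have hfin : (A.col '' I).Finite := (Set.toFinite I).image _
      have := FiniteDimensional.span_of_finite K hfin
      have hle := Submodule.finrank_mono (Submodule.span_le.2 hsub)
      have hcard : ∀ S : Set C, LinearIndepOn K A.col S →
          Module.finrank K (Submodule.span K (A.col '' S)) = S.ncard := by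
        intro S hS
        have := Fintype.ofFinite S
        have h := finrank_span_eq_card hS
        rw [Set.image_eq_range, h, ← Nat.card_eq_fintype_card, Nat.card_coe_set_eq]
      rw [hcard I hI, hcard J hJ] at hle
      omega)
    (fun _ _ => Set.subset_univ _)).matroid

theorem columnMatroid_indep_iff {K R C : Type*} [Field K] [Finite C] (A : Matrix R C K)
    (S : Set C) : (columnMatroid A).Indep S ↔ LinearIndepOn K A.col S := Iff.rfl

/-- The field `ℂ(x_{ij}, y_{kl})` of rational functions, with `(i, j) ∈ [m] × [a]` and
`(k, l) ∈ [n] × [b]`. -/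
abbrev RigidityField (m n a b : ℕ) : Type :=
  FractionRing (MvPolynomial ((Fin m × Fin a) ⊕ (Fin n × Fin b)) ℂ)

/-- The variable `x_{ij}`, as a rational function. -/
noncomputable def rigidityX {m n a b : ℕ} (i : Fin m) (j : Fin a) : RigidityField m n a b :=
  algebraMap (MvPolynomial ((Fin m × Fin a) ⊕ (Fin n × Fin b)) ℂ) _ (MvPolynomial.X (Sum.inl (i, j)))

/-- The variable `y_{kl}`, as a rational function. -/
noncomputable def rigidityY {m n a b : ℕ} (k : Fin n) (l : Fin b) : RigidityField m n a b :=
  algebraMap (MvPolynomial ((Fin m × Fin a) ⊕ (Fin n × Fin b)) ℂ) _ (MvPolynomial.X (Sum.inr (k, l)))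

/-- The `(an + bm) × mn` bipartite rigidity matrix. The row `(j, k) ∈ [a] × [n]` has the entry
`x_{pj}` in column `(p, k)`; the row `(l, i) ∈ [b] × [m]` has the entry `y_{ql}` in column
`(i, q)`; all other entries are zero. -/
noncomputable def rigidityMatrix (m n a b : ℕ) :
    Matrix ((Fin a × Fin n) ⊕ (Fin b × Fin m)) (Fin m × Fin n) (RigidityField m n a b) :=
  Matrix.of fun row col =>
    match row with
    | Sum.inl (j, k) => if col.2 = k then rigidityX col.1 j else 0
    | Sum.inr (l, i) => if col.1 = i then rigidityY col.2 l else 0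

/-- The bipartite rigidity matroid `ℬ_{m,n}(a,b)` on `[m] × [n]`. -/
noncomputable def bipartiteRigidityMatroid (m n a b : ℕ) : Matroid (Fin m × Fin n) :=
  columnMatroid (rigidityMatrix m n a b)

/-- A number in unary, followed by a separator. -/
def encodeUnary (k : ℕ) : List Γ' :=
  List.replicate k (Γ'.bit true) ++ [Γ'.comma]

/-- The input word for `m, n, a, b` and `X ⊆ [m] × [n]`: the four numbers, then the `m × n`
zero-one incidence matrix of `X`, row by row, each row being followed by a separator. As running
times are measured in `m + n`, writing numbers `≤ m + n` in unary or in binary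
makes no difference. -/
def encodeInput (m n a b : ℕ) (X : Finset (Fin m × Fin n)) : List Γ' :=
  encodeUnary m ++ encodeUnary n ++ encodeUnary a ++ encodeUnary b ++
    (List.finRange m).flatMap fun i =>
      ((List.finRange n).map fun j => Γ'.bit (decide ((i, j) ∈ X))) ++ [Γ'.comma]

/-- The deterministic (multi-stack) Turing machine `M`, started on the word `input`, halts
after at most `t` steps with the word `output` as its output. -/
def HaltsWithOutput {Γ₀ Γ₁ : Type} (M : Turing.TM2ComputableAux Γ₀ Γ₁)
    (input : List Γ₀) (output : List Γ₁) (t : ℕ) : Prop :=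
  Nonempty (Turing.TM2OutputsInTime M.tm (input.map M.inputAlphabet.symm)
    (some (output.map M.outputAlphabet.symm)) t)

/-!
The rank of `X` is the least of polynomially many explicit numbers
`q * b + ∑ j, min |X_j| (a + c j)`, where `X_j` is the set of the rows of the elements of `X` in
the column `j`, and where `q ≤ 3` and the capacities `c` are determined by at most four rows. The
minimum can be computed by nested loops.

To see that the minimum is the rank, add empty rows until `m = a + 3`. Each of the numbers is an
upper bound by an orthogonality argument. To attain one of them it suffices to specialize the
variables. Choose `x` such that the linear relations between the rows of `x` form the space `N` of
the values of all polynomials of degree at most two at generic points. A linear relation between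
the columns with labels in `X` then consists of one element of `N` for each column `j`, vanishing
outside `X_j`, such that these elements satisfy `b` further relations given by `y`. Let each
relation say that the elements in a set of columns have the sum zero, with disjoint sets of columns
for different relations. The number of relations that take effect is a sum of values of a
submodular function, and by a theorem of Rado's type its maximum over all choices of the sets is
a minimum over sets `A` of columns. The elements of `N` that belong to the columns in `A` span a
space of dimension at most three. As the points are generic, only few coincidences between such
spaces are possible, and in each case one of the numbers above is small enough. If more than `b`
columns have at most one row outside `X_j`, let the relations instead say that the elements are
constant on each of `n - b` disjoint sets of columns and zero in all other columns, and argue with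
the sets of missing rows in place of the spaces.
-/

/-- Programs over counters indexed by `V` and a read-only tape with a movable head, in which the
algorithm is written. `ifOne` tests whether the scanned symbol is the bit one, and `rep v p` runs
`p` as often as the value of the counter `v` says when the loop is entered. -/
inductive Program (V : Type) : Type
  | skip : Program V
  | inc : V → Program V
  | dec : V → Program V
  | left : Program V
  | right : Program V
  | seq : Program V → Program V → Program V
  | ifz : V → Program V → Program V → Program V
  | ifOne : Program V → Program V → Program V
  | rep : V → Program V → Program V

namespace Program

/-- The state of a program: the values of the counters and the position of the head. -/
@[ext]
structure State (V : Type) : Type where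
  /-- the values of the counters -/
  ctr : V → ℕ
  /-- the number of symbols to the left of the head -/
  pos : ℕ

variable {V : Type} [DecidableEq V]

namespace State

/-- The state obtained by giving the counter `v` the value `x`. -/
def set (s : State V) (v : V) (x : ℕ) : State V :=
  ⟨Function.update s.ctr v x, s.pos⟩

@[simp]
theorem set_set (s : State V) (v : V) (x y : ℕ) : (s.set v x).set v y = s.set v y := by
  simp [set]

@[simp]
theorem set_ctr_self (s : State V) (v : V) : s.set v (s.ctr v) = s := by
  simp [set]

@[simp]
theorem ctr_set_self (s : State V) (v : V) (x : ℕ) : (s.set v x).ctr v = x := by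
  simp [set]

@[simp]
theorem pos_set (s : State V) (v : V) (x : ℕ) : (s.set v x).pos = s.pos := rfl

theorem ctr_set (s : State V) (u v : V) (x : ℕ) :
    (s.set v x).ctr u = if u = v then x else s.ctr u := by
  simp [set, Function.update_apply]

theorem set_comm (s : State V) {u v : V} (h : u ≠ v) (x y : ℕ) :
    (s.set u x).set v y = (s.set v y).set u x := by
  rw [set, set, set, set, Function.update_comm h]

end State

/-- The state transformation computed by a program on the tape `w`. No loop is run through more
than `F` times; this makes the running time polynomial in `F` for every program. -/
def eval (w : List Γ') (F : ℕ) : Program V → State V → State V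
  | skip, s => s
  | inc v, s => s.set v (s.ctr v + 1)
  | dec v, s => s.set v (s.ctr v - 1)
  | left, s => ⟨s.ctr, s.pos - 1⟩
  | right, s => ⟨s.ctr, min (s.pos + 1) w.length⟩
  | seq p q, s => q.eval w F (p.eval w F s)
  | ifz v p q, s => if s.ctr v = 0 then p.eval w F s else q.eval w F s
  | ifOne p q, s => if w[s.pos]? = some (Γ'.bit true) then p.eval w F s else q.eval w F s
  | rep v p, s => (p.eval w F)^[min (s.ctr v) F] s

theorem pos_eval_le (w : List Γ') (F : ℕ) (p : Program V) :
    ∀ s : State V, s.pos ≤ w.length → (p.eval w F s).pos ≤ w.length := by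
  induction p with
  | skip | inc | dec => exact fun _ hs => hs
  | left => exact fun _ hs => (Nat.sub_le _ _).trans hs
  | right => exact fun _ _ => min_le_right _ _
  | seq _ _ hp hq => exact fun _ hs => hq _ (hp _ hs)
  | ifz v p q hp hq | ifOne p q hp hq =>
    intro s hs
    simp only [eval]
    split_ifs
    exacts [hp _ hs, hq _ hs]
  | rep v p hp =>
    intro s hs
    simp only [eval]
    exact Function.Iterate.rec (fun s : State V => s.pos ≤ w.length) hs hp _

/-- A bound for the running time of the machine that executes a program, as a polynomial in the
bound `F` for the loops. -/
noncomputable def cost : Program V → Polynomial ℕ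
  | skip | inc _ | dec _ | left | right => 1
  | seq p q => p.cost + q.cost
  | ifz _ p q | ifOne p q => 1 + p.cost + q.cost
  | rep _ p => Polynomial.X * p.cost + 3 * Polynomial.X + 4

/-- The stacks of the machine that executes a program. All stacks except for the two that hold the
tape use a unary encoding. -/
inductive Stack (V : Type) : Type
  /-- the value of a counter -/
  | reg : V → Stack V
  /-- the number of times the counter of the current loop has been decreased -/
  | aux : Stack V
  /-- the bound for the number of times a loop is run through -/
  | fuel : Stack V
  /-- the remaining iterations of all active loops, one `true` for each, with a `false` below the
  iterations of each loop -/
  | loop : Stack V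
  /-- the tape to the left of the head, in reverse order -/
  | before : Stack V
  /-- the tape to the right of the head, with the scanned symbol on top -/
  | behind : Stack V
  deriving DecidableEq, Fintype

/-- The alphabets of the stacks. -/
abbrev Sym : Stack V → Type
  | .before | .behind => Γ'
  | _ => Bool

/-- The contents of the stacks when a program on the tape `w` is in the state `s`. -/
def stackOf (w : List Γ') (F : ℕ) (lp : List Bool) (ax : ℕ) (s : State V) :
    ∀ k : Stack V, List (Sym k)
  | .reg v => List.replicate (s.ctr v) true
  | .aux => List.replicate ax true
  | .fuel => List.replicate F true
  | .loop => lp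
  | .before => (w.take s.pos).reverse
  | .behind => w.drop s.pos

/-- The labels in the code of a loop. -/
inductive LoopLabel : Type
  /-- separate the iterations of this loop from those of the surrounding loops -/
  | mark
  /-- move the counter to `aux`, at the expense of `fuel`, and to `loop` -/
  | count
  /-- restore the counter and `fuel` -/
  | restore
  /-- start the next iteration or leave the loop -/
  | next
  deriving DecidableEq

instance : Fintype LoopLabel where
  elems := {.mark, .count, .restore, .next}
  complete l := by cases l <;> decide

/-- The labels in the code of a program. -/
abbrev Label : Program V → Type
  | skip | inc _ | dec _ | left | right => Unit
  | seq p q => p.Label ⊕ q.Label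
  | ifz _ p q | ifOne p q => Unit ⊕ (p.Label ⊕ q.Label)
  | rep _ p => LoopLabel ⊕ p.Label

instance fintypeLabel : (p : Program V) → Fintype p.Label
  | skip | inc _ | dec _ | left | right => inferInstanceAs (Fintype Unit)
  | seq p q =>
    have := p.fintypeLabel
    have := q.fintypeLabel
    inferInstanceAs (Fintype (p.Label ⊕ q.Label))
  | ifz _ p q | ifOne p q =>
    have := p.fintypeLabel
    have := q.fintypeLabel
    inferInstanceAs (Fintype (Unit ⊕ (p.Label ⊕ q.Label)))
  | rep _ p =>
    have := p.fintypeLabel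
    inferInstanceAs (Fintype (LoopLabel ⊕ p.Label))

/-- The label at which the execution of a program starts. -/
def entry : (p : Program V) → p.Label
  | skip | inc _ | dec _ | left | right => ()
  | seq p _ => Sum.inl p.entry
  | ifz _ _ _ | ifOne _ _ => Sum.inl ()
  | rep _ _ => Sum.inl .mark

section Code

variable {Λ : Type}

/-- The statements of the machine. The internal state holds at most one symbol. -/
abbrev Code (V Λ : Type) : Type := Turing.TM2.Stmt (Sym (V := V)) Λ (Option Γ')

/-- Go to the label `l` with an empty internal state. -/
def jump (l : Λ) : Code V Λ := .load (fun _ => none) (.goto fun _ => l)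

/-- Remove a symbol from the stack `k`, and continue with `q` if there was one and with `q'` if the
stack was empty. -/
def popTest (k : Stack V) (q q' : Code V Λ) : Code V Λ :=
  .pop k (fun _ o => o.map fun _ => Γ'.blank) (.branch Option.isSome q q')

/-- Move the head to the left, and continue with `q` if this was possible and with `q'` if not. -/
def moveLeft (q q' : Code V Λ) : Code V Λ :=
  .pop .before (fun _ o => o)
    (.branch Option.isSome (.push .behind (fun o => o.getD Γ'.blank) q) q')

/-- Move the head to the right, and continue with `q` if this was possible and with `q'` if not. -/
def moveRight (q q' : Code V Λ) : Code V Λ :=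
  .pop .behind (fun _ o => o)
    (.branch Option.isSome (.push .before (fun o => o.getD Γ'.blank) q) q')

/-- The code of a loop over the counter `v` whose body has the entry point `body`. -/
def loopCode (v : V) (ι : LoopLabel → Λ) (body out : Λ) : LoopLabel → Code V Λ
  | .mark => .push .loop (fun _ => false) (jump (ι .count))
  | .count =>
    popTest (.reg v)
      (popTest .fuel
        (.push .aux (fun _ => true) (.push .loop (fun _ => true) (jump (ι .count))))
        (.push (.reg v) (fun _ => true) (jump (ι .restore))))
      (jump (ι .restore))
  | .restore =>
    popTest .aux
      (.push (.reg v) (fun _ => true) (.push .fuel (fun _ => true) (jump (ι .restore))))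
      (jump (ι .next))
  | .next =>
    .pop .loop (fun _ (o : Option Bool) => if o = some true then some Γ'.blank else none)
      (.branch Option.isSome (jump body) (jump out))

/-- The code of a program, with labels embedded in `Λ` by `ι`, that leaves by the label `out`. -/
def code : (p : Program V) → (ι : p.Label → Λ) → (out : Λ) → p.Label → Code V Λ
  | skip, _, out, _ => jump out
  | inc v, _, out, _ => .push (.reg v) (fun _ => true) (jump out)
  | dec v, _, out, _ => .pop (.reg v) (fun _ _ => none) (jump out)
  | left, _, out, _ => moveLeft (jump out) (jump out)
  | right, _, out, _ => moveRight (jump out) (jump out)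
  | seq p q, ι, out, l =>
    match l with
    | .inl l => p.code (fun l => ι (.inl l)) (ι (.inr q.entry)) l
    | .inr l => q.code (fun l => ι (.inr l)) out l
  | ifz v p q, ι, out, l =>
    match l with
    | .inl _ => .peek (.reg v) (fun _ o => o.map fun _ => Γ'.blank)
        (.branch Option.isSome (jump (ι (.inr (.inr q.entry)))) (jump (ι (.inr (.inl p.entry)))))
    | .inr (.inl l) => p.code (fun l => ι (.inr (.inl l))) out l
    | .inr (.inr l) => q.code (fun l => ι (.inr (.inr l))) out l
  | ifOne p q, ι, out, l =>
    match l with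
    | .inl _ => .peek .behind (fun _ o => o)
        (.branch (fun o => decide (o = some (Γ'.bit true)))
          (jump (ι (.inr (.inl p.entry)))) (jump (ι (.inr (.inr q.entry)))))
    | .inr (.inl l) => p.code (fun l => ι (.inr (.inl l))) out l
    | .inr (.inr l) => q.code (fun l => ι (.inr (.inr l))) out l
  | rep v p, ι, out, l =>
    match l with
    | .inl l => loopCode v (fun l => ι (.inl l)) (ι (.inr p.entry)) out l
    | .inr l => p.code (fun l => ι (.inr l)) (ι (.inl .next)) l

end Code

section Stacks

variable (w : List Γ') {Λ : Type} {q q' : Code V Λ} {F : ℕ} {lp : List Bool} {ax : ℕ} {s : State V}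
  {v : V} {x : Option Γ'}

open Turing.TM2 (stepAux)

theorem stepAux_jump (l : Λ) (S : ∀ k : Stack V, List (Sym k)) :
    stepAux (jump l) x S = ⟨some l, none, S⟩ := rfl

theorem update_stackOf_reg (y : ℕ) :
    Function.update (stackOf w F lp ax s) (.reg v) (List.replicate y true) =
      stackOf w F lp ax (s.set v y) := by
  funext k
  cases k with
  | reg u =>
    obtain rfl | h := eq_or_ne u v
    · simp [stackOf]
    · simp [stackOf, State.ctr_set, h]
  | _ => simp [stackOf]

theorem update_stackOf_aux (y : ℕ) :
    Function.update (stackOf w F lp ax s) .aux (List.replicate y true) = stackOf w F lp y s := by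
  funext k
  cases k <;> simp [stackOf]

theorem update_stackOf_fuel (y : ℕ) :
    Function.update (stackOf w F lp ax s) .fuel (List.replicate y true) = stackOf w y lp ax s := by
  funext k
  cases k <;> simp [stackOf]

theorem update_stackOf_loop (lp' : List Bool) :
    Function.update (stackOf w F lp ax s) .loop lp' = stackOf w F lp' ax s := by
  funext k
  cases k <;> simp [stackOf]

theorem update_stackOf_before_behind (i : ℕ) :
    Function.update (Function.update (stackOf w F lp ax s) .before (w.take i).reverse)
      .behind (w.drop i) = stackOf w F lp ax ⟨s.ctr, i⟩ := by
  funext k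
  cases k <;> simp [stackOf]

theorem stepAux_push_reg :
    stepAux (.push (.reg v) (fun _ => true) q) x (stackOf w F lp ax s) =
      stepAux q x (stackOf w F lp ax (s.set v (s.ctr v + 1))) := by
  rw [stepAux, ← update_stackOf_reg]
  rfl

theorem stepAux_push_aux :
    stepAux (.push .aux (fun _ => true) q) x (stackOf w F lp ax s) =
      stepAux q x (stackOf w F lp (ax + 1) s) := by
  rw [stepAux, ← update_stackOf_aux w (ax := ax) (ax + 1)]
  rfl

theorem stepAux_push_fuel :
    stepAux (.push .fuel (fun _ => true) q) x (stackOf w F lp ax s) =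
      stepAux q x (stackOf w (F + 1) lp ax s) := by
  rw [stepAux, ← update_stackOf_fuel w (F := F) (F + 1)]
  rfl

theorem stepAux_push_loop (c : Bool) :
    stepAux (.push .loop (fun _ => c) q) x (stackOf w F lp ax s) =
      stepAux q x (stackOf w F (c :: lp) ax s) := by
  rw [stepAux, ← update_stackOf_loop w (lp := lp) (c :: lp)]
  rfl

theorem stepAux_pop_loop {f : Option Γ' → Option Bool → Option Γ'} :
    stepAux (.pop .loop f q) x (stackOf w F lp ax s) =
      stepAux q (f x lp.head?) (stackOf w F lp.tail ax s) := by
  rw [stepAux, ← update_stackOf_loop w (lp := lp) lp.tail]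
  rfl

theorem stepAux_pop_reg {f : Option Γ' → Option Bool → Option Γ'} :
    stepAux (.pop (.reg v) f q) x (stackOf w F lp ax s) =
      stepAux q (f x (List.replicate (s.ctr v) true).head?)
        (stackOf w F lp ax (s.set v (s.ctr v - 1))) := by
  rw [stepAux, ← update_stackOf_reg]
  simp [stackOf]

theorem stepAux_popTest {k : Stack V} {S : ∀ k : Stack V, List (Sym k)} {σ : Sym k}
    {l : List (Sym k)} (h : S k = σ :: l) :
    stepAux (popTest k q q') x S = stepAux q (some Γ'.blank) (Function.update S k l) := by
  simp [popTest, h]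

theorem stepAux_popTest_of_eq_nil {k : Stack V} {S : ∀ k : Stack V, List (Sym k)} (h : S k = []) :
    stepAux (popTest k q q') x S = stepAux q' none S := by
  have hS : Function.update S k [] = S := by rw [← h, Function.update_eq_self]
  simp [popTest, h, hS]

theorem stepAux_popTest_reg {y : ℕ} :
    stepAux (popTest (.reg v) q q') x (stackOf w F lp ax (s.set v (y + 1))) =
      stepAux q (some Γ'.blank) (stackOf w F lp ax (s.set v y)) := by
  rw [stepAux_popTest (l := List.replicate y true) (σ := true) (by simp [stackOf]; rfl),
    update_stackOf_reg, State.set_set]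

theorem stepAux_popTest_fuel :
    stepAux (popTest .fuel q q') x (stackOf w (F + 1) lp ax s) =
      stepAux q (some Γ'.blank) (stackOf w F lp ax s) := by
  rw [stepAux_popTest (l := List.replicate F true) (σ := true) rfl, update_stackOf_fuel]

theorem stepAux_popTest_aux :
    stepAux (popTest .aux q q') x (stackOf w F lp (ax + 1) s) =
      stepAux q (some Γ'.blank) (stackOf w F lp ax s) := by
  rw [stepAux_popTest (l := List.replicate ax true) (σ := true) rfl, update_stackOf_aux]

theorem stepAux_moveLeft_of_eq_cons {S : ∀ k : Stack V, List (Sym k)} {σ : Γ'} {l : List Γ'}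
    (h : S .before = σ :: l) :
    stepAux (moveLeft q q') x S = stepAux q (some σ)
      (Function.update (Function.update S .before l) .behind (σ :: S .behind : List Γ')) := by
  simp [moveLeft, h]

theorem stepAux_moveRight_of_eq_cons {S : ∀ k : Stack V, List (Sym k)} {σ : Γ'} {l : List Γ'}
    (h : S .behind = σ :: l) :
    stepAux (moveRight q q') x S = stepAux q (some σ)
      (Function.update (Function.update S .behind l) .before (σ :: S .before : List Γ')) := by
  simp [moveRight, h]

theorem stepAux_moveLeft (hs : s.pos ≤ w.length) (h0 : s.pos ≠ 0) :
    ∃ y, stepAux (moveLeft q q') x (stackOf w F lp ax s) =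
      stepAux q y (stackOf w F lp ax ⟨s.ctr, s.pos - 1⟩) := by
  obtain ⟨i, hi⟩ := Nat.exists_eq_succ_of_ne_zero h0
  have hlt : i < w.length := by omega
  have hbefore : stackOf w F lp ax s .before = (w[i] :: (w.take i).reverse : List Γ') := by
    simp only [stackOf, hi, Nat.succ_eq_add_one, List.take_succ_eq_append_getElem hlt,
      List.reverse_append, List.reverse_cons, List.reverse_nil, List.nil_append, List.cons_append]
  refine ⟨some w[i], ?_⟩
  rw [stepAux_moveLeft_of_eq_cons hbefore, hi, Nat.succ_sub_one,
    ← update_stackOf_before_behind w (s := s) i, List.drop_eq_getElem_cons hlt, stackOf, hi]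

theorem stepAux_moveLeft_of_pos_eq_zero (h0 : s.pos = 0) :
    stepAux (moveLeft q q') x (stackOf w F lp ax s) = stepAux q' none (stackOf w F lp ax s) := by
  have hbefore : stackOf w F lp ax s .before = [] := by simp [stackOf, h0]
  have hupdate : Function.update (stackOf w F lp ax s) .before [] = stackOf w F lp ax s := by
    rw [← hbefore, Function.update_eq_self]
  simp [moveLeft, hbefore, hupdate]

theorem stepAux_moveRight (hs : s.pos < w.length) :
    ∃ y, stepAux (moveRight q q') x (stackOf w F lp ax s) =
      stepAux q y (stackOf w F lp ax ⟨s.ctr, s.pos + 1⟩) := by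
  have hbehind : stackOf w F lp ax s .behind = (w[s.pos] :: w.drop (s.pos + 1) : List Γ') := by
    simp [stackOf]
  refine ⟨some w[s.pos], ?_⟩
  rw [stepAux_moveRight_of_eq_cons hbehind, ← update_stackOf_before_behind w (s := s) (s.pos + 1),
    List.take_succ_eq_append_getElem hs, Function.update_comm (by simp), stackOf]
  simp only [List.reverse_append, List.reverse_cons, List.reverse_nil, List.nil_append,
    List.cons_append]

theorem stepAux_moveRight_of_pos_eq_length (hs : s.pos = w.length) :
    stepAux (moveRight q q') x (stackOf w F lp ax s) = stepAux q' none (stackOf w F lp ax s) := by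
  have hbehind : stackOf w F lp ax s .behind = [] := by simp [stackOf, hs]
  have hupdate : Function.update (stackOf w F lp ax s) .behind [] = stackOf w F lp ax s := by
    rw [← hbehind, Function.update_eq_self]
  simp [moveRight, hbehind, hupdate]

end Stacks

section Reach

variable {Λ : Type} {M : Λ → Code V Λ}

/-- The machine `M` gets from the configuration `c` to `c'` in at most `t` steps. -/
def Reach (M : Λ → Code V Λ) (c c' : Turing.TM2.Cfg (Sym (V := V)) Λ (Option Γ')) (t : ℕ) : Prop :=
  Nonempty (StateTransition.EvalsToInTime (Turing.TM2.step M) c (some c') t)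

variable {c c' c'' : Turing.TM2.Cfg (Sym (V := V)) Λ (Option Γ')} {t t' : ℕ}

theorem Reach.refl : Reach M c c 0 := ⟨.refl _ _⟩

theorem Reach.mono (h : Reach M c c' t) (ht : t ≤ t') : Reach M c c' t' :=
  let ⟨h⟩ := h
  ⟨h.toEvalsTo, h.steps_le_m.trans ht⟩

theorem Reach.trans (h : Reach M c c' t) (h' : Reach M c' c'' t') : Reach M c c'' (t + t') :=
  let ⟨h⟩ := h
  let ⟨h'⟩ := h'
  Reach.mono ⟨.trans _ _ _ _ _ _ h h'⟩ (Nat.add_comm _ _).le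

theorem Reach.single {l : Λ} {x S} (h : Turing.TM2.stepAux (M l) x S = c') :
    Reach M ⟨some l, x, S⟩ c' 1 :=
  ⟨⟨1, congrArg some h⟩, le_rfl⟩

section Loop

variable (w : List Γ') {v : V} {ι : LoopLabel → Λ} {body out : Λ}

theorem reach_count (hM : ∀ l, M (ι l) = loopCode v ι body out l) {F x : ℕ} (h : x = 0 ∨ F = 0)
    (s : State V) (k : ℕ) : ∀ (lp : List Bool) (ax : ℕ),
      Reach M ⟨some (ι .count), none, stackOf w (F + k) lp ax (s.set v (x + k))⟩
        ⟨some (ι .restore), none,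
          stackOf w F (List.replicate k true ++ lp) (ax + k) (s.set v x)⟩ (k + 1) := by
  induction k with
  | zero =>
    intro lp ax
    refine Reach.single ?_
    rw [hM, loopCode]
    obtain _ | x := x
    · rw [stepAux_popTest_of_eq_nil (by simp [stackOf]), stepAux_jump]
      rfl
    · obtain rfl : F = 0 := by simpa using h
      rw [add_zero, stepAux_popTest_reg, stepAux_popTest_of_eq_nil rfl, stepAux_push_reg,
        stepAux_jump, State.set_set, State.ctr_set_self]
      rfl
  | succ k ih =>
    intro lp ax
    have hstep : Reach M
        ⟨some (ι .count), none, stackOf w (F + (k + 1)) lp ax (s.set v (x + (k + 1)))⟩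
        ⟨some (ι .count), none, stackOf w (F + k) (true :: lp) (ax + 1) (s.set v (x + k))⟩ 1 := by
      refine Reach.single ?_
      rw [hM, loopCode, ← add_assoc, ← add_assoc, stepAux_popTest_reg, stepAux_popTest_fuel,
        stepAux_push_aux, stepAux_push_loop, stepAux_jump]
    have hrest := ih (true :: lp) (ax + 1)
    rw [Nat.add_right_comm ax] at hrest
    rw [List.replicate_succ', List.append_assoc]
    exact (hstep.trans hrest).mono (by omega)

theorem reach_restore (hM : ∀ l, M (ι l) = loopCode v ι body out l) (lp : List Bool) (s : State V)
    (k : ℕ) : ∀ F x : ℕ,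
      Reach M ⟨some (ι .restore), none, stackOf w F lp k (s.set v x)⟩
        ⟨some (ι .next), none, stackOf w (F + k) lp 0 (s.set v (x + k))⟩ (k + 1) := by
  induction k with
  | zero =>
    intro F x
    refine Reach.single ?_
    rw [hM, loopCode, stepAux_popTest_of_eq_nil rfl, stepAux_jump]
    rfl
  | succ k ih =>
    intro F x
    have hstep : Reach M ⟨some (ι .restore), none, stackOf w F lp (k + 1) (s.set v x)⟩
        ⟨some (ι .restore), none, stackOf w (F + 1) lp k (s.set v (x + 1))⟩ 1 := by
      refine Reach.single ?_
      rw [hM, loopCode, stepAux_popTest_aux, stepAux_push_reg, stepAux_push_fuel, stepAux_jump,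
        State.set_set, State.ctr_set_self]
    have hrest := ih (F + 1) (x + 1)
    rw [Nat.add_right_comm F, Nat.add_right_comm x] at hrest
    exact (hstep.trans hrest).mono (by omega)

theorem reach_next (hM : ∀ l, M (ι l) = loopCode v ι body out l) {p : Program V} {F t : ℕ}
    {lp : List Bool}
    (hbody : ∀ (s : State V) lp, s.pos ≤ w.length →
      Reach M ⟨some body, none, stackOf w F lp 0 s⟩
        ⟨some (ι .next), none, stackOf w F lp 0 (p.eval w F s)⟩ t) (k : ℕ) :
    ∀ s : State V, s.pos ≤ w.length →
      Reach M ⟨some (ι .next), none, stackOf w F (List.replicate k true ++ false :: lp) 0 s⟩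
        ⟨some out, none, stackOf w F lp 0 ((p.eval w F)^[k] s)⟩ (k * (t + 1) + 1) := by
  induction k with
  | zero =>
    intro s _
    refine (Reach.single ?_).mono (Nat.le_add_left _ _)
    rw [hM, loopCode, stepAux_pop_loop]
    rfl
  | succ k ih =>
    intro s hs
    refine (((Reach.single ?_).trans (hbody s (List.replicate k true ++ false :: lp) hs)).trans
      (ih _ (pos_eval_le w F p s hs))).mono (by ring_nf; omega)
    rw [hM, loopCode, stepAux_pop_loop]
    rfl

theorem reach_loop (hM : ∀ l, M (ι l) = loopCode v ι body out l) {p : Program V} {F t : ℕ}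
    (hbody : ∀ (s : State V) lp, s.pos ≤ w.length →
      Reach M ⟨some body, none, stackOf w F lp 0 s⟩
        ⟨some (ι .next), none, stackOf w F lp 0 (p.eval w F s)⟩ t)
    (s : State V) (lp : List Bool) (hs : s.pos ≤ w.length) :
    Reach M ⟨some (ι .mark), none, stackOf w F lp 0 s⟩
      ⟨some out, none, stackOf w F lp 0 ((rep v p).eval w F s)⟩ (F * t + 3 * F + 4) := by
  set k := min (s.ctr v) F
  have hmark : Reach M ⟨some (ι .mark), none, stackOf w F lp 0 s⟩
      ⟨some (ι .count), none, stackOf w F (false :: lp) 0 s⟩ 1 :=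
    Reach.single (by rw [hM, loopCode, stepAux_push_loop]; rfl)
  have hcount := reach_count w hM (F := F - k) (x := s.ctr v - k) (by omega) s k (false :: lp) 0
  have hrestore := reach_restore w hM (List.replicate k true ++ false :: lp) s k (F - k)
    (s.ctr v - k)
  rw [Nat.sub_add_cancel (by omega), Nat.sub_add_cancel (by omega), State.set_ctr_self]
    at hcount hrestore
  rw [Nat.zero_add] at hcount
  have hnext := reach_next w hM (lp := lp) hbody k s hs
  refine (((hmark.trans hcount).trans hrestore).trans hnext).mono ?_
  have hkF : k ≤ F := min_le_right _ _
  linarith [Nat.mul_le_mul_right t hkF]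

end Loop

theorem reach_moveLeft {l out : Λ} (w : List Γ') {F : ℕ} {lp : List Bool} {s : State V}
    (hM : M l = moveLeft (jump out) (jump out)) (hs : s.pos ≤ w.length) :
    Reach M ⟨some l, none, stackOf w F lp 0 s⟩
      ⟨some out, none, stackOf w F lp 0 ⟨s.ctr, s.pos - 1⟩⟩ 1 := by
  refine Reach.single ?_
  rw [hM]
  obtain h0 | h0 := eq_or_ne s.pos 0
  · rw [stepAux_moveLeft_of_pos_eq_zero w h0, stepAux_jump, h0, Nat.zero_sub, ← h0]
  · obtain ⟨_, h⟩ := stepAux_moveLeft w hs h0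
    exact h

theorem reach_moveRight {l out : Λ} (w : List Γ') {F : ℕ} {lp : List Bool} {s : State V}
    (hM : M l = moveRight (jump out) (jump out)) (hs : s.pos ≤ w.length) :
    Reach M ⟨some l, none, stackOf w F lp 0 s⟩
      ⟨some out, none, stackOf w F lp 0 ⟨s.ctr, min (s.pos + 1) w.length⟩⟩ 1 := by
  refine Reach.single ?_
  rw [hM]
  obtain hlen | hlt := hs.eq_or_lt
  · rw [stepAux_moveRight_of_pos_eq_length w hlen, stepAux_jump, min_eq_right (by omega), ← hlen]
  · obtain ⟨_, h⟩ := stepAux_moveRight w hlt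
    rw [h, stepAux_jump, min_eq_left (by omega)]

theorem reach_code (w : List Γ') (F : ℕ) (p : Program V) :
    ∀ (ι : p.Label → Λ) (out : Λ), (∀ l, M (ι l) = p.code ι out l) →
    ∀ (s : State V) (lp : List Bool), s.pos ≤ w.length →
      Reach M ⟨some (ι p.entry), none, stackOf w F lp 0 s⟩
        ⟨some out, none, stackOf w F lp 0 (p.eval w F s)⟩ (p.cost.eval F) := by
  induction p with
  | skip =>
    intro ι out hM s lp _
    simpa only [cost, Polynomial.eval_one] using Reach.single (by rw [hM]; rfl)
  | inc v =>
    intro ι out hM s lp _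
    simpa only [cost, Polynomial.eval_one] using
      Reach.single (by rw [hM, code, stepAux_push_reg]; rfl)
  | dec v =>
    intro ι out hM s lp _
    simpa only [cost, Polynomial.eval_one] using
      Reach.single (by rw [hM, code, stepAux_pop_reg]; rfl)
  | left =>
    intro ι out hM s lp hs
    simpa only [cost, Polynomial.eval_one, eval] using reach_moveLeft w (hM _) hs
  | right =>
    intro ι out hM s lp hs
    simpa only [cost, Polynomial.eval_one, eval] using reach_moveRight w (hM _) hs
  | seq p q hp hq =>
    intro ι out hM s lp hs
    simp only [cost, Polynomial.eval_add]
    exact (hp (fun l => ι (.inl l)) (ι (.inr q.entry)) (fun _ => hM _) s lp hs).trans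
      (hq (fun l => ι (.inr l)) out (fun _ => hM _) _ lp (pos_eval_le w F p s hs))
  | ifz v p q hp hq =>
    intro ι out hM s lp hs
    simp only [cost, Polynomial.eval_add, Polynomial.eval_one, eval]
    split_ifs with h0
    · refine ((Reach.single ?_).trans
        (hp (fun l => ι (.inr (.inl l))) out (fun _ => hM _) s lp hs)).mono (by omega)
      simp [entry, hM, code, stackOf, h0, stepAux_jump]
    · refine ((Reach.single ?_).trans
        (hq (fun l => ι (.inr (.inr l))) out (fun _ => hM _) s lp hs)).mono (by omega)
      simp [entry, hM, code, stackOf, h0, stepAux_jump, List.head?_replicate]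
  | ifOne p q hp hq =>
    intro ι out hM s lp hs
    simp only [cost, Polynomial.eval_add, Polynomial.eval_one, eval]
    split_ifs with h0
    · refine ((Reach.single ?_).trans
        (hp (fun l => ι (.inr (.inl l))) out (fun _ => hM _) s lp hs)).mono (by omega)
      simp [entry, hM, code, stackOf, h0, stepAux_jump]
    · refine ((Reach.single ?_).trans
        (hq (fun l => ι (.inr (.inr l))) out (fun _ => hM _) s lp hs)).mono (by omega)
      simp [entry, hM, code, stackOf, h0, stepAux_jump]
  | rep v p hp =>
    intro ι out hM s lp hs
    simp only [cost, Polynomial.eval_add, Polynomial.eval_mul, Polynomial.eval_X,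
      Polynomial.eval_ofNat]
    exact reach_loop w (ι := fun l => ι (.inl l)) (fun _ => hM _)
      (hp (fun l => ι (.inr l)) (ι (.inl .next)) fun _ => hM _) s lp hs

end Reach

section Machine

/-- The labels of the machine that runs a program, except for those of the program itself. -/
inductive Phase : Type
  /-- move the head to the right end of the tape, thereby initializing the bound for the loops -/
  | measure
  /-- erase the tape -/
  | eraseTape
  /-- erase the bound for the loops -/
  | eraseFuel
  deriving DecidableEq

instance : Fintype Phase where
  elems := {.measure, .eraseTape, .eraseFuel}
  complete l := by cases l <;> decide

/-- Add four to the bound for the loops and to the counter `big`. -/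
def charge {Λ : Type} (big : V) (q : Code V Λ) : Code V Λ :=
  .push .fuel (fun _ => true) <| .push .fuel (fun _ => true) <|
  .push .fuel (fun _ => true) <| .push .fuel (fun _ => true) <|
  .push (.reg big) (fun _ => true) <| .push (.reg big) (fun _ => true) <|
  .push (.reg big) (fun _ => true) <| .push (.reg big) (fun _ => true) q

/-- The code of the machine that runs the program `p`. The loops of `p` are bounded by four times
the length of the tape, and `p` is started with this number in the counter `big`. As the output
is one of the stacks of the final configuration and the others have to be empty, the tape and the
bound are erased in the end. -/
def machineCode (p : Program V) (big : V) : Phase ⊕ p.Label → Code V (Phase ⊕ p.Label)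
  | .inl .measure => moveRight (charge big (jump (.inl .measure))) (jump (.inr p.entry))
  | .inl .eraseTape => popTest .behind (jump (.inl .eraseTape)) (jump (.inl .eraseFuel))
  | .inl .eraseFuel => popTest .fuel (jump (.inl .eraseFuel)) .halt
  | .inr l => p.code .inr (.inl .eraseTape) l

/-- The machine that runs the program `p` and outputs the counter `out`. -/
def machine [Fintype V] (p : Program V) (big out : V) : Turing.FinTM2 where
  K := Stack V
  k₀ := .behind
  k₁ := .reg out
  Γ := Sym
  Λ := Phase ⊕ p.Label
  main := .inl .measure
  σ := Option Γ'
  initialState := none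
  Γk₀Fin := inferInstanceAs (Fintype Γ')
  m := p.machineCode big

/-- The state with the value `x` of the counter `v` and all other counters zero. -/
def single (v : V) (x i : ℕ) : State V := ⟨Function.update (fun _ => 0) v x, i⟩

theorem reach_measure (p : Program V) (big : V) (w : List Γ') (i : ℕ) (hi : i ≤ w.length) :
    Reach (p.machineCode big) ⟨some (.inl .measure), none, stackOf w 0 [] 0 ⟨fun _ => 0, 0⟩⟩
      ⟨some (.inl .measure), none, stackOf w (4 * i) [] 0 (single big (4 * i) i)⟩ i := by
  induction i with
  | zero => simpa [single] using Reach.refl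
  | succ i ih =>
    refine (ih (by omega)).trans (Reach.single ?_)
    obtain ⟨_, h⟩ := stepAux_moveRight w (s := single big (4 * i) i) hi
    rw [machineCode, h, charge]
    simp only [stepAux_push_fuel, stepAux_push_reg, stepAux_jump, State.set_set, State.ctr_set_self]
    simp [single, State.set, mul_add]

theorem reach_erase_tape (p : Program V) (big : V) (F : ℕ) (c : V → ℕ) (w : List Γ') :
    Reach (p.machineCode big) ⟨some (.inl .eraseTape), none, stackOf w F [] 0 ⟨c, 0⟩⟩
      ⟨some (.inl .eraseFuel), none, stackOf [] F [] 0 ⟨c, 0⟩⟩ (w.length + 1) := by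
  induction w with
  | nil =>
    refine Reach.single ?_
    rw [machineCode, stepAux_popTest_of_eq_nil rfl]
    rfl
  | cons a w ih =>
    refine ((Reach.single ?_).trans ih).mono (by rw [List.length_cons]; omega)
    have hupdate : Function.update (stackOf (a :: w) F [] 0 ⟨c, 0⟩) .behind w =
        stackOf w F [] 0 ⟨c, 0⟩ := by
      funext k
      cases k <;> simp [stackOf]
    rw [machineCode, stepAux_popTest rfl, stepAux_jump]
    exact congrArg _ hupdate

theorem reach_erase_fuel (p : Program V) (big : V) (c : V → ℕ) (F : ℕ) :
    Reach (p.machineCode big) ⟨some (.inl .eraseFuel), none, stackOf [] F [] 0 ⟨c, 0⟩⟩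
      ⟨none, none, stackOf [] 0 [] 0 ⟨c, 0⟩⟩ (F + 1) := by
  induction F with
  | zero =>
    refine Reach.single ?_
    rw [machineCode, stepAux_popTest_of_eq_nil rfl]
    rfl
  | succ F ih =>
    refine ((Reach.single ?_).trans ih).mono (by omega)
    rw [machineCode, stepAux_popTest_fuel, stepAux_jump]

theorem initList_machine [Fintype V] (p : Program V) (big out : V) (w : List Γ') :
    Turing.initList (p.machine big out) w =
      ⟨some (.inl .measure), none, stackOf w 0 [] 0 ⟨fun _ => 0, 0⟩⟩ := by
  unfold Turing.initList
  congr 1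
  funext k
  cases k <;> rfl

theorem haltList_machine [Fintype V] (p : Program V) (big out : V) (r : ℕ) :
    Turing.haltList (p.machine big out) (List.replicate r true : List Bool) =
      ⟨none, none, stackOf [] 0 [] 0 (single out r 0)⟩ := by
  unfold Turing.haltList
  congr 1
  funext k
  cases k with
  | reg u =>
    obtain rfl | hu := eq_or_ne u out
    · exact (dif_pos rfl).trans (by simp only [stackOf, single, Function.update_self]; rfl)
    · exact (dif_neg fun h => hu (Stack.reg.inj h)).trans
        (by simp only [stackOf, single, Function.update_of_ne hu, List.replicate_zero]; rfl)
  | _ => rfl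

theorem machine_outputs [Fintype V] (p : Program V) (big out : V) (w : List Γ') (r : ℕ)
    (h : p.eval w (4 * w.length) (single big (4 * w.length) w.length) = single out r 0) :
    Nonempty (Turing.TM2OutputsInTime (p.machine big out) w
      (some (List.replicate r true : List Bool))
      (p.cost.eval (4 * w.length) + 6 * w.length + 4)) := by
  set F := 4 * w.length
  have hmeasure := reach_measure p big w w.length le_rfl
  have hstart : Reach (p.machineCode big)
      ⟨some (.inl .measure), none, stackOf w F [] 0 (single big F w.length)⟩
      ⟨some (.inr p.entry), none, stackOf w F [] 0 (single big F w.length)⟩ 1 :=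
    Reach.single (by rw [machineCode, stepAux_moveRight_of_pos_eq_length w rfl, stepAux_jump])
  have hrun := reach_code w F p (M := p.machineCode big) .inr (.inl .eraseTape) (fun _ => rfl)
    (single big F w.length) [] le_rfl
  rw [h] at hrun
  have htape := reach_erase_tape p big F (single out r 0).ctr w
  have hfuel := reach_erase_fuel p big (single out r 0).ctr F
  unfold Turing.TM2OutputsInTime
  rw [initList_machine]
  change Nonempty (StateTransition.EvalsToInTime _ _ (some (Turing.haltList _ _)) _)
  rw [haltList_machine]
  exact ((((hmeasure.trans hstart).trans hrun).trans htape).trans hfuel).mono (by omega)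

end Machine

section Generic

variable {V : Type} [DecidableEq V] {w : List Γ'} {F : ℕ}

theorem eval_rep_induction {v : V} {p : Program V} {s : State V} (hs : s.ctr v ≤ F)
    {P : ℕ → State V → Prop} (h₀ : P 0 s)
    (h : ∀ t < s.ctr v, ∀ s', P t s' → P (t + 1) (p.eval w F s')) :
    P (s.ctr v) ((rep v p).eval w F s) := by
  rw [eval, min_eq_left hs]
  suffices ∀ t ≤ s.ctr v, P t ((p.eval w F)^[t] s) from this _ le_rfl
  intro t ht
  induction t with
  | zero => exact h₀
  | succ t ih =>
    rw [Function.iterate_succ_apply']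
    exact h t ht _ (ih (by omega))

theorem eval_rep_eq {v : V} {p : Program V} {s : State V} (hs : s.ctr v ≤ F) (S : ℕ → State V)
    (h₀ : S 0 = s) (h : ∀ t < s.ctr v, p.eval w F (S t) = S (t + 1)) :
    (rep v p).eval w F s = S (s.ctr v) :=
  eval_rep_induction (P := fun t s' => s' = S t) hs h₀.symm fun t ht _ hs' => by rw [hs', h t ht]

/-- Add the constant `q` to the counter `v`. -/
def incs (v : V) : ℕ → Program V
  | 0 => skip
  | q + 1 => seq (inc v) (incs v q)

theorem eval_incs (v : V) (q : ℕ) (s : State V) :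
    (incs v q).eval w F s = s.set v (s.ctr v + q) := by
  induction q generalizing s with
  | zero => simp [incs, eval]
  | succ q ih => simp [incs, eval, ih, add_assoc, add_comm 1 q]

/-- Set the counter `v` to zero. -/
def clear (v : V) : Program V := rep v (dec v)

theorem eval_clear {v : V} {s : State V} (hs : s.ctr v ≤ F) :
    (clear v).eval w F s = s.set v 0 := by
  rw [clear, eval_rep_eq hs (fun t => s.set v (s.ctr v - t)) (by simp)]
  · simp
  · intro t _
    simp [eval, Nat.sub_sub]

/-- Add `q` times the counter `u` to the counter `v`. -/
def addMul (q : ℕ) (u v : V) : Program V := rep u (incs v q)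

theorem eval_addMul {q : ℕ} {u v : V} {s : State V} (hs : s.ctr u ≤ F) :
    (addMul q u v).eval w F s = s.set v (s.ctr v + q * s.ctr u) := by
  rw [addMul, eval_rep_eq hs (fun t => s.set v (s.ctr v + q * t)) (by simp)]
  intro t _
  simp [eval_incs, mul_add, add_assoc]

/-- Add the minimum of the counters `u` and `v` to the counter `x`, and set `v` to zero. -/
def addMin (u v x : V) : Program V :=
  seq (rep u (ifz v skip (seq (dec v) (inc x)))) (clear v)

theorem eval_addMin {u v x : V} {s : State V} (hu : s.ctr u ≤ F) (hv : s.ctr v ≤ F)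
    (hvx : v ≠ x) :
    (addMin u v x).eval w F s = (s.set v 0).set x (s.ctr x + min (s.ctr u) (s.ctr v)) := by
  rw [addMin, eval, eval_rep_eq hu
    (fun t => (s.set x (s.ctr x + min t (s.ctr v))).set v (s.ctr v - t)) (by simp)]
  · rw [eval_clear (by rw [State.ctr_set_self]; omega), State.set_set, State.set_comm _ hvx.symm]
  · intro t _
    rw [eval, State.ctr_set_self]
    split_ifs with h0
    · rw [eval, min_eq_right (by omega), min_eq_right (by omega), h0, Nat.sub_add_eq, h0]
    · rw [min_eq_left (by omega), min_eq_left (by omega)]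
      simp only [eval, State.ctr_set_self, State.set_set, State.ctr_set, if_neg hvx.symm]
      rw [State.set_comm _ hvx, State.set_set, add_assoc, Nat.sub_sub]

/-- Run `p` for all values of the counter `i` that are less than the counter `lim`. -/
def forLoop (i lim : V) (p : Program V) : Program V := seq (rep lim (seq p (inc i))) (clear i)

theorem eval_forLoop_induction {i lim : V} {p : Program V} {s : State V} (hl : s.ctr lim ≤ F)
    {P : ℕ → State V → Prop} (hi : ∀ t s', P t s' → s'.ctr i = 0) (h₀ : P 0 s)
    (h : ∀ t < s.ctr lim, ∀ s', P t s' →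
      ∃ s'', P (t + 1) s'' ∧ p.eval w F (s'.set i t) = s''.set i t) :
    P (s.ctr lim) ((forLoop i lim p).eval w F s) := by
  obtain ⟨s', hs', heval⟩ := eval_rep_induction (w := w) (p := seq p (inc i))
    (P := fun t s₁ => ∃ s', P t s' ∧ s₁ = s'.set i t) hl
    ⟨s, h₀, by rw [← hi 0 s h₀, State.set_ctr_self]⟩ (by
      rintro t ht _ ⟨s', hs', rfl⟩
      obtain ⟨s'', hs'', heval⟩ := h t ht s' hs'
      exact ⟨s'', hs'', by rw [eval, heval, eval, State.ctr_set_self, State.set_set]⟩)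
  rw [forLoop, eval, heval, eval_clear (by rwa [State.ctr_set_self]), State.set_set, ← hi _ _ hs',
    State.set_ctr_self]
  exact hs'

theorem eval_forLoop {i lim : V} {p : Program V} {s : State V} (hl : s.ctr lim ≤ F)
    (S : ℕ → State V) (hi : ∀ t, (S t).ctr i = 0) (h₀ : S 0 = s)
    (h : ∀ t < s.ctr lim, p.eval w F ((S t).set i t) = (S (t + 1)).set i t) :
    (forLoop i lim p).eval w F s = S (s.ctr lim) :=
  eval_forLoop_induction (P := fun t s' => s' = S t) hl (fun t _ hs' => hs' ▸ hi t) h₀.symm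
    fun t ht _ hs' => ⟨_, rfl, hs' ▸ h t ht⟩

theorem iterate_left (s : State V) (k : ℕ) :
    ((left : Program V).eval w F)^[k] s = ⟨s.ctr, s.pos - k⟩ := by
  induction k with
  | zero => rfl
  | succ k ih => rw [Function.iterate_succ_apply', ih, eval, Nat.sub_sub]

theorem iterate_right (s : State V) (hs : s.pos ≤ w.length) (k : ℕ) :
    ((right : Program V).eval w F)^[k] s = ⟨s.ctr, min (s.pos + k) w.length⟩ := by
  induction k with
  | zero => rw [Function.iterate_zero_apply, Nat.add_zero, min_eq_left hs]
  | succ k ih =>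
    rw [Function.iterate_succ_apply', ih, eval]
    congr 1
    dsimp only
    omega

/-- Move the head to the left by the value of the counter `big`. -/
def rewind (big : V) : Program V := rep big left

theorem eval_rewind {big : V} {c : V → ℕ} {i : ℕ} (hb : c big = F) (hi : i ≤ F) :
    (rewind big).eval w F ⟨c, i⟩ = ⟨c, 0⟩ := by
  rw [rewind, eval, iterate_left]
  simp [hb, hi]

theorem eval_rep_right {v : V} {c : V → ℕ} {i : ℕ} (hv : c v ≤ F) (hi : i ≤ w.length) :
    (rep v right).eval w F ⟨c, i⟩ = ⟨c, min (i + c v) w.length⟩ := by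
  rw [eval, min_eq_left hv, iterate_right _ hi]

/-- Skip all ones to the right of the head, running `p` for each of them, and then skip the next
symbol. The counter `big` has to be at least the number of ones. -/
def readUnary (big : V) (p : Program V) : Program V :=
  seq (rep big (ifOne (seq right p) skip)) right

theorem getElem?_encodeUnary_append {k t : ℕ} (ht : t ≤ k) (pre post : List Γ') :
    (pre ++ (encodeUnary k ++ post))[pre.length + t]? = some (Γ'.bit true) ↔ t < k := by
  rw [List.getElem?_append_right (by omega), Nat.add_sub_cancel_left, encodeUnary,
    List.append_assoc]
  obtain ht | rfl := ht.lt_or_eq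
  · simp [ht, List.getElem?_append_left]
  · simp

theorem eval_readUnary {big : V} {c : V → ℕ} (hb : c big = F) {pre post : List Γ'} {k : ℕ}
    (hw : w = pre ++ (encodeUnary k ++ post)) (hk : k ≤ F) {p : Program V}
    {f : (V → ℕ) → V → ℕ} (hp : ∀ c i, p.eval w F ⟨c, i⟩ = ⟨f c, i⟩) :
    (readUnary big p).eval w F ⟨c, pre.length⟩ = ⟨f^[k] c, pre.length + k + 1⟩ := by
  have hlen : w.length = pre.length + (k + 1 + post.length) := by
    rw [hw, List.length_append, List.length_append, encodeUnary, List.length_append,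
      List.length_replicate, List.length_singleton]
  rw [readUnary, eval, eval_rep_eq (s := ⟨c, pre.length⟩) hb.le
    (fun t => ⟨f^[min t k] c, pre.length + min t k⟩) (by simp)]
  · simp only [hb, min_eq_right hk]
    rw [eval, min_eq_left (by dsimp only; omega)]
  · intro t _
    have hread : w[pre.length + min t k]? = some (Γ'.bit true) ↔ min t k < k := by
      rw [hw, getElem?_encodeUnary_append (min_le_right t k)]
    rw [eval]
    dsimp only
    obtain ht | ht := lt_or_ge t k
    · rw [if_pos (hread.2 (by omega)), min_eq_left ht.le, min_eq_left (by omega : t + 1 ≤ k), eval,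
        eval, hp, Function.iterate_succ_apply', min_eq_left (by dsimp only; omega), add_assoc]
    · rw [if_neg (by rw [hread]; omega), min_eq_right ht, min_eq_right (by omega : k ≤ t + 1), eval]

end Generic

end Program

/-- Membership in `X`, for natural numbers as indices. -/
def HasEntry {m n : ℕ} (X : Finset (Fin m × Fin n)) (i j : ℕ) : Prop :=
  ∃ (hi : i < m) (hj : j < n), (⟨i, hi⟩, ⟨j, hj⟩) ∈ X

section Bounds

variable {m n : ℕ}

open Classical in
/-- The number of elements of `X` in the column `j`. -/
noncomputable def columnCount (X : Finset (Fin m × Fin n)) (j : ℕ) : ℕ :=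
  ((Finset.range m).filter fun i => HasEntry X i j).card

open Classical in
/-- The indicator function of `X`. -/
noncomputable def entryBit (X : Finset (Fin m × Fin n)) (i j : ℕ) : ℕ :=
  if HasEntry X i j then 1 else 0

/-- The indicator function of the columns that meet `X` both in one of the rows `i`, `i'` and in one
of the rows `k`, `k'`. -/
noncomputable def crossBit (X : Finset (Fin m × Fin n)) (i i' k k' j : ℕ) : ℕ :=
  min (max (entryBit X i j) (entryBit X i' j)) (max (entryBit X k j) (entryBit X k' j))

/-- The bound for the rank of `X` in `ℬ_{m,n}(a,b)` that is obtained from `q` spanning rows and, for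
each column `j`, from a subspace of dimension `a + c j`. -/
noncomputable def rankBound (a b : ℕ) (X : Finset (Fin m × Fin n)) (q : ℕ) (c : ℕ → ℕ) : ℕ :=
  q * b + ∑ j ∈ Finset.range n, min (columnCount X j) (a + c j)

/-- The bounds for the rank whose minimum is the rank if `m - a ≤ 3`. The row indices run up to
`a + 3`, as if `X` were padded with empty rows. -/
def rankBounds (X : Finset (Fin m × Fin n)) (a b : ℕ) : Set ℕ :=
  {rankBound a b X 0 fun _ => 3} ∪ ({rankBound a b X 3 fun _ => 0} ∪
    ⋃ i < a + 3, ({rankBound a b X 2 fun j => entryBit X i j} ∪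
      ⋃ i' < i, ({rankBound a b X 1 fun j => entryBit X i j + entryBit X i' j} ∪
        ⋃ k < a + 3, ⋃ k' < k, {rankBound a b X 2 (crossBit X i i' k k')})))

theorem entryBit_le (X : Finset (Fin m × Fin n)) (i j : ℕ) : entryBit X i j ≤ 1 := by
  rw [entryBit]
  split_ifs <;> simp

theorem crossBit_le (X : Finset (Fin m × Fin n)) (i i' k k' j : ℕ) : crossBit X i i' k k' j ≤ 1 :=
  (min_le_left _ _).trans (max_le (entryBit_le X i j) (entryBit_le X i' j))

open Classical in
theorem columnCount_le (X : Finset (Fin m × Fin n)) (j : ℕ) : columnCount X j ≤ m :=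
  (Finset.card_filter_le _ _).trans (Finset.card_range m).le

open Classical in
theorem card_filter_hasEntry (X : Finset (Fin m × Fin n)) (j : ℕ) {k : ℕ} (hk : m ≤ k) :
    ((Finset.range k).filter fun i => HasEntry X i j).card = columnCount X j := by
  refine congrArg Finset.card (Finset.ext fun i => ?_)
  simp only [Finset.mem_filter, Finset.mem_range]
  exact ⟨fun ⟨_, h⟩ => ⟨h.1, h⟩, fun ⟨h, h'⟩ => ⟨h.trans_le hk, h'⟩⟩

theorem rankBound_le (a b : ℕ) (X : Finset (Fin m × Fin n)) (q : ℕ) (c : ℕ → ℕ) :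
    rankBound a b X q c ≤ q * b + n * m := by
  refine Nat.add_le_add_left ((Finset.sum_le_card_nsmul _ _ m fun j _ =>
    (min_le_left _ _).trans (columnCount_le X j)).trans ?_) _
  rw [Finset.card_range, smul_eq_mul]

end Bounds

theorem getElem?_flatMap_of_length_eq {α β : Type*} {f : α → List β} {c : ℕ}
    (hf : ∀ x, (f x).length = c) (l : List α) (p : ℕ) {j : ℕ} (hj : j < c) :
    (l.flatMap f)[p * c + j]? = l[p]?.bind fun x => (f x)[j]? := by
  induction l generalizing p with
  | nil => simp
  | cons x l ih =>
    rw [List.flatMap_cons]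
    cases p with
    | zero => simp [List.getElem?_append_left ((hf x).symm ▸ hj)]
    | succ p =>
      have hle : (f x).length ≤ (p + 1) * c + j := by rw [hf, add_mul]; omega
      rw [List.getElem?_append_right hle, hf, Nat.succ_mul, Nat.add_right_comm, Nat.add_sub_cancel,
        ih, List.getElem?_cons_succ]

theorem length_encodeUnary (k : ℕ) : (encodeUnary k).length = k + 1 := by simp [encodeUnary]

section Input

variable {m n a b : ℕ} (X : Finset (Fin m × Fin n))

theorem length_encodeInput :
    (encodeInput m n a b X).length = m + n + a + b + 4 + m * (n + 1) := by
  simp only [encodeInput, List.length_append, length_encodeUnary, List.length_flatMap,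
    List.length_map, List.length_finRange, List.length_singleton, List.map_const',
    List.sum_replicate, smul_eq_mul]
  ring

theorem getElem?_encodeInput (i : ℕ) {j : ℕ} (hj : j < n) :
    (encodeInput m n a b X)[m + n + a + b + 4 + i * (n + 1) + j]? = some (Γ'.bit true) ↔
      HasEntry X i j := by
  have hheader : (encodeUnary m ++ encodeUnary n ++ encodeUnary a ++ encodeUnary b).length =
      m + n + a + b + 4 := by
    simp only [List.length_append, length_encodeUnary]
    ring
  rw [encodeInput, List.getElem?_append_right (by omega), hheader, add_assoc,
    Nat.add_sub_cancel_left, getElem?_flatMap_of_length_eq (c := n + 1) (by simp) _ _ (by omega)]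
  obtain hi | hi := lt_or_ge i m
  · simp [hi, hj, HasEntry, List.getElem?_append_left]
  · simp [hi, HasEntry]

end Input

/-- The counters of the rank program. The counter `big` bounds the number of iterations of all
loops, and `rows` has the value `a + 3`. The counters `i₁`, `i₂`, `k₁`, `k₂` hold the indices of the
rows that define a bound, and `best` holds the least bound found so far. The other counters are used
in the computation of one bound: `j` and `p` are the column and the row that are looked at, `cnt`
and `cap` are the two numbers whose minimum is added to the bound `cur`, and `new` becomes `best`.
-/
inductive Reg : Type
  | big | n | a | b | rows | i₁ | i₂ | k₁ | k₂ | j | p | cnt | cap | cur | best | new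
  deriving DecidableEq

namespace Reg

instance : Fintype Reg where
  elems := {.big, .n, .a, .b, .rows, .i₁, .i₂, .k₁, .k₂, .j, .p, .cnt, .cap, .cur, .best, .new}
  complete r := by cases r <;> decide

/-- The counters that hold the parameters of the problem. -/
def isParam : Reg → Bool
  | .big | .n | .a | .b | .rows => true
  | _ => false

/-- The counters that hold the indices of the rows that define a bound. -/
def isIndex : Reg → Bool
  | .i₁ | .i₂ | .k₁ | .k₂ => true
  | _ => false

/-- The counters that are zero except during the computation of one bound. -/
def isScratch : Reg → Bool
  | .j | .p | .cnt | .cap | .cur | .new => true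
  | _ => false

theorem isParam_of_isIndex : ∀ u : Reg, u.isIndex = true → u.isParam = false := by decide

theorem isScratch_of_isIndex : ∀ u : Reg, u.isIndex = true → u.isScratch = false := by decide

end Reg

namespace Program

/-- Move the head behind the four numbers `m`, `n`, `a`, `b` at the beginning of the tape, running
`p₁`, `p₂` and `p₃` as often as the last three of them say. -/
def readHeader (p₁ p₂ p₃ : Program Reg) : Program Reg :=
  seq (readUnary .big skip) (seq (readUnary .big p₁)
    (seq (readUnary .big p₂) (readUnary .big p₃)))

/-- Move the head from the left end to the entry of the matrix in the row `u` and the column `v`. -/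
def seekEntry (u v : Reg) : Program Reg :=
  seq (readHeader skip skip skip) (seq (rep u (seq (rep .n right) right)) (rep v right))

/-- Branch on the entry of the matrix in the row `u` and the column `v`, with the head at the left
end before and after. -/
def ifEntry (u v : Reg) (p q : Program Reg) : Program Reg :=
  seq (seekEntry u v) (ifOne (seq (rewind .big) p) (seq (rewind .big) q))

/-- Store the four numbers at the beginning of the tape and move the head to the left end. -/
def parse : Program Reg :=
  seq (rewind .big) (seq (readHeader (inc .n) (inc .a) (inc .b))
    (seq (rewind .big) (seq (addMul 1 .a .rows) (incs .rows 3))))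

/-- Count the entries of the column `j`. -/
def countColumn : Program Reg := forLoop .p .rows (ifEntry .p .j (inc .cnt) skip)

/-- Add the minimum of the number of entries in the column `j` and of `a` plus the number computed
by `c` to `cur`. -/
def column (c : Program Reg) : Program Reg :=
  seq countColumn (seq (addMul 1 .a .cap) (seq c (seq (addMin .cnt .cap .cur) (clear .cnt))))

/-- Replace `best` by the minimum of `best` and `cur`, and set `cur` to zero. -/
def updateBest : Program Reg :=
  seq (addMin .best .cur .new) (seq (clear .best) (seq (addMul 1 .new .best) (clear .new)))

/-- Take the bound given by `q` and `c` into account. -/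
def bound (q : ℕ) (c : Program Reg) : Program Reg :=
  seq (addMul q .b .cur) (seq (forLoop .j .n (column c)) updateBest)

/-- Add the entry in the row `u` and the column `j` to `cap`. -/
def addEntry (u : Reg) : Program Reg := ifEntry u .j (inc .cap) skip

/-- Add `crossBit` to `cap`, for the rows `u`, `v`, `u'`, `v'` and the column `j`. -/
def addCross (u v u' v' : Reg) : Program Reg :=
  let q := ifEntry u' .j (inc .cap) (ifEntry v' .j (inc .cap) skip)
  ifEntry u .j q (ifEntry v .j q skip)

/-- Minimize over the bounds that are defined by `i₁`, `i₂` and two other rows. -/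
def minimizeCross : Program Reg :=
  forLoop .k₁ .rows (forLoop .k₂ .k₁ (bound 2 (addCross .i₁ .i₂ .k₁ .k₂)))

/-- Minimize over the bounds that are defined by `i₁` and other rows. -/
def minimizePairs : Program Reg :=
  forLoop .i₂ .i₁ (seq (bound 1 (seq (addEntry .i₁) (addEntry .i₂))) minimizeCross)

/-- Minimize over all bounds. -/
def minimize : Program Reg :=
  seq (bound 0 (incs .cap 3)) (seq (bound 3 skip)
    (forLoop .i₁ .rows (seq (bound 2 (addEntry .i₁)) minimizePairs)))

/-- The program that computes the least bound. -/
def rankProgram : Program Reg :=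
  seq parse (seq (addMul 1 .big .best) (seq minimize (seq (clear .n) (seq (clear .a)
    (seq (clear .b) (seq (clear .rows) (clear .big)))))))

section Iterate

variable {V : Type}

theorem iterate_apply_of_forall {f : (V → ℕ) → V → ℕ} {v : V} (hf : ∀ c, f c v = c v) (k : ℕ)
    (c : V → ℕ) : f^[k] c v = c v := by
  induction k with
  | zero => rfl
  | succ k ih => rw [Function.iterate_succ_apply', hf, ih]

theorem iterate_update_add_one [DecidableEq V] (v : V) (k : ℕ) (c : V → ℕ) :
    (fun c : V → ℕ => Function.update c v (c v + 1))^[k] c = Function.update c v (c v + k) := by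
  induction k with
  | zero => simp
  | succ k ih => rw [Function.iterate_succ_apply', ih]; simp [add_assoc]

end Iterate

section Semantics

attribute [local simp] State.ctr_set

variable {m n a b : ℕ} {X : Finset (Fin m × Fin n)}

/-- The number of iterations that is allowed for each loop on the input given by `X`, `a`, `b`. -/
def loopBound (X : Finset (Fin m × Fin n)) (a b : ℕ) : ℕ := 4 * (encodeInput m n a b X).length

theorem loopBound_eq (X : Finset (Fin m × Fin n)) (a b : ℕ) :
    loopBound X a b = 4 * (m + n + a + b + 4 + m * (n + 1)) := by
  rw [loopBound, length_encodeInput]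

theorem length_le_loopBound (X : Finset (Fin m × Fin n)) (a b : ℕ) :
    (encodeInput m n a b X).length ≤ loopBound X a b :=
  Nat.le_mul_of_pos_left _ (by norm_num)

theorem rankBound_lt_loopBound {q : ℕ} (hq : q ≤ 3) (c : ℕ → ℕ) :
    rankBound a b X q c < loopBound X a b := by
  refine (rankBound_le a b X q c).trans_lt ?_
  rw [loopBound_eq]
  nlinarith

/-- The evaluation on the input given by `X`, `a`, `b`. -/
noncomputable def run (X : Finset (Fin m × Fin n)) (a b : ℕ) (p : Program Reg) :
    State Reg → State Reg :=
  p.eval (encodeInput m n a b X) (loopBound X a b)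

theorem run_seq (p q : Program Reg) (s : State Reg) :
    run X a b (seq p q) s = run X a b q (run X a b p s) := rfl

theorem run_readHeader {p₁ p₂ p₃ : Program Reg} {f₁ f₂ f₃ : (Reg → ℕ) → Reg → ℕ}
    (hp₁ : ∀ c i, run X a b p₁ ⟨c, i⟩ = ⟨f₁ c, i⟩) (hf₁ : ∀ c, f₁ c .big = c .big)
    (hp₂ : ∀ c i, run X a b p₂ ⟨c, i⟩ = ⟨f₂ c, i⟩) (hf₂ : ∀ c, f₂ c .big = c .big)
    (hp₃ : ∀ c i, run X a b p₃ ⟨c, i⟩ = ⟨f₃ c, i⟩) {c : Reg → ℕ} (hc : c .big = loopBound X a b) :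
    run X a b (readHeader p₁ p₂ p₃) ⟨c, 0⟩ =
      ⟨f₃^[b] (f₂^[a] (f₁^[n] c)), m + n + a + b + 4⟩ := by
  have hbound := loopBound_eq X a b
  have hc₁ : f₁^[n] c .big = loopBound X a b := (iterate_apply_of_forall hf₁ n c).trans hc
  have hc₂ : f₂^[a] (f₁^[n] c) .big = loopBound X a b :=
    (iterate_apply_of_forall hf₂ a _).trans hc₁
  obtain ⟨rest, hw⟩ : ∃ rest, encodeInput m n a b X =
      encodeUnary m ++ (encodeUnary n ++ (encodeUnary a ++ (encodeUnary b ++ rest))) :=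
    ⟨_, by rw [encodeInput]; simp only [List.append_assoc]; rfl⟩
  have hm : run X a b (readUnary .big skip) ⟨c, 0⟩ = ⟨c, m + 1⟩ := by
    have h := eval_readUnary (pre := []) hc hw (by omega) (p := skip) (f := id) fun _ _ => rfl
    rw [run]
    simpa only [List.length_nil, zero_add, Function.iterate_id, id] using h
  have hn : run X a b (readUnary .big p₁) ⟨c, m + 1⟩ = ⟨f₁^[n] c, m + 1 + n + 1⟩ := by
    have h := eval_readUnary (pre := encodeUnary m) hc hw (by omega) hp₁
    rw [run]
    simpa only [length_encodeUnary] using h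
  have ha : run X a b (readUnary .big p₂) ⟨f₁^[n] c, m + 1 + n + 1⟩ =
      ⟨f₂^[a] (f₁^[n] c), m + 1 + (n + 1) + a + 1⟩ := by
    have h := eval_readUnary (pre := encodeUnary m ++ encodeUnary n) hc₁
      (by rw [hw, List.append_assoc]) (by omega) hp₂
    rw [run]
    simpa only [List.length_append, length_encodeUnary, ← add_assoc] using h
  have hb : run X a b (readUnary .big p₃) ⟨f₂^[a] (f₁^[n] c), m + 1 + (n + 1) + a + 1⟩ =
      ⟨f₃^[b] (f₂^[a] (f₁^[n] c)), m + 1 + (n + 1) + (a + 1) + b + 1⟩ := by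
    have h := eval_readUnary (pre := encodeUnary m ++ encodeUnary n ++ encodeUnary a) hc₂
      (by rw [hw, List.append_assoc, List.append_assoc]) (by omega) hp₃
    rw [run]
    simpa only [List.length_append, length_encodeUnary, ← add_assoc] using h
  rw [readHeader, run_seq, hm, run_seq, hn, run_seq, ha, hb]
  congr 1
  omega

/-- The head is at the left end, and the parameters of the problem are stored. -/
structure Ready (X : Finset (Fin m × Fin n)) (a b : ℕ) (s : State Reg) : Prop where
  pos_eq : s.pos = 0
  big_eq : s.ctr .big = loopBound X a b
  n_eq : s.ctr .n = n
  a_eq : s.ctr .a = a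
  b_eq : s.ctr .b = b
  rows_eq : s.ctr .rows = a + 3

theorem ctr_set_of_apply_ne {s : State Reg} {u v : Reg} {x : ℕ} (kind : Reg → Bool)
    (h : kind u ≠ kind v) : (s.set v x).ctr u = s.ctr u := by
  rw [State.ctr_set, if_neg]
  rintro rfl
  exact h rfl

theorem Ready.set {s : State Reg} (hs : Ready X a b s) {v : Reg} (hv : v.isParam = false)
    (x : ℕ) : Ready X a b (s.set v x) := by
  have h (u : Reg) (hu : u.isParam = true) : (s.set v x).ctr u = s.ctr u :=
    ctr_set_of_apply_ne Reg.isParam (by simp [hu, hv])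
  exact ⟨hs.pos_eq, (h _ rfl).trans hs.big_eq, (h _ rfl).trans hs.n_eq, (h _ rfl).trans hs.a_eq,
    (h _ rfl).trans hs.b_eq, (h _ rfl).trans hs.rows_eq⟩

theorem run_seekEntry {s : State Reg} (hs : Ready X a b s) {u v : Reg}
    (hu : s.ctr u ≤ loopBound X a b) (hv : s.ctr v ≤ loopBound X a b) :
    run X a b (seekEntry u v) s =
      ⟨s.ctr, min (m + n + a + b + 4 + s.ctr u * (n + 1) + s.ctr v)
        (encodeInput m n a b X).length⟩ := by
  have hlen := length_encodeInput (a := a) (b := b) X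
  have hbound := loopBound_eq X a b
  have hheader : run X a b (readHeader skip skip skip) s = ⟨s.ctr, m + n + a + b + 4⟩ := by
    have h := run_readHeader (p₁ := skip) (p₂ := skip) (p₃ := skip) (f₁ := id) (f₂ := id)
      (f₃ := id) (fun _ _ => rfl) (fun _ => rfl) (fun _ _ => rfl) (fun _ => rfl)
      (fun _ _ => rfl) hs.big_eq
    simpa only [Function.iterate_id, id, ← hs.pos_eq] using h
  have hrow : run X a b (rep u (seq (rep .n right) right)) ⟨s.ctr, m + n + a + b + 4⟩ =
      ⟨s.ctr, min (m + n + a + b + 4 + s.ctr u * (n + 1)) (encodeInput m n a b X).length⟩ := by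
    refine eval_rep_eq (s := ⟨s.ctr, m + n + a + b + 4⟩) hu (fun t => ⟨s.ctr,
      min (m + n + a + b + 4 + t * (n + 1)) (encodeInput m n a b X).length⟩) ?_ fun t _ => ?_
    · rw [zero_mul, add_zero, min_eq_left (by omega)]
    · rw [eval, eval_rep_right (by rw [hs.n_eq]; omega) (min_le_right _ _), eval, add_mul,
        hs.n_eq]
      congr 1
      dsimp only
      omega
  rw [seekEntry, run_seq, hheader, run_seq, hrow, run, eval_rep_right hv (min_le_right _ _)]
  congr 1
  omega

open Classical in
theorem run_ifEntry {s : State Reg} (hs : Ready X a b s) {u v : Reg} {p q : Program Reg}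
    (hu : s.ctr u ≤ loopBound X a b) (hv : s.ctr v < n) :
    run X a b (ifEntry u v p q) s =
      if HasEntry X (s.ctr u) (s.ctr v) then run X a b p s else run X a b q s := by
  have hbound := loopBound_eq X a b
  have hlen := length_le_loopBound X a b
  have hread (i : ℕ) : (encodeInput m n a b X)[min i (encodeInput m n a b X).length]? =
      (encodeInput m n a b X)[i]? := by
    obtain h | h := le_total i (encodeInput m n a b X).length
    · rw [min_eq_left h]
    · rw [min_eq_right h, List.getElem?_eq_none le_rfl, List.getElem?_eq_none h]
  have hrewind {i : ℕ} (hi : i ≤ loopBound X a b) :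
      eval (encodeInput m n a b X) (loopBound X a b) (rewind .big) ⟨s.ctr, i⟩ = s := by
    rw [eval_rewind hs.big_eq hi, ← hs.pos_eq]
  rw [ifEntry, run_seq, run_seekEntry hs hu (by omega), run, eval, hread,
    if_congr (getElem?_encodeInput X _ hv) rfl rfl, eval, eval, hrewind (by omega)]
  rfl

theorem run_countColumn (hm : m ≤ a + 3) {s : State Reg} (hs : Ready X a b s)
    (hj : s.ctr .j < n) (hp : s.ctr .p = 0) (hc : s.ctr .cnt = 0) :
    run X a b countColumn s = s.set .cnt (columnCount X (s.ctr .j)) := by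
  classical
  have hbound := loopBound_eq X a b
  have hrows := hs.rows_eq
  let S (t : ℕ) : State Reg :=
    s.set .cnt ((Finset.range t).filter fun i => HasEntry X i (s.ctr .j)).card
  have hstep (t : ℕ) (ht : t < s.ctr .rows) :
      run X a b (ifEntry .p .j (inc .cnt) skip) ((S t).set .p t) = (S (t + 1)).set .p t := by
    rw [run_ifEntry ((hs.set rfl _).set rfl _) (by rw [State.ctr_set_self]; omega)
      (by simpa [S] using hj)]
    simp only [S, State.ctr_set, if_true, reduceCtorEq, if_false, Finset.range_add_one,
      Finset.filter_insert]
    split_ifs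
    · rw [Finset.card_insert_of_notMem (by simp), run, eval,
        State.set_comm _ (u := Reg.p) (by decide)]
      simp
    · rfl
  have hS₀ : S 0 = s := by
    simp only [S, Finset.range_zero, Finset.filter_empty, Finset.card_empty]
    rw [← hc, State.set_ctr_self]
  have hloop : run X a b countColumn s = S (s.ctr .rows) :=
    eval_forLoop (by omega) S (fun t => by simpa [S] using hp) hS₀ hstep
  rw [hloop, ← card_filter_hasEntry X _ hm, ← hrows]

/-- The program `p` adds `c j` to the counter `cap`, where `j` is the current column, provided that
the row indices are as in the state `s`. -/
def AddsToCap (X : Finset (Fin m × Fin n)) (a b : ℕ) (p : Program Reg) (s : State Reg)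
    (c : ℕ → ℕ) : Prop :=
  ∀ s' : State Reg, Ready X a b s' → (∀ u : Reg, u.isIndex = true → s'.ctr u = s.ctr u) →
    s'.ctr .j < n → run X a b p s' = s'.set .cap (s'.ctr .cap + c (s'.ctr .j))

theorem addsToCap_skip (s : State Reg) : AddsToCap X a b skip s fun _ => 0 :=
  fun s' _ _ _ => (s'.set_ctr_self .cap).symm

theorem addsToCap_incs (q : ℕ) (s : State Reg) : AddsToCap X a b (incs .cap q) s fun _ => q :=
  fun _ _ _ _ => eval_incs _ _ _

theorem addsToCap_inc (s : State Reg) : AddsToCap X a b (inc .cap) s fun _ => 1 :=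
  fun _ _ _ _ => rfl

theorem AddsToCap.seq {s : State Reg} {p q : Program Reg} {c d : ℕ → ℕ}
    (hp : AddsToCap X a b p s c) (hq : AddsToCap X a b q s d) :
    AddsToCap X a b (seq p q) s fun j => c j + d j := by
  intro s' hs hindex hj
  rw [run_seq, hp s' hs hindex hj, hq _ (hs.set rfl _)
    (fun u hu => (ctr_set_of_apply_ne Reg.isIndex (by rw [hu]; decide)).trans (hindex u hu))
    (by simpa using hj)]
  simp [add_assoc]

open Classical in
theorem AddsToCap.ifEntry {s : State Reg} {p q : Program Reg} {c d : ℕ → ℕ}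
    (hp : AddsToCap X a b p s c) (hq : AddsToCap X a b q s d) {u : Reg} (hu : u.isIndex = true)
    (hle : s.ctr u ≤ a + 3) :
    AddsToCap X a b (ifEntry u .j p q) s
      fun j => if HasEntry X (s.ctr u) j then c j else d j := by
  intro s' hs hindex hj
  have hbound := loopBound_eq X a b
  rw [run_ifEntry hs (by rw [hindex u hu]; omega) hj, hindex u hu]
  dsimp only
  split_ifs
  exacts [hp s' hs hindex hj, hq s' hs hindex hj]

theorem addsToCap_addEntry {s : State Reg} {u : Reg} (hu : u.isIndex = true)
    (hle : s.ctr u ≤ a + 3) : AddsToCap X a b (addEntry u) s (entryBit X (s.ctr u)) :=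
  (addsToCap_inc s).ifEntry (addsToCap_skip s) hu hle

theorem addsToCap_addCross {s : State Reg} (hs : ∀ u : Reg, u.isIndex = true → s.ctr u ≤ a + 3) :
    AddsToCap X a b (addCross .i₁ .i₂ .k₁ .k₂) s
      (crossBit X (s.ctr .i₁) (s.ctr .i₂) (s.ctr .k₁) (s.ctr .k₂)) := by
  have hk := (addsToCap_inc s).ifEntry (X := X) (b := b)
    ((addsToCap_inc s).ifEntry (addsToCap_skip s) (u := .k₂) rfl (hs _ rfl)) (u := .k₁) rfl
    (hs _ rfl)
  have h := hk.ifEntry (hk.ifEntry (addsToCap_skip s) (u := .i₂) rfl (hs _ rfl)) (u := .i₁) rfl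
    (hs _ rfl)
  convert h using 1
  · rfl
  · funext j
    simp only [crossBit, entryBit]
    split_ifs <;> rfl

theorem run_column (hm : m ≤ a + 3) {s : State Reg} (hs : Ready X a b s) {p : Program Reg}
    {c : ℕ → ℕ} (hp : AddsToCap X a b p s c) (hc : ∀ j, c j ≤ 3) (hj : s.ctr .j < n)
    (hp₀ : s.ctr .p = 0) (hcnt : s.ctr .cnt = 0) (hcap : s.ctr .cap = 0) :
    run X a b (column p) s =
      s.set .cur (s.ctr .cur + min (columnCount X (s.ctr .j)) (a + c (s.ctr .j))) := by
  have hbound := loopBound_eq X a b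
  have hcount := columnCount_le X (s.ctr .j)
  have hc' := hc (s.ctr .j)
  have ha := hs.a_eq
  have hadd : run X a b (addMul 1 .a .cap) (s.set .cnt (columnCount X (s.ctr .j))) =
      (s.set .cnt (columnCount X (s.ctr .j))).set .cap a := by
    rw [run, eval_addMul (by simp only [State.ctr_set, reduceCtorEq, if_false]; omega)]
    simp [hcap, ha]
  rw [column, run_seq, run_countColumn hm hs hj hp₀ hcnt, run_seq, hadd, run_seq,
    hp _ ((hs.set rfl _).set rfl _) (fun u hu => by
      rw [ctr_set_of_apply_ne Reg.isIndex (by rw [hu]; decide),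
        ctr_set_of_apply_ne Reg.isIndex (by rw [hu]; decide)]) (by simpa using hj), run_seq]
  simp only [State.ctr_set, if_true, reduceCtorEq, if_false, State.set_set]
  rw [run, run, eval_addMin (by simp; omega) (by simp; omega) (by decide),
    eval_clear (by simp; omega)]
  ext r
  · simp only [State.ctr_set, if_true, reduceCtorEq, if_false]
    split_ifs <;> simp_all
  · rfl

theorem run_updateBest {s : State Reg} (hbest : s.ctr .best ≤ loopBound X a b)
    (hcur : s.ctr .cur ≤ loopBound X a b) (hnew : s.ctr .new = 0) :
    run X a b updateBest s = (s.set .best (min (s.ctr .best) (s.ctr .cur))).set .cur 0 := by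
  rw [updateBest, run_seq, run_seq, run_seq, run, run, run, run, eval_addMin hbest hcur (by decide),
    eval_clear (v := Reg.best) (by simpa using hbest), eval_addMul (by simp [hnew, hbest]),
    eval_clear (v := Reg.new) (by simp [hnew, hbest])]
  ext r
  · simp only [State.ctr_set, if_true, reduceCtorEq, if_false]
    split_ifs <;> simp_all
  · rfl

/-- The states between the computations of two bounds. -/
structure Fit (X : Finset (Fin m × Fin n)) (a b : ℕ) (s : State Reg) : Prop
    extends Ready X a b s where
  scratch_eq : ∀ u : Reg, u.isScratch = true → s.ctr u = 0
  index_le : ∀ u : Reg, u.isIndex = true → s.ctr u ≤ a + 3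
  best_le : s.ctr .best ≤ loopBound X a b

theorem Fit.set_best {s : State Reg} (hs : Fit X a b s) {r : ℕ} (hr : r ≤ s.ctr .best) :
    Fit X a b (s.set .best r) where
  toReady := hs.toReady.set rfl r
  scratch_eq u hu := by
    rw [ctr_set_of_apply_ne Reg.isScratch (by rw [hu]; decide), hs.scratch_eq u hu]
  index_le u hu := by
    rw [ctr_set_of_apply_ne Reg.isIndex (by rw [hu]; decide)]
    exact hs.index_le u hu
  best_le := by
    rw [State.ctr_set_self]
    exact hr.trans hs.best_le

theorem Fit.set_index {s : State Reg} (hs : Fit X a b s) {v : Reg} (hv : v.isIndex = true)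
    {x : ℕ} (hx : x ≤ a + 3) : Fit X a b (s.set v x) where
  toReady := hs.toReady.set (Reg.isParam_of_isIndex v hv) x
  scratch_eq u hu := by
    rw [ctr_set_of_apply_ne Reg.isScratch (by rw [hu, Reg.isScratch_of_isIndex v hv]; decide),
      hs.scratch_eq u hu]
  index_le u hu := by
    rw [State.ctr_set]
    split_ifs
    exacts [hx, hs.index_le u hu]
  best_le := by
    rw [ctr_set_of_apply_ne Reg.isIndex (by rw [hv]; decide)]
    exact hs.best_le

theorem run_forLoop_column (hm : m ≤ a + 3) {s : State Reg} (hs : Fit X a b s) {q : ℕ}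
    {p : Program Reg} {c : ℕ → ℕ} (hp : AddsToCap X a b p s c) (hc : ∀ j, c j ≤ 3) :
    run X a b (forLoop .j .n (column p)) (s.set .cur (q * b)) =
      s.set .cur (rankBound a b X q c) := by
  have hbound := loopBound_eq X a b
  have hn : (s.set .cur (q * b)).ctr .n = n := by simpa using hs.n_eq
  let S (t : ℕ) : State Reg :=
    s.set .cur (q * b + ∑ j ∈ Finset.range t, min (columnCount X j) (a + c j))
  have hscratch {t : ℕ} {u : Reg} (hu : u.isScratch = true) (hj : u ≠ .j) (hcur : u ≠ .cur) :
      ((S t).set .j t).ctr u = 0 := by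
    simpa [S, hj, hcur] using hs.scratch_eq u hu
  have hstep (t : ℕ) (ht : t < n) :
      run X a b (column p) ((S t).set .j t) = (S (t + 1)).set .j t := by
    rw [run_column hm (c := c) ((hs.toReady.set rfl _).set rfl _) (fun s' hs' hindex hj =>
        hp s' hs' (fun u hu => (hindex u hu).trans (by
          rw [ctr_set_of_apply_ne Reg.isIndex (by rw [hu]; decide),
            ctr_set_of_apply_ne Reg.isIndex (by rw [hu]; decide)])) hj) hc (by simpa using ht)
      (hscratch rfl (by decide) (by decide)) (hscratch rfl (by decide) (by decide))
      (hscratch rfl (by decide) (by decide)), State.set_comm _ (u := Reg.j) (by decide)]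
    simp [S, Finset.sum_range_succ, add_assoc]
  have hloop : run X a b (forLoop .j .n (column p)) (s.set .cur (q * b)) =
      S ((s.set .cur (q * b)).ctr .n) :=
    eval_forLoop (by rw [hn]; omega) S (fun t => by simpa [S] using hs.scratch_eq .j rfl)
      (by simp [S]) fun t ht => hstep t (ht.trans_eq hn)
  rw [hloop, hn, rankBound]

theorem run_bound (hm : m ≤ a + 3) {s : State Reg} (hs : Fit X a b s) {q : ℕ} (hq : q ≤ 3)
    {p : Program Reg} {c : ℕ → ℕ} (hp : AddsToCap X a b p s c) (hc : ∀ j, c j ≤ 3) :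
    run X a b (bound q p) s = s.set .best (min (s.ctr .best) (rankBound a b X q c)) := by
  have hbound := loopBound_eq X a b
  have hb := hs.b_eq
  have hcur := hs.scratch_eq .cur rfl
  have hinit : run X a b (addMul q .b .cur) s = s.set .cur (q * b) := by
    rw [run, eval_addMul (by omega), hcur, hb, zero_add]
  rw [bound, run_seq, hinit, run_seq, run_forLoop_column hm hs hp hc,
    run_updateBest (by simpa using hs.best_le)
    (by simpa using (rankBound_lt_loopBound hq c).le)
    (by simpa using hs.scratch_eq .new rfl), State.set_comm _ (u := Reg.best) (by decide),
    State.set_set, ← hcur]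
  simp

/-- The program `p` replaces `best` by the minimum of `best` and of the elements of `C`. -/
def Minimizes (X : Finset (Fin m × Fin n)) (a b : ℕ) (p : Program Reg) (s : State Reg)
    (C : Set ℕ) : Prop :=
  ∃ r, run X a b p s = s.set .best r ∧ IsLeast (insert (s.ctr .best) C) r

theorem minimizes_bound (hm : m ≤ a + 3) {s : State Reg} (hs : Fit X a b s) {q : ℕ} (hq : q ≤ 3)
    {p : Program Reg} {c : ℕ → ℕ} (hp : AddsToCap X a b p s c) (hc : ∀ j, c j ≤ 3) :
    Minimizes X a b (bound q p) s {rankBound a b X q c} :=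
  ⟨_, run_bound hm hs hq hp hc, isLeast_pair⟩

theorem isLeast_insert_union {C D : Set ℕ} {x r r' : ℕ} (h : IsLeast (insert x C) r)
    (h' : IsLeast (insert r D) r') : IsLeast (insert x (C ∪ D)) r' := by
  have hle : r' ≤ r := h'.2 (Set.mem_insert _ _)
  rw [← Set.insert_union]
  constructor
  · obtain rfl | hr' := h'.1
    exacts [Or.inl h.1, Or.inr hr']
  · rintro y (hy | hy)
    exacts [hle.trans (h.2 hy), h'.2 (Or.inr hy)]

theorem Minimizes.seq {p q : Program Reg} {s : State Reg} {C D : Set ℕ}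
    (hp : Minimizes X a b p s C)
    (hq : ∀ r ≤ s.ctr .best, Minimizes X a b q (s.set .best r) D) :
    Minimizes X a b (seq p q) s (C ∪ D) := by
  obtain ⟨r, hrun, hr⟩ := hp
  obtain ⟨r', hrun', hr'⟩ := hq r (hr.2 (Set.mem_insert _ _))
  rw [State.ctr_set_self] at hr'
  exact ⟨r', by rw [run_seq, hrun, hrun', State.set_set], isLeast_insert_union hr hr'⟩

theorem Minimizes.forLoop {p : Program Reg} {s : State Reg} {i lim : Reg} (hi : i ≠ .best)
    (hi₀ : s.ctr i = 0) (hl : s.ctr lim ≤ loopBound X a b) (C : ℕ → Set ℕ)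
    (h : ∀ t < s.ctr lim, ∀ r ≤ s.ctr .best, Minimizes X a b p ((s.set .best r).set i t) (C t)) :
    Minimizes X a b (forLoop i lim p) s (⋃ t < s.ctr lim, C t) := by
  refine eval_forLoop_induction (i := i) hl (P := fun t s' => ∃ r, s' = s.set .best r ∧
    IsLeast (insert (s.ctr .best) (⋃ u < t, C u)) r) ?_ ⟨s.ctr .best, by simp, by simp⟩ ?_
  · rintro t _ ⟨r, rfl, -⟩
    simpa [hi] using hi₀
  · rintro t ht _ ⟨r, rfl, hr⟩
    obtain ⟨r', hrun, hr'⟩ := h t ht r (hr.2 (Set.mem_insert _ _))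
    rw [State.ctr_set, if_neg hi.symm, State.ctr_set_self] at hr'
    refine ⟨_, ⟨r', rfl, ?_⟩, hrun.trans ?_⟩
    · rw [Set.biUnion_lt_succ]
      exact isLeast_insert_union hr hr'
    · rw [State.set_comm _ hi, State.set_set]

theorem minimizes_forLoop_addCross (hm : m ≤ a + 3) {s : State Reg} (hs : Fit X a b s)
    (hk₂ : s.ctr .k₂ = 0) (hk₁ : s.ctr .k₁ ≤ a + 3) :
    Minimizes X a b (forLoop .k₂ .k₁ (bound 2 (addCross .i₁ .i₂ .k₁ .k₂))) s
      (⋃ k < s.ctr .k₁,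
        {rankBound a b X 2 (crossBit X (s.ctr .i₁) (s.ctr .i₂) (s.ctr .k₁) k)}) := by
  have hbound := loopBound_eq X a b
  refine Minimizes.forLoop (by decide) hk₂ (by omega) _ fun k hk r hr => ?_
  have hs' := (hs.set_best hr).set_index (v := .k₂) rfl (x := k) (by omega)
  have h := minimizes_bound hm hs' (q := 2) (by omega) (addsToCap_addCross hs'.index_le)
    fun j => (crossBit_le X _ _ _ _ j).trans (by omega)
  simpa only [State.ctr_set, reduceCtorEq, if_false, if_true] using h

theorem minimizes_minimizeCross (hm : m ≤ a + 3) {s : State Reg} (hs : Fit X a b s)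
    (hk₁ : s.ctr .k₁ = 0) (hk₂ : s.ctr .k₂ = 0) :
    Minimizes X a b minimizeCross s
      (⋃ k < a + 3, ⋃ k' < k, {rankBound a b X 2 (crossBit X (s.ctr .i₁) (s.ctr .i₂) k k')}) := by
  have hbound := loopBound_eq X a b
  have hrows := hs.rows_eq
  rw [← hrows]
  refine Minimizes.forLoop (by decide) hk₁ (by omega) _ fun k hk r hr => ?_
  have hs' := (hs.set_best hr).set_index (v := .k₁) rfl (x := k) (by omega)
  have h := minimizes_forLoop_addCross hm hs' (by simpa using hk₂)
    (by rw [State.ctr_set_self]; omega)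
  simpa only [State.ctr_set, reduceCtorEq, if_false, if_true] using h

theorem minimizes_minimizePairs (hm : m ≤ a + 3) {s : State Reg} (hs : Fit X a b s)
    (hi₂ : s.ctr .i₂ = 0) (hk₁ : s.ctr .k₁ = 0) (hk₂ : s.ctr .k₂ = 0) :
    Minimizes X a b minimizePairs s
      (⋃ i' < s.ctr .i₁,
        ({rankBound a b X 1 fun j => entryBit X (s.ctr .i₁) j + entryBit X i' j} ∪
          ⋃ k < a + 3, ⋃ k' < k, {rankBound a b X 2 (crossBit X (s.ctr .i₁) i' k k')})) := by
  have hbound := loopBound_eq X a b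
  have hi₁ := hs.index_le .i₁ rfl
  refine Minimizes.forLoop (by decide) hi₂ (by omega) _ fun i' hi' r hr => ?_
  have hs' := (hs.set_best hr).set_index (v := .i₂) rfl (x := i') (by omega)
  have h := minimizes_bound hm hs' (q := 1) (by omega)
    ((addsToCap_addEntry (u := .i₁) rfl (hs'.index_le _ rfl)).seq
      (addsToCap_addEntry (u := .i₂) rfl (hs'.index_le _ rfl)))
    fun j => (add_le_add (entryBit_le X _ j) (entryBit_le X _ j)).trans (by omega)
  simpa only [State.ctr_set, reduceCtorEq, if_false, if_true] using h.seq fun r' hr' =>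
    minimizes_minimizeCross hm (hs'.set_best hr') (by simpa using hk₁) (by simpa using hk₂)

theorem minimizes_minimize (hm : m ≤ a + 3) {s : State Reg} (hs : Fit X a b s)
    (hindex : ∀ u : Reg, u.isIndex = true → s.ctr u = 0) :
    Minimizes X a b minimize s (rankBounds X a b) := by
  have hbound := loopBound_eq X a b
  refine (minimizes_bound hm hs (by omega) (addsToCap_incs 3 s) fun _ => le_rfl).seq
    fun r hr => ?_
  have hs₁ := hs.set_best hr
  refine (minimizes_bound hm hs₁ le_rfl (addsToCap_skip _) fun _ => by omega).seq fun r' hr' => ?_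
  have hs₂ := hs₁.set_best hr'
  rw [← hs₂.rows_eq]
  refine Minimizes.forLoop (by decide) (by simpa using hindex .i₁ rfl)
    (by rw [hs₂.rows_eq]; omega) _ fun i hi x hx => ?_
  have hs₃ := (hs₂.set_best hx).set_index (v := .i₁) rfl (x := i) (by rw [hs₂.rows_eq] at hi; omega)
  have h := minimizes_bound hm hs₃ (q := 2) (by omega)
    (addsToCap_addEntry (u := .i₁) rfl (hs₃.index_le _ rfl))
    fun j => (entryBit_le X _ j).trans (by omega)
  rw [hs₂.rows_eq]
  simpa only [State.ctr_set, reduceCtorEq, if_false, if_true] using h.seq fun y hy =>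
    minimizes_minimizePairs hm (hs₃.set_best hy) (by simpa using hindex .i₂ rfl)
      (by simpa using hindex .k₁ rfl) (by simpa using hindex .k₂ rfl)

/-- The state in which the parameters of the problem are stored, the counter `best` has the value
`best`, and the other counters are zero. -/
def paramState (X : Finset (Fin m × Fin n)) (a b best : ℕ) : State Reg where
  ctr
    | .big => loopBound X a b
    | .n => n
    | .a => a
    | .b => b
    | .rows => a + 3
    | .best => best
    | _ => 0
  pos := 0

theorem fit_paramState {best : ℕ} (h : best ≤ loopBound X a b) :
    Fit X a b (paramState X a b best) where
  pos_eq := rfl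
  big_eq := rfl
  n_eq := rfl
  a_eq := rfl
  b_eq := rfl
  rows_eq := rfl
  scratch_eq u hu := by cases u <;> first | rfl | cases hu
  index_le u hu := by cases u <;> first | exact Nat.zero_le _ | cases hu
  best_le := h

theorem run_parse :
    run X a b parse (single .big (loopBound X a b) (encodeInput m n a b X).length) =
      paramState X a b 0 := by
  have hbound := loopBound_eq X a b
  have hlen := length_le_loopBound X a b
  set c : Reg → ℕ := Function.update (fun _ => 0) .big (loopBound X a b)
  have hrewind : run X a b (rewind .big) (single .big (loopBound X a b)
      (encodeInput m n a b X).length) = ⟨c, 0⟩ := eval_rewind (by simp) hlen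
  have hinc (v : Reg) (c : Reg → ℕ) (i : ℕ) :
      run X a b (inc v) ⟨c, i⟩ = ⟨Function.update c v (c v + 1), i⟩ := rfl
  have hheader := run_readHeader (hinc .n) (fun c => by simp) (hinc .a) (fun c => by simp)
    (hinc .b) (c := c) (by simp [c])
  rw [parse, run_seq, hrewind, run_seq, hheader, run_seq, run_seq]
  simp only [run, iterate_update_add_one]
  rw [eval_rewind (by simp [c]) (by omega), eval_addMul (by simp [c]; omega), eval_incs]
  ext r
  · cases r <;> simp [c, paramState]
  · rfl

theorem run_rankProgram (hm : m ≤ a + 3) :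
    ∃ r, run X a b rankProgram (single .big (loopBound X a b) (encodeInput m n a b X).length) =
      single .best r 0 ∧ IsLeast (rankBounds X a b) r := by
  have hbound := loopBound_eq X a b
  have hinit : run X a b (addMul 1 .big .best) (paramState X a b 0) =
      paramState X a b (loopBound X a b) := by
    rw [run, eval_addMul (by simp [paramState])]
    ext r
    · cases r <;> simp [paramState]
    · rfl
  obtain ⟨r, hrun, hr⟩ := minimizes_minimize hm (fit_paramState (X := X) (b := b) le_rfl)
    fun u hu => by cases u <;> first | rfl | cases hu
  refine ⟨r, ?_, ?_⟩
  · rw [rankProgram, run_seq, run_parse, run_seq, hinit, run_seq, hrun]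
    simp only [run_seq]
    simp only [run]
    rw [eval_clear (v := Reg.n) (by simp [paramState]; omega),
      eval_clear (v := Reg.a) (by simp [paramState]; omega),
      eval_clear (v := Reg.b) (by simp [paramState]; omega),
      eval_clear (v := Reg.rows) (by simp [paramState]; omega),
      eval_clear (v := Reg.big) (by simp [paramState])]
    ext u
    · cases u <;> simp [paramState, single]
    · rfl
  · have hmem : rankBound a b X 0 (fun _ => 3) ∈ rankBounds X a b := Or.inl rfl
    have hlt := (hr.2 (Or.inr hmem)).trans_lt (rankBound_lt_loopBound (by omega) _)
    exact ⟨hr.1.resolve_left hlt.ne, fun x hx => hr.2 (Or.inr hx)⟩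

end Semantics

end Program

theorem polynomial_eval_mono {R : Type*} [CommSemiring R] [PartialOrder R] [IsOrderedRing R]
    [CanonicallyOrderedAdd R] (p : Polynomial R) : Monotone fun x => p.eval x := by
  intro x y h
  simp only [Polynomial.eval_eq_sum_range]
  gcongr

theorem unaryEncodeNat_eq_replicate (r : ℕ) :
    Computability.unaryEncodeNat r = List.replicate r true := by
  induction r with
  | zero => rfl
  | succ r ih => rw [Computability.unaryEncodeNat, ih, List.replicate_succ]

theorem haltsWithOutput_of_outputsInTime {tm : Turing.FinTM2} {w : List (tm.Γ tm.k₀)}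
    {w' : List (tm.Γ tm.k₁)} {t t' : ℕ} (h : Turing.TM2OutputsInTime tm w (some w') t)
    (ht : t ≤ t') : HaltsWithOutput ⟨tm, Equiv.refl _, Equiv.refl _⟩ w w' t' := by
  rw [HaltsWithOutput]
  simp only [Equiv.refl_symm, Equiv.coe_refl, List.map_id]
  exact ⟨⟨h.toTM2Outputs, h.steps_le_m.trans ht⟩⟩

theorem exists_machine_isLeast_rankBounds :
    ∃ (M : Turing.TM2ComputableAux Γ' Bool) (p : Polynomial ℕ),
      ∀ m n a b : ℕ, a ≤ m → b ≤ n → m - a ≤ 3 → ∀ X : Finset (Fin m × Fin n),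
        ∃ r : ℕ, IsLeast (rankBounds X a b) r ∧
          HaltsWithOutput M (encodeInput m n a b X) (Computability.unaryEncodeNat r)
            (p.eval (m + n)) := by
  let N : Polynomial ℕ := 4 * (Polynomial.X + 2) ^ 2
  refine ⟨⟨Program.rankProgram.machine .big .best, Equiv.refl _, Equiv.refl _⟩,
    Program.rankProgram.cost.comp N + 2 * N + 4, fun m n a b ha hb hd X => ?_⟩
  have hlen : 4 * (encodeInput m n a b X).length ≤ N.eval (m + n) := by
    simp only [length_encodeInput, N, Polynomial.eval_mul, Polynomial.eval_pow,
      Polynomial.eval_add, Polynomial.eval_X, Polynomial.eval_ofNat]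
    nlinarith
  obtain ⟨r, hrun, hr⟩ := Program.run_rankProgram (X := X) (b := b) (Nat.sub_le_iff_le_add'.1 hd)
  obtain ⟨h⟩ := Program.machine_outputs _ _ _ _ _ hrun
  refine ⟨r, hr, ?_⟩
  rw [unaryEncodeNat_eq_replicate]
  refine haltsWithOutput_of_outputsInTime h ?_
  have hcost := polynomial_eval_mono Program.rankProgram.cost hlen
  simp only [Polynomial.eval_add, Polynomial.eval_comp, Polynomial.eval_mul,
    Polynomial.eval_ofNat]
  dsimp only at hcost
  omega

section LinearAlgebra

variable {K V W : Type*} [Field K] [AddCommGroup V] [Module K V] [AddCommGroup W] [Module K W]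

theorem exists_submodule_le_finrank_eq (S : Submodule K V) {k : ℕ} (hk : k ≤ Module.finrank K S) :
    ∃ U ≤ S, Module.finrank K U = k := by
  obtain ⟨f, hf⟩ := exists_linearIndependent_of_le_finrank hk
  have hf' : LinearIndependent K fun i => (f i : V) := hf.map' S.subtype (Submodule.ker_subtype S)
  refine ⟨Submodule.span K (Set.range fun i => (f i : V)), ?_, ?_⟩
  · rw [Submodule.span_le]
    rintro _ ⟨i, rfl⟩
    exact (f i).2
  · rw [finrank_span_eq_card hf', Fintype.card_fin]

theorem finrank_add_finrank_le_of_le {S T Z : Submodule K V} [FiniteDimensional K Z] (hS : S ≤ Z)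
    (hT : T ≤ Z) : Module.finrank K S + Module.finrank K T ≤
      Module.finrank K Z + Module.finrank K (S ⊓ T : Submodule K V) := by
  have := Submodule.finiteDimensional_of_le hS
  have := Submodule.finiteDimensional_of_le hT
  rw [← Submodule.finrank_sup_add_finrank_inf_eq]
  gcongr
  exact Submodule.finrank_mono (sup_le hS hT)

theorem finrank_map_add_finrank_inf_ker (f : V →ₗ[K] W) (S : Submodule K V)
    [FiniteDimensional K S] :
    Module.finrank K (S.map f) + Module.finrank K (S ⊓ LinearMap.ker f : Submodule K V) =
      Module.finrank K S := by
  rw [← (f.domRestrict S).finrank_range_add_finrank_ker, LinearMap.range_domRestrict,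
    LinearMap.ker_domRestrict, ← Submodule.map_comap_subtype, Submodule.finrank_map_subtype_eq]

theorem finrank_le_finrank_inf_ker_add [FiniteDimensional K W] (S : Submodule K V)
    [FiniteDimensional K S] (f : V →ₗ[K] W) :
    Module.finrank K S ≤
      Module.finrank K (S ⊓ LinearMap.ker f : Submodule K V) + Module.finrank K W := by
  rw [← finrank_map_add_finrank_inf_ker f S, add_comm]
  gcongr
  exact Submodule.finrank_le _

theorem finrank_le_finrank_ker_add [FiniteDimensional K V] [FiniteDimensional K W]
    (f : V →ₗ[K] W) :
    Module.finrank K V ≤ Module.finrank K (LinearMap.ker f) + Module.finrank K W := by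
  have h := finrank_le_finrank_inf_ker_add ⊤ f
  rwa [finrank_top, top_inf_eq] at h

theorem map_linearCombination_spanSubset {ι : Type*} [Fintype ι] (v : ι → V) (s : Set ι) :
    (Pi.spanSubset K s).map (Fintype.linearCombination K v) = Submodule.span K (v '' s) := by
  classical
  simp only [Pi.spanSubset, Submodule.map_span, Set.image_image, Pi.basisFun_apply,
    Fintype.linearCombination_apply_single, one_smul]

theorem finrank_span_image_of_linearIndepOn {ι : Type*} [Finite ι] {v : ι → V} {s : Set ι}
    (h : LinearIndepOn K v s) : Module.finrank K (Submodule.span K (v '' s)) = s.ncard := by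
  have := Fintype.ofFinite s
  rw [Set.image_eq_range, finrank_span_eq_card h, ← Nat.card_eq_fintype_card, Nat.card_coe_set_eq]

theorem columnMatroid_eRk {K R C : Type*} [Field K] [Finite C] (A : Matrix R C K) (X : Set C) :
    (columnMatroid A).eRk X = (Module.finrank K (Submodule.span K (A.col '' X)) : ℕ∞) := by
  obtain ⟨I, hI⟩ := (columnMatroid A).exists_isBasis X (Set.subset_univ X)
  have hind : LinearIndepOn K A.col I := (columnMatroid_indep_iff A I).1 hI.indep
  have hspan : Submodule.span K (A.col '' X) = Submodule.span K (A.col '' I) := by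
    refine le_antisymm (Submodule.span_le.2 ?_) (Submodule.span_mono (Set.image_mono hI.subset))
    rintro _ ⟨e, he, rfl⟩
    by_cases heI : e ∈ I
    · exact Submodule.subset_span (Set.mem_image_of_mem _ heI)
    · by_contra hne
      exact heI (hI.mem_of_insert_indep he ((columnMatroid_indep_iff A _).2
        ((linearIndepOn_insert heI).2 ⟨hind, hne⟩)))
  rw [hI.eRk_eq_encard, hspan, finrank_span_image_of_linearIndepOn hind,
    Set.Finite.cast_ncard_eq (Set.toFinite I)]

/- A left inverse of the specialized matrix lifts to `R`; its product with the matrix has a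
determinant that specializes to `1`. -/
theorem linearIndependent_algebraMap_of_linearIndependent_map {R F K ι κ : Type*} [CommRing R]
    [IsDomain R] [Field F] [Field K] [Algebra R K] [FaithfulSMul R K] [Finite ι] [Finite κ]
    {φ : R →+* F} (hφ : Function.Surjective φ) (v : ι → κ → R)
    (h : LinearIndependent F fun i k => φ (v i k)) :
    LinearIndependent K fun i k => algebraMap R K (v i k) := by
  classical
  have := Fintype.ofFinite ι
  have := Fintype.ofFinite κ
  let A : Matrix κ ι R := Matrix.of fun k i => v i k
  obtain ⟨C, hC⟩ : ∃ C : Matrix ι κ F, C * A.map φ = 1 := by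
    obtain ⟨g, hg⟩ := LinearMap.exists_leftInverse_of_injective (A.map φ).mulVecLin
      (LinearMap.ker_eq_bot.2 (Matrix.mulVec_injective_iff.2 h))
    exact ⟨LinearMap.toMatrix' g, by rw [← LinearMap.toMatrix'_id, ← hg,
      LinearMap.toMatrix'_comp, ← Matrix.toLin'_apply', LinearMap.toMatrix'_toLin']⟩
  choose ψ hψ using hφ
  let B : Matrix ι κ R := C.map ψ
  have hB : B.map φ = C := by
    ext i k
    simp [B, hψ]
  have hdet : (B * A).det ≠ 0 := fun h₀ => by
    have h₁ : φ (B * A).det = 1 := by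
      rw [RingHom.map_det, RingHom.mapMatrix_apply, Matrix.map_mul, hB, hC, Matrix.det_one]
    rw [h₀, map_zero] at h₁
    exact zero_ne_one h₁
  have hunit : IsUnit (B.map (algebraMap R K) * A.map (algebraMap R K)) := by
    rw [Matrix.isUnit_iff_isUnit_det, ← Matrix.map_mul, ← RingHom.mapMatrix_apply,
      ← RingHom.map_det, isUnit_iff_ne_zero]
    exact (map_ne_zero_iff _ (FaithfulSMul.algebraMap_injective R K)).2 hdet
  have hinj := Matrix.mulVec_injective_iff_isUnit.2 hunit
  refine (Matrix.mulVec_injective_iff (M := A.map (algebraMap R K))).1 fun u w huw => hinj ?_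
  rw [← Matrix.mulVec_mulVec, huw, Matrix.mulVec_mulVec]

theorem finrank_span_map_le_finrank_span_algebraMap {R F K ι κ : Type*} [CommRing R]
    [IsDomain R] [Field F] [Field K] [Algebra R K] [FaithfulSMul R K] [Finite ι] [Finite κ]
    {φ : R →+* F} (hφ : Function.Surjective φ) (v : ι → κ → R) (s : Set ι) :
    Module.finrank F (Submodule.span F ((fun i k => φ (v i k)) '' s)) ≤
      Module.finrank K (Submodule.span K ((fun i k => algebraMap R K (v i k)) '' s)) := by
  obtain ⟨t, hts, -, hspan, ht⟩ := exists_linearIndepOn_extension (K := F)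
    (v := fun i k => φ (v i k)) (linearIndepOn_empty F _) (Set.empty_subset s)
  have ht' : LinearIndepOn K (fun i k => algebraMap R K (v i k)) t :=
    linearIndependent_algebraMap_of_linearIndependent_map hφ (fun i : t => v i) ht
  calc Module.finrank F (Submodule.span F ((fun i k => φ (v i k)) '' s))
      ≤ Module.finrank F (Submodule.span F ((fun i k => φ (v i k)) '' t)) :=
        Submodule.finrank_mono (Submodule.span_le.2 hspan)
    _ = Module.finrank K (Submodule.span K ((fun i k => algebraMap R K (v i k)) '' t)) := by
      rw [finrank_span_image_of_linearIndepOn ht, finrank_span_image_of_linearIndepOn ht']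
    _ ≤ _ := Submodule.finrank_mono (Submodule.span_mono (Set.image_mono hts))

end LinearAlgebra

section Rigidity

variable {K : Type*} [Field K] {m n a b : ℕ}

/-- The columns of the bipartite rigidity matrix for arbitrary values of the variables. -/
def rigidityColumn (x : Fin m → Fin a → K) (y : Fin n → Fin b → K) (p : Fin m × Fin n) :
    (Fin a × Fin n) ⊕ (Fin b × Fin m) → K :=
  Sum.elim (fun r => if p.2 = r.2 then x p.1 r.1 else 0)
    (fun r => if p.1 = r.2 then y p.2 r.1 else 0)

/-- The rank of the columns with labels in `X`. -/
noncomputable def columnRank (x : Fin m → Fin a → K) (y : Fin n → Fin b → K)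
    (X : Finset (Fin m × Fin n)) : ℕ :=
  Module.finrank K (Submodule.span K (rigidityColumn x y '' X))

/-- The linear relations between the columns with labels in `X`. The coefficient of the column
`(i, j)` in the relation `f` is `f j i`, so that `f j : Fin m → K` collects the coefficients with
the label `j` in `[n]`. -/
noncomputable def columnRelations (x : Fin m → Fin a → K) (y : Fin n → Fin b → K)
    (X : Finset (Fin m × Fin n)) : Submodule K (Fin n → Fin m → K) :=
  (Pi.spanSubset K X ⊓ LinearMap.ker (Fintype.linearCombination K (rigidityColumn x y))).map
    ((LinearEquiv.funCongrLeft K K (Equiv.prodComm (Fin n) (Fin m))).trans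
      (LinearEquiv.curry K K (Fin n) (Fin m))).toLinearMap

theorem mem_columnRelations {x : Fin m → Fin a → K} {y : Fin n → Fin b → K}
    {X : Finset (Fin m × Fin n)} {f : Fin n → Fin m → K} :
    f ∈ columnRelations x y X ↔ (∀ j i, (i, j) ∉ X → f j i = 0) ∧
      (∀ j t, ∑ i, f j i * x i t = 0) ∧ ∀ i l, ∑ j, f j i * y j l = 0 := by
  have hinl (j : Fin n) (t : Fin a) : Fintype.linearCombination K (rigidityColumn x y)
      (fun p => f p.2 p.1) (Sum.inl (t, j)) = ∑ i, f j i * x i t := by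
    simp [Fintype.linearCombination_apply, rigidityColumn, Fintype.sum_prod_type_right]
  have hinr (i : Fin m) (l : Fin b) : Fintype.linearCombination K (rigidityColumn x y)
      (fun p => f p.2 p.1) (Sum.inr (l, i)) = ∑ j, f j i * y j l := by
    simp [Fintype.linearCombination_apply, rigidityColumn, Fintype.sum_prod_type]
  rw [columnRelations, Submodule.mem_map_equiv, Submodule.mem_inf, Pi.mem_spanSubset_iff,
    LinearMap.mem_ker, funext_iff, Sum.forall, Prod.forall, Prod.forall, Prod.forall, forall_comm,
    forall_comm (α := Fin a), forall_comm (α := Fin b)]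
  exact and_congr Iff.rfl (and_congr
    (forall₂_congr fun j t => by rw [← hinl]; rfl) (forall₂_congr fun i l => by rw [← hinr]; rfl))

theorem columnRank_add_finrank_columnRelations (x : Fin m → Fin a → K) (y : Fin n → Fin b → K)
    (X : Finset (Fin m × Fin n)) :
    columnRank x y X + Module.finrank K (columnRelations x y X) = X.card := by
  rw [columnRank, columnRelations, LinearEquiv.finrank_map_eq, ← map_linearCombination_spanSubset,
    finrank_map_add_finrank_inf_ker, Pi.dim_spanSubset, Set.ncard_coe_finset]

theorem bipartiteRigidityMatroid_eRk (X : Finset (Fin m × Fin n)) :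
    (bipartiteRigidityMatroid m n a b).eRk X =
      (columnRank (K := RigidityField m n a b) (a := a) (b := b) rigidityX rigidityY X : ℕ∞) := by
  have hcol : (rigidityMatrix m n a b).col = rigidityColumn rigidityX rigidityY := by
    ext p (r | r) <;> rfl
  rw [bipartiteRigidityMatroid, columnMatroid_eRk, columnRank, hcol]

theorem columnRank_le_generic (x : Fin m → Fin a → ℂ) (y : Fin n → Fin b → ℂ)
    (X : Finset (Fin m × Fin n)) :
    columnRank x y X ≤
      columnRank (K := RigidityField m n a b) (a := a) (b := b) rigidityX rigidityY X := by
  let φ : MvPolynomial ((Fin m × Fin a) ⊕ (Fin n × Fin b)) ℂ →+* ℂ :=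
    MvPolynomial.eval (Sum.elim (fun p => x p.1 p.2) (fun p => y p.1 p.2))
  have hφ : Function.Surjective φ := fun c => ⟨MvPolynomial.C c, by simp [φ]⟩
  let w : Fin m × Fin n → (Fin a × Fin n) ⊕ (Fin b × Fin m) →
      MvPolynomial ((Fin m × Fin a) ⊕ (Fin n × Fin b)) ℂ := fun p =>
    Sum.elim (fun r => if p.2 = r.2 then MvPolynomial.X (Sum.inl (p.1, r.1)) else 0)
      (fun r => if p.1 = r.2 then MvPolynomial.X (Sum.inr (p.2, r.1)) else 0)
  have hspecial : rigidityColumn x y = fun p r => φ (w p r) := by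
    ext p (r | r)
    · by_cases h : p.2 = r.2 <;> simp [w, φ, rigidityColumn, h]
    · by_cases h : p.1 = r.2 <;> simp [w, φ, rigidityColumn, h]
  have hgeneric : rigidityColumn (K := RigidityField m n a b) (a := a) (b := b)
      rigidityX rigidityY = fun p r => algebraMap _ (RigidityField m n a b) (w p r) := by
    ext p (r | r)
    · by_cases h : p.2 = r.2 <;> simp [w, rigidityColumn, rigidityX, h]
    · by_cases h : p.1 = r.2 <;> simp [w, rigidityColumn, rigidityY, h]
  rw [columnRank, columnRank, hspecial, hgeneric]
  exact finrank_span_map_le_finrank_span_algebraMap hφ w X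

/-- The set of positions `X`, in a matrix with more rows. -/
def padRows {M : ℕ} (h : m ≤ M) (X : Finset (Fin m × Fin n)) : Finset (Fin M × Fin n) :=
  X.map ((Fin.castLEEmb h).prodMap (Function.Embedding.refl _))

theorem hasEntry_padRows {M : ℕ} (h : m ≤ M) (X : Finset (Fin m × Fin n)) (i j : ℕ) :
    HasEntry (padRows h X) i j ↔ HasEntry X i j := by
  constructor
  · rintro ⟨hi, hj, hX⟩
    obtain ⟨⟨i', j'⟩, hX', he⟩ := Finset.mem_map.1 hX
    obtain ⟨rfl, rfl⟩ : (i' : ℕ) = i ∧ (j' : ℕ) = j := by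
      simpa [Function.Embedding.prodMap, Prod.ext_iff, Fin.ext_iff] using he
    exact ⟨i'.2, j'.2, hX'⟩
  · rintro ⟨hi, hj, hX⟩
    exact ⟨hi.trans_le h, hj, Finset.mem_map_of_mem _ hX⟩

theorem columnCount_padRows {M : ℕ} (h : m ≤ M) (X : Finset (Fin m × Fin n)) (j : ℕ) :
    columnCount (padRows h X) j = columnCount X j := by
  classical
  rw [← card_filter_hasEntry X j h, columnCount]
  simp only [hasEntry_padRows]

theorem rankBounds_padRows {M : ℕ} (h : m ≤ M) (X : Finset (Fin m × Fin n)) (a b : ℕ) :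
    rankBounds (padRows h X) a b = rankBounds X a b := by
  have hentry : entryBit (padRows h X) = entryBit X := by
    ext i j
    by_cases hX : HasEntry X i j <;> simp [entryBit, hasEntry_padRows, hX]
  have hcross : crossBit (padRows h X) = crossBit X := by
    ext i i' k k' j
    simp only [crossBit, hentry]
  have hbound : rankBound a b (padRows h X) = rankBound a b X := by
    ext q c
    simp only [rankBound, columnCount_padRows]
  simp only [rankBounds, hentry, hcross, hbound]

theorem columnRank_padRows {M : ℕ} (h : m ≤ M) (x : Fin M → Fin a → K) (y : Fin n → Fin b → K)
    (X : Finset (Fin m × Fin n)) :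
    columnRank x y (padRows h X) = columnRank (fun i => x (Fin.castLE h i)) y X := by
  let ρ : (Fin a × Fin n) ⊕ (Fin b × Fin m) → (Fin a × Fin n) ⊕ (Fin b × Fin M) :=
    Sum.map id (Prod.map id (Fin.castLE h))
  have hρ : Function.Injective ρ := Function.injective_id.sumMap
    (Function.injective_id.prodMap (Fin.castLE_injective h))
  let E := Function.ExtendByZero.linearMap K ρ
  have hcol (p : Fin m × Fin n) : rigidityColumn x y (Fin.castLE h p.1, p.2) =
      E (rigidityColumn (fun i => x (Fin.castLE h i)) y p) := by
    ext r
    by_cases hr : ∃ r', ρ r' = r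
    · obtain ⟨r' | r', rfl⟩ := hr
      all_goals
        refine Eq.trans ?_ (hρ.extend_apply _ _ _).symm
        simp [ρ, rigidityColumn]
    · refine Eq.trans ?_ (Function.extend_apply' _ _ _ hr).symm
      rcases r with r | r
      · exact absurd ⟨Sum.inl r, rfl⟩ hr
      · refine if_neg fun he => hr ⟨Sum.inr (r.1, p.1), ?_⟩
        exact congrArg Sum.inr (Prod.ext rfl he)
  have himage : rigidityColumn x y '' (padRows h X : Finset _) =
      E '' (rigidityColumn (fun i => x (Fin.castLE h i)) y '' X) := by
    rw [padRows, Finset.coe_map, Set.image_image, Set.image_image]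
    exact Set.image_congr fun p _ => hcol p
  rw [columnRank, himage, ← Submodule.map_span, columnRank]
  exact (Submodule.equivMapOfInjective E (Function.extend_injective hρ _) _).finrank_eq.symm

end Rigidity

section UpperBound

variable {K : Type*} [Field K] {m n a b : ℕ}

/-- The set of rows of the elements of `Y` in the column `j`. -/
def columnRows (Y : Finset (Fin m × Fin n)) (j : Fin n) : Finset (Fin m) :=
  Finset.univ.filter fun i => (i, j) ∈ Y

theorem mem_columnRows {Y : Finset (Fin m × Fin n)} {j : Fin n} {i : Fin m} :
    i ∈ columnRows Y j ↔ (i, j) ∈ Y := by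
  simp [columnRows]

theorem hasEntry_iff_mem_columnRows {Y : Finset (Fin m × Fin n)} {j : Fin n} {i : Fin m} :
    HasEntry Y i j ↔ i ∈ columnRows Y j := by
  rw [mem_columnRows]
  exact ⟨fun ⟨_, _, h⟩ => h, fun h => ⟨i.2, j.2, h⟩⟩

theorem columnCount_eq_card_columnRows (Y : Finset (Fin m × Fin n)) (j : Fin n) :
    columnCount Y j = (columnRows Y j).card := by
  classical
  rw [columnCount, ← Finset.card_map Fin.valEmbedding]
  congr 1
  ext i
  simp only [Finset.mem_filter, Finset.mem_range, Finset.mem_map, Fin.valEmbedding_apply]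
  constructor
  · rintro ⟨hi, h⟩
    exact ⟨⟨i, hi⟩, hasEntry_iff_mem_columnRows.1 h, rfl⟩
  · rintro ⟨i, h, rfl⟩
    exact ⟨i.2, hasEntry_iff_mem_columnRows.2 h⟩

theorem rankBound_eq_sum_card_columnRows (Y : Finset (Fin m × Fin n)) (q : ℕ) (c : ℕ → ℕ) :
    rankBound a b Y q c = q * b + ∑ j : Fin n, min (columnRows Y j).card (a + c j) := by
  rw [rankBound, ← Fin.sum_univ_eq_sum_range (fun j => min (columnCount Y j) (a + c j))]
  simp only [columnCount_eq_card_columnRows]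

theorem sum_card_columnRows (Y : Finset (Fin m × Fin n)) :
    ∑ j, (columnRows Y j).card = Y.card := by
  rw [Finset.card_eq_sum_card_fiberwise (f := Prod.snd) (t := Finset.univ) (by simp)]
  refine Finset.sum_congr rfl fun j _ => ?_
  rw [← Finset.card_map (Function.Embedding.sectL (Fin m) j)]
  congr 1
  ext ⟨i, k⟩
  simp only [Finset.mem_map, mem_columnRows, Function.Embedding.sectL_apply, Prod.mk.injEq,
    Finset.mem_filter]
  constructor
  · rintro ⟨i', h, rfl, rfl⟩
    exact ⟨h, rfl⟩
  · rintro ⟨h, rfl⟩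
    exact ⟨i, h, rfl, rfl⟩

theorem entryBit_eq_ite (Y : Finset (Fin m × Fin n)) (i : Fin m) (j : Fin n) :
    entryBit Y i j = if i ∈ columnRows Y j then 1 else 0 := by
  by_cases h : i ∈ columnRows Y j <;> simp [entryBit, hasEntry_iff_mem_columnRows, h]

theorem entryBit_eq_card_inter (Y : Finset (Fin m × Fin n)) (i : Fin m) (j : Fin n) :
    entryBit Y i j = ({i} ∩ columnRows Y j).card := by
  rw [entryBit_eq_ite]
  by_cases h : i ∈ columnRows Y j <;> simp [h]

theorem entryBit_add_entryBit_eq_card_inter (Y : Finset (Fin m × Fin n)) {i i' : Fin m}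
    (hi : i ≠ i') (j : Fin n) :
    entryBit Y i j + entryBit Y i' j = ({i, i'} ∩ columnRows Y j).card := by
  rw [entryBit_eq_card_inter, entryBit_eq_card_inter, Finset.insert_eq,
    Finset.union_inter_distrib_right, Finset.card_union_of_disjoint]
  exact (Finset.disjoint_singleton.2 hi).mono Finset.inter_subset_left Finset.inter_subset_left

/- A family of vectors `u j ∈ U` supported in the respective columns of `Y` is orthogonal to the
columns of `x`; it is a relation as soon as the `b` vectors `∑ j, y j l • u j` in `U` vanish. -/
theorem sum_finrank_inf_spanSubset_le (x : Fin m → Fin a → K) (y : Fin n → Fin b → K)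
    (Y : Finset (Fin m × Fin n)) {U : Submodule K (Fin m → K)}
    (hU : U ≤ LinearMap.ker (Fintype.linearCombination K x)) :
    ∑ j, Module.finrank K (U ⊓ Pi.spanSubset K (columnRows Y j) : Submodule K (Fin m → K)) ≤
      Module.finrank K (columnRelations x y Y) + b * Module.finrank K U := by
  let W (j : Fin n) : Submodule K (Fin m → K) := U ⊓ Pi.spanSubset K (columnRows Y j)
  let Ψ : (∀ j, W j) →ₗ[K] (Fin b → U) := LinearMap.pi fun l =>
    ∑ j, y j l • (Submodule.inclusion (inf_le_left : W j ≤ U)).comp (LinearMap.proj j)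
  have hΨ := finrank_le_finrank_ker_add Ψ
  rw [Module.finrank_pi_fintype, Module.finrank_pi_fintype, Finset.sum_const, Finset.card_univ,
    Fintype.card_fin, smul_eq_mul] at hΨ
  refine hΨ.trans (Nat.add_le_add_right ?_ _)
  let E : (∀ j, W j) →ₗ[K] (Fin n → Fin m → K) :=
    LinearMap.pi fun j => (W j).subtype.comp (LinearMap.proj j)
  have hE : Function.Injective E := fun u v huv => by
    ext j i
    exact congrFun (congrFun huv j) i
  rw [(Submodule.equivMapOfInjective E hE (LinearMap.ker Ψ)).finrank_eq]
  refine Submodule.finrank_mono ?_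
  rintro _ ⟨u, hu, rfl⟩
  refine mem_columnRelations.2 ⟨fun j i hi => ?_, fun j t => ?_, fun i l => ?_⟩
  · exact Pi.mem_spanSubset_iff.1 (u j).2.2 i (by simpa [mem_columnRows] using hi)
  · have := congrFun (LinearMap.mem_ker.1 (hU (u j).2.1)) t
    simpa [E, Fintype.linearCombination_apply] using this
  · have := congrFun (congrArg Subtype.val (congrFun (LinearMap.mem_ker.1 hu) l)) i
    simpa [Ψ, E, mul_comm] using this

theorem columnRank_le_rankBound (x : Fin m → Fin a → K) (y : Fin n → Fin b → K)
    (Y : Finset (Fin m × Fin n)) {U : Submodule K (Fin m → K)}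
    (hU : U ≤ LinearMap.ker (Fintype.linearCombination K x)) (c : ℕ → ℕ)
    (h : ∀ j : Fin n, (columnRows Y j).card ≤ a + c j +
      Module.finrank K (U ⊓ Pi.spanSubset K (columnRows Y j) : Submodule K (Fin m → K))) :
    columnRank x y Y ≤ rankBound a b Y (Module.finrank K U) c := by
  have hrelations := sum_finrank_inf_spanSubset_le x y Y hU
  have hrank := columnRank_add_finrank_columnRelations x y Y
  have hcard : ∑ j : Fin n, (columnRows Y j).card ≤
      ∑ j : Fin n, min (columnRows Y j).card (a + c j) + ∑ j : Fin n,
        Module.finrank K (U ⊓ Pi.spanSubset K (columnRows Y j) : Submodule K (Fin m → K)) := by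
    rw [← Finset.sum_add_distrib]
    refine Finset.sum_le_sum fun j _ => ?_
    have := h j
    omega
  rw [sum_card_columnRows] at hcard
  rw [rankBound_eq_sum_card_columnRows, mul_comm]
  omega

theorem exists_le_ker_linearCombination (x : Fin m → Fin a → K) (S : Submodule K (Fin m → K))
    {k : ℕ} (hk : a + k ≤ Module.finrank K S) :
    ∃ U ≤ S, U ≤ LinearMap.ker (Fintype.linearCombination K x) ∧ Module.finrank K U = k := by
  have := finrank_le_finrank_inf_ker_add S (Fintype.linearCombination K x)
  rw [Module.finrank_fintype_fun_eq_card, Fintype.card_fin] at this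
  obtain ⟨U, hU, hr⟩ := exists_submodule_le_finrank_eq
    (S ⊓ LinearMap.ker (Fintype.linearCombination K x)) (k := k) (by omega)
  exact ⟨U, hU.trans inf_le_left, hU.trans inf_le_right, hr⟩

theorem columnRank_le_rankBound_inter (x : Fin (a + 3) → Fin a → K) (y : Fin n → Fin b → K)
    (Y : Finset (Fin (a + 3) × Fin n)) (I : Finset (Fin (a + 3))) {q : ℕ} (hI : q + I.card = 3)
    {c : ℕ → ℕ} (hc : ∀ j : Fin n, c j = (I ∩ columnRows Y j).card) :
    columnRank x y Y ≤ rankBound a b Y q c := by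
  have hZ : Module.finrank K (Pi.spanSubset K ((Iᶜ : Finset _) : Set (Fin (a + 3)))) = a + q := by
    rw [Pi.dim_spanSubset, Set.ncard_coe_finset, Finset.card_compl, Fintype.card_fin]
    omega
  obtain ⟨U, hUZ, hU, rfl⟩ := exists_le_ker_linearCombination x _ hZ.ge
  refine columnRank_le_rankBound x y Y hU c fun j => ?_
  have hmono {s t : Finset (Fin (a + 3))} (h : s ⊆ t) :
      Pi.spanSubset K (s : Set (Fin (a + 3))) ≤ Pi.spanSubset K t := fun f hf =>
    Pi.mem_spanSubset_iff.2 fun i hi => Pi.mem_spanSubset_iff.1 hf i (mt (h ·) hi)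
  have hdim := finrank_add_finrank_le_of_le hUZ
    (hmono (Finset.subset_compl_comm.1 (Finset.subset_compl_iff_disjoint_left.2
      (Finset.sdiff_disjoint (s := I) (t := columnRows Y j)))))
  rw [hZ, Pi.dim_spanSubset, Set.ncard_coe_finset] at hdim
  have hinf := Submodule.finrank_mono (inf_le_inf_left U
    (hmono (Finset.sdiff_subset (s := columnRows Y j) (t := I))))
  have hcard := Finset.card_sdiff_add_card_inter (columnRows Y j) I
  rw [hc, Finset.inter_comm]
  omega

/- The map `w ↦ (f w, g w)` to a space of dimension `4` is not onto, so `s (f w) + s' (g w) = 0` for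
some pair `(s, s') ≠ 0`. -/
theorem exists_ker_le_ker_comp {V : Type*} [AddCommGroup V] [Module K V] [FiniteDimensional K V]
    (hV : Module.finrank K V < 4) (f g : V →ₗ[K] K × K) :
    ∃ (φ : V →ₗ[K] K) (u v : K × K →ₗ[K] K), u ≠ 0 ∧ v ≠ 0 ∧
      LinearMap.ker φ ≤ LinearMap.ker (u.comp f) ∧ LinearMap.ker φ ≤ LinearMap.ker (v.comp g) := by
  have hne : LinearMap.range (f.prod g) < ⊤ := by
    refine Submodule.lt_top_of_finrank_lt_finrank ((LinearMap.finrank_range_le _).trans_lt ?_)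
    simpa using hV
  obtain ⟨s, hs, hs'⟩ := Submodule.exists_le_ker_of_lt_top _ hne
  set s₁ := s.comp (LinearMap.inl K (K × K) (K × K)) with hs₁
  set s₂ := s.comp (LinearMap.inr K (K × K) (K × K)) with hs₂
  have hsum (w : V) : s₁ (f w) + s₂ (g w) = 0 := by
    have : s (f w, g w) = 0 := hs' ⟨w, rfl⟩
    rw [← this, hs₁, hs₂, LinearMap.comp_apply, LinearMap.comp_apply, ← map_add]
    simp
  have hfst : LinearMap.fst K K K ≠ 0 := fun h => by simpa using LinearMap.congr_fun h (1, 0)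
  by_cases h₁ : s₁ = 0
  · have h₂ : s₂ ≠ 0 := fun h₂ => hs (LinearMap.prod_ext h₁ h₂)
    refine ⟨(LinearMap.fst K K K).comp f, _, s₂, hfst, h₂, le_rfl, fun w _ => ?_⟩
    simpa [h₁] using hsum w
  · by_cases h₂ : s₂ = 0
    · refine ⟨(LinearMap.fst K K K).comp g, s₁, _, h₁, hfst, fun w _ => ?_, le_rfl⟩
      simpa [h₂] using hsum w
    · refine ⟨s₁.comp f, s₁, s₂, h₁, h₂, le_rfl, fun w hw => ?_⟩
      simpa [show s₁ (f w) = 0 from hw] using hsum w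

theorem finrank_ker_comp_proj_prod_add_one {ι : Type*} [Fintype ι] {i i' : ι} (hi : i ≠ i')
    {u : K × K →ₗ[K] K} (hu : u ≠ 0) :
    Module.finrank K (LinearMap.ker (u.comp ((LinearMap.proj i).prod (LinearMap.proj i') :
      (ι → K) →ₗ[K] K × K))) + 1 = Fintype.card ι := by
  classical
  rw [Module.Dual.finrank_ker_add_one_of_ne_zero, Module.finrank_fintype_fun_eq_card]
  intro h
  apply hu
  ext
  · simpa [hi.symm] using LinearMap.congr_fun h (Pi.single i 1)
  · simpa [hi] using LinearMap.congr_fun h (Pi.single i' 1)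

theorem card_add_finrank_lt_of_le_ker_comp_proj_prod {ι : Type*} [Fintype ι] {i i' : ι}
    (hi : i ≠ i') {u : K × K →ₗ[K] K} (hu : u ≠ 0) {U : Submodule K (ι → K)}
    (hU : U ≤ LinearMap.ker (u.comp ((LinearMap.proj i).prod (LinearMap.proj i'))))
    {s : Finset ι} (his : i ∉ s) (his' : i' ∉ s) :
    s.card + Module.finrank K U <
      Fintype.card ι + Module.finrank K (U ⊓ Pi.spanSubset K s : Submodule K (ι → K)) := by
  have hs : Pi.spanSubset K s ≤
      LinearMap.ker (u.comp ((LinearMap.proj i).prod (LinearMap.proj i'))) := fun f hf => by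
    have h := Pi.mem_spanSubset_iff.1 hf
    simp [h i his, h i' his', ← Prod.zero_eq_mk]
  have hker := finrank_ker_comp_proj_prod_add_one hi hu
  have hdim := finrank_add_finrank_le_of_le hU hs
  rw [Pi.dim_spanSubset, Set.ncard_coe_finset] at hdim
  omega

theorem crossBit_eq_one {Y : Finset (Fin m × Fin n)} {i i' k k' : Fin m} {j : Fin n}
    (hi : i ∈ columnRows Y j ∨ i' ∈ columnRows Y j)
    (hk : k ∈ columnRows Y j ∨ k' ∈ columnRows Y j) : crossBit Y i i' k k' j = 1 := by
  simp only [crossBit, entryBit_eq_ite]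
  rcases hi with hi | hi <;> rcases hk with hk | hk <;> simp only [hi, hk, if_true] <;>
    split_ifs <;> rfl

theorem columnRank_le_rankBound_cross (x : Fin (a + 3) → Fin a → K) (y : Fin n → Fin b → K)
    (Y : Finset (Fin (a + 3) × Fin n)) {i i' k k' : Fin (a + 3)} (hi : i ≠ i') (hk : k ≠ k') :
    columnRank x y Y ≤ rankBound a b Y 2 (crossBit Y i i' k k') := by
  let f : (Fin (a + 3) → K) →ₗ[K] K × K := (LinearMap.proj i).prod (LinearMap.proj i')
  let g : (Fin (a + 3) → K) →ₗ[K] K × K := (LinearMap.proj k).prod (LinearMap.proj k')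
  obtain ⟨U, hU, hr, u, v, hu, hv, hf, hg⟩ : ∃ U : Submodule K (Fin (a + 3) → K),
      U ≤ LinearMap.ker (Fintype.linearCombination K x) ∧ Module.finrank K U = 2 ∧
      ∃ u v : K × K →ₗ[K] K, u ≠ 0 ∧ v ≠ 0 ∧
        U ≤ LinearMap.ker (u.comp f) ∧ U ≤ LinearMap.ker (v.comp g) := by
    obtain ⟨U₀, -, hU₀, hr₀⟩ := exists_le_ker_linearCombination x ⊤ (k := 3) (by simp)
    obtain ⟨φ, u, v, hu, hv, hf, hg⟩ := exists_ker_le_ker_comp (hr₀.trans_lt (by norm_num))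
      (f.comp U₀.subtype) (g.comp U₀.subtype)
    have hker := finrank_le_finrank_ker_add φ
    rw [hr₀, Module.finrank_self] at hker
    obtain ⟨U₁, hU₁, hr⟩ := exists_submodule_le_finrank_eq (LinearMap.ker φ) (k := 2) (by omega)
    refine ⟨U₁.map U₀.subtype, (Submodule.map_subtype_le _ _).trans hU₀,
      (Submodule.finrank_map_subtype_eq _ _).trans hr, u, v, hu, hv, ?_, ?_⟩ <;>
    rw [Submodule.map_le_iff_le_comap]
    exacts [hU₁.trans hf, hU₁.trans hg]
  rw [← hr]
  refine columnRank_le_rankBound x y Y hU _ fun j => ?_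
  by_cases h₁ : i ∈ columnRows Y j ∨ i' ∈ columnRows Y j
  · by_cases h₂ : k ∈ columnRows Y j ∨ k' ∈ columnRows Y j
    · have hdim := finrank_add_finrank_le_of_le (S := U)
        (T := Pi.spanSubset K (columnRows Y j)) le_top le_top
      rw [Pi.dim_spanSubset, Set.ncard_coe_finset, finrank_top,
        Module.finrank_fintype_fun_eq_card, Fintype.card_fin] at hdim
      have := crossBit_eq_one h₁ h₂
      omega
    · obtain ⟨hk₁, hk₂⟩ := not_or.1 h₂
      have := card_add_finrank_lt_of_le_ker_comp_proj_prod hk hv hg hk₁ hk₂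
      rw [Fintype.card_fin] at this
      omega
  · obtain ⟨hi₁, hi₂⟩ := not_or.1 h₁
    have := card_add_finrank_lt_of_le_ker_comp_proj_prod hi hu hf hi₁ hi₂
    rw [Fintype.card_fin] at this
    omega

theorem columnRank_le_of_mem_rankBounds (x : Fin (a + 3) → Fin a → K) (y : Fin n → Fin b → K)
    (Y : Finset (Fin (a + 3) × Fin n)) {r : ℕ} (hr : r ∈ rankBounds Y a b) :
    columnRank x y Y ≤ r := by
  have hne {i i' : ℕ} (hi : i < a + 3) (h : i' < i) :
      (⟨i, hi⟩ : Fin (a + 3)) ≠ ⟨i', h.trans hi⟩ := fun he => h.ne' (Fin.mk.inj_iff.1 he)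
  simp only [rankBounds, Set.mem_union, Set.mem_singleton_iff, Set.mem_iUnion, exists_prop] at hr
  rcases hr with rfl | rfl | ⟨i, hi, rfl | ⟨i', hi', rfl | ⟨k, hk, k', hk', rfl⟩⟩⟩
  · rw [← finrank_bot K (Fin (a + 3) → K)]
    refine columnRank_le_rankBound x y Y bot_le _ fun j => le_add_right ?_
    simpa using (columnRows Y j).card_le_univ
  · exact columnRank_le_rankBound_inter x y Y ∅ (by simp) (by simp)
  · refine columnRank_le_rankBound_inter x y Y {⟨i, hi⟩} (by simp)
      (c := entryBit Y i) fun j => ?_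
    exact entryBit_eq_card_inter Y ⟨i, hi⟩ j
  · refine columnRank_le_rankBound_inter x y Y {⟨i, hi⟩, ⟨i', hi'.trans hi⟩}
      (by rw [Finset.card_pair (hne hi hi')]) fun j => ?_
    exact entryBit_add_entryBit_eq_card_inter Y (hne hi hi') j
  · exact columnRank_le_rankBound_cross x y Y (i := ⟨i, hi⟩) (i' := ⟨i', hi'.trans hi⟩)
      (k := ⟨k, hk⟩) (k' := ⟨k', hk'.trans hk⟩) (hne hi hi') (hne hk hk')

end UpperBound

section Assignment

variable {α β : Type*} [DecidableEq α]

/-- Monotone submodular functions on finite sets. -/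
structure MonotoneSubmodular (F : Finset α → ℕ) : Prop where
  monotone : Monotone F
  submodular : ∀ A B, F (A ∪ B) + F (A ∩ B) ≤ F A + F B

namespace MonotoneSubmodular

variable {F : Finset α → ℕ}

theorem union_left (hF : MonotoneSubmodular F) (C : Finset α) :
    MonotoneSubmodular fun A => F (C ∪ A) where
  monotone _ _ h := hF.monotone (Finset.union_subset_union_right h)
  submodular A B := by
    rw [Finset.union_union_distrib_left, Finset.union_inter_distrib_left]
    exact hF.submodular _ _

theorem min_left (hF : MonotoneSubmodular F) (c : ℕ) :
    MonotoneSubmodular fun A => min c (F A) where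
  monotone _ _ h := min_le_min_left c (hF.monotone h)
  submodular A B := by
    have := hF.submodular A B
    have := hF.monotone (Finset.inter_subset_left : A ∩ B ⊆ A)
    have := hF.monotone (Finset.inter_subset_right : A ∩ B ⊆ B)
    have := hF.monotone (Finset.subset_union_left : A ⊆ A ∪ B)
    have := hF.monotone (Finset.subset_union_right : B ⊆ A ∪ B)
    omega

theorem insert_le (hF : MonotoneSubmodular F) (j : α) (A : Finset α) :
    F (insert j A) ≤ F {j} + F A := by
  rw [Finset.insert_eq]
  exact (Nat.le_add_right _ _).trans (hF.submodular _ _)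

theorem card_biUnion {γ : Type*} [DecidableEq γ] (S : α → Finset γ) :
    MonotoneSubmodular fun A => (A.biUnion S).card where
  monotone _ _ h := Finset.card_le_card (Finset.biUnion_subset_biUnion_of_subset_left S h)
  submodular A B := by
    rw [← Finset.card_union_add_card_inter (A.biUnion S), Finset.union_biUnion]
    gcongr
    exact Finset.subset_inter
      (Finset.biUnion_subset_biUnion_of_subset_left S Finset.inter_subset_left)
      (Finset.biUnion_subset_biUnion_of_subset_left S Finset.inter_subset_right)

theorem finrank_iSup {K V : Type*} [Field K] [AddCommGroup V] [Module K V]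
    [FiniteDimensional K V] (S : α → Submodule K V) :
    MonotoneSubmodular fun A => Module.finrank K (⨆ k ∈ A, S k : Submodule K V) where
  monotone _ _ h := Submodule.finrank_mono (biSup_mono h)
  submodular A B := by
    rw [← Submodule.finrank_sup_add_finrank_inf_eq (⨆ k ∈ A, S k), Finset.iSup_union]
    gcongr
    exact Submodule.finrank_mono (le_inf (biSup_mono fun _ hk => (Finset.mem_inter.1 hk).1)
      (biSup_mono fun _ hk => (Finset.mem_inter.1 hk).2))

end MonotoneSubmodular

theorem submodular_card_sdiff_add_sum [Fintype β] {F : β → Finset α → ℕ}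
    (hF : ∀ t, MonotoneSubmodular (F t)) (E A B : Finset α) :
    (E \ (A ∪ B)).card + ∑ t, F t (A ∪ B) + ((E \ (A ∩ B)).card + ∑ t, F t (A ∩ B)) ≤
      (E \ A).card + ∑ t, F t A + ((E \ B).card + ∑ t, F t B) := by
  have hcard := Finset.card_union_add_card_inter (E \ A) (E \ B)
  rw [← Finset.sdiff_inter_distrib_right, ← Finset.sdiff_union_distrib] at hcard
  have hsum := Finset.sum_le_sum fun t (_ : t ∈ Finset.univ) => (hF t).submodular A B
  rw [Finset.sum_add_distrib, Finset.sum_add_distrib] at hsum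
  omega

theorem exists_greatest_lt_of_submodular {G : Finset α → ℕ}
    (hG : ∀ A B, G (A ∪ B) + G (A ∩ B) ≤ G A + G B) {E : Finset α} {v : ℕ}
    (hle : ∀ A ⊆ E, v ≤ G A + 1) (hlt : ∃ A ⊆ E, G A < v) :
    ∃ A₀ ⊆ E, G A₀ < v ∧ ∀ A ⊆ E, G A < v → A ⊆ A₀ := by
  obtain ⟨A, hA, hAv⟩ := hlt
  obtain ⟨A₀, hA₀, hmax⟩ := Finset.exists_max_image (E.powerset.filter fun A => G A < v)
    Finset.card ⟨A, by simp [hA, hAv]⟩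
  simp only [Finset.mem_filter, Finset.mem_powerset] at hA₀ hmax
  refine ⟨A₀, hA₀.1, hA₀.2, fun B hB hBv => ?_⟩
  have hunion : G (B ∪ A₀) < v := by
    have := hG B A₀
    have := hle (B ∩ A₀) (Finset.inter_subset_left.trans hB)
    omega
  rw [Finset.eq_of_subset_of_card_le Finset.subset_union_right
    (hmax _ ⟨Finset.union_subset hB hA₀.1, hunion⟩)]
  exact Finset.subset_union_left

/- If `v` exceeds `|E \ A| + ∑ t, F t A` for some `A ⊆ E`, there is a greatest such `A`; the new
element `k` has to increase one of the values at this set, and by submodularity this `t` then works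
for all `A`. -/
theorem exists_insert_assignment [Fintype β] [DecidableEq β] {F : β → Finset α → ℕ}
    (hF : ∀ t, MonotoneSubmodular (F t)) {E : Finset α} {k : α} (hk : k ∉ E) {v : ℕ}
    (hv : ∀ A ⊆ insert k E, v ≤ (insert k E \ A).card + ∑ t, F t A)
    (hlt : ∃ A ⊆ E, (E \ A).card + ∑ t, F t A < v) :
    ∃ t, ∀ A ⊆ E, v ≤ (E \ A).card + ∑ s, F s (if s = t then insert k A else A) := by
  have hge (A : Finset α) (hA : A ⊆ E) : v ≤ (E \ A).card + ∑ t, F t A + 1 := by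
    have := hv A (hA.trans (Finset.subset_insert k E))
    rw [Finset.insert_sdiff_of_notMem _ fun h => hk (hA h), Finset.card_insert_of_notMem
      fun h => hk (Finset.mem_sdiff.1 h).1] at this
    omega
  obtain ⟨A₀, hA₀, hA₀v, hmax⟩ :=
    exists_greatest_lt_of_submodular (submodular_card_sdiff_add_sum hF E) hge hlt
  obtain ⟨t, ht⟩ : ∃ t, F t A₀ < F t (insert k A₀) := by
    by_contra! hcon
    have hins := hv (insert k A₀) (Finset.insert_subset_insert k hA₀)
    rw [Finset.insert_sdiff_insert, Finset.sdiff_insert_of_notMem hk] at hins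
    have := Finset.sum_le_sum fun t (_ : t ∈ Finset.univ) => hcon t
    omega
  refine ⟨t, fun A hA => ?_⟩
  have hle (s : β) : F s A ≤ F s (if s = t then insert k A else A) := by
    apply (hF s).monotone
    split_ifs
    exacts [Finset.subset_insert k A, subset_rfl]
  by_cases hAv : (E \ A).card + ∑ t, F t A < v
  · have hAA₀ := hmax A hA hAv
    have hsub := (hF t).submodular A₀ (insert k A)
    rw [Finset.union_insert, Finset.union_eq_left.2 hAA₀,
      Finset.inter_insert_of_notMem fun h => hk (hA₀ h), Finset.inter_eq_right.2 hAA₀] at hsub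
    have hsum : ∑ s, F s A < ∑ s, F s (if s = t then insert k A else A) := by
      refine Finset.sum_lt_sum (fun s _ => hle s) ⟨t, Finset.mem_univ t, ?_⟩
      rw [if_pos rfl]
      omega
    have := hge A hA
    omega
  · have := Finset.sum_le_sum fun s (_ : s ∈ Finset.univ) => hle s
    omega

theorem exists_assignment [Fintype β] [DecidableEq β] (E : Finset α) {F : β → Finset α → ℕ}
    (hF : ∀ t, MonotoneSubmodular (F t)) {v : ℕ}
    (hv : ∀ A ⊆ E, v ≤ (E \ A).card + ∑ t, F t A) :
    ∃ σ : α → Option β, v ≤ ∑ t, F t (E.filter fun k => σ k = some t) := by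
  induction E using Finset.induction_on generalizing F v with
  | empty => exact ⟨fun _ => none, by simpa using hv ∅⟩
  | insert k E hk ih =>
    have hupdate (σ : α → Option β) (o : Option β) (t : β) :
        (insert k E).filter (fun j => Function.update σ k o j = some t) =
          if o = some t then insert k (E.filter fun j => σ j = some t)
            else E.filter fun j => σ j = some t := by
      have hE (j : α) (hj : j ∈ E) : Function.update σ k o j = some t ↔ σ j = some t := by
        rw [Function.update_of_ne (ne_of_mem_of_not_mem hj hk)]
      rw [Finset.filter_insert, Function.update_self, Finset.filter_congr hE]
    by_cases h : ∀ A ⊆ E, v ≤ (E \ A).card + ∑ t, F t A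
    · obtain ⟨σ, hσ⟩ := ih hF h
      exact ⟨Function.update σ k none, by simpa [hupdate] using hσ⟩
    · push Not at h
      obtain ⟨t, ht⟩ := exists_insert_assignment hF hk hv h
      obtain ⟨σ, hσ⟩ := ih (F := fun s A => F s (if s = t then insert k A else A)) (fun s => by
        by_cases hs : s = t
        · simpa only [if_pos hs, Finset.insert_eq] using (hF s).union_left {k}
        · simpa only [if_neg hs] using hF s) ht
      exact ⟨Function.update σ k (some t), by simpa [hupdate, eq_comm (a := t)] using hσ⟩

theorem exists_assignment_le [Fintype β] [DecidableEq β] (E : Finset α) {F : β → Finset α → ℕ}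
    (hF : ∀ t, MonotoneSubmodular (F t)) :
    ∃ σ : α → Option β, ∃ A ⊆ E,
      (E \ A).card + ∑ t, F t A ≤ ∑ t, F t (E.filter fun k => σ k = some t) := by
  obtain ⟨A, hA, hmin⟩ := Finset.exists_min_image E.powerset
    (fun A => (E \ A).card + ∑ t, F t A) ⟨∅, by simp⟩
  obtain ⟨σ, hσ⟩ := exists_assignment E hF fun B hB => hmin B (Finset.mem_powerset.2 hB)
  exact ⟨σ, A, Finset.mem_powerset.1 hA, hσ⟩

theorem sum_comp_embedding_add_le {ι : Type*} [Fintype ι] [Fintype β] (f : ι ↪ β) (g : β → ℕ)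
    {d : ℕ} (hd : ∀ t, d ≤ g t) :
    ∑ j, g (f j) + (Fintype.card β - Fintype.card ι) * d ≤ ∑ t, g t := by
  classical
  rw [← Finset.sum_add_sum_compl (Finset.univ.map f) g, Finset.sum_map]
  gcongr
  have := Finset.card_nsmul_le_sum (Finset.univ.map f)ᶜ g d fun t _ => hd t
  rwa [Finset.card_compl, Finset.card_map, Finset.card_univ, smul_eq_mul] at this

end Assignment

section Assigned

variable {α β : Type*} [Fintype α]

theorem exists_forall_ne_eq_of_not_surjective [Fintype β] (hcard : Fintype.card β ≤ Fintype.card α)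
    {σ : α → Option β} {t : β} (ht : ∀ j, σ j ≠ some t) :
    ∃ j, ∀ s, σ j = some s → ∃ j', j' ≠ j ∧ σ j' = some s := by
  by_contra! hcon
  choose f hf hf' using hcon
  have hinj : Function.Injective f := fun i j hij => by
    by_contra hne
    exact hf' j i hne (hij ▸ hf i)
  have := Fintype.card_lt_of_injective_of_notMem f hinj (b := t) (by
    rintro ⟨j, rfl⟩
    exact ht j (hf j))
  omega

variable [DecidableEq β]

/-- The set of all elements that are assigned to `t` by the partial map `τ`. -/
def assigned (τ : α → Option β) (t : β) : Finset α :=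
  Finset.univ.filter fun j => τ j = some t

theorem mem_assigned {τ : α → Option β} {t : β} {j : α} : j ∈ assigned τ t ↔ τ j = some t := by
  simp [assigned]

variable [DecidableEq α]

theorem exists_assigned_le_of_disjoint [Fintype β] {F : Finset α → ℕ} (hF : MonotoneSubmodular F)
    {B E : Finset α} (hBE : Disjoint B E) (hB : B.card ≤ Fintype.card β) :
    ∃ τ : α → Option β, ∃ A ⊆ E, (E \ A).card + (∑ j ∈ B, F (insert j A) +
      (Fintype.card β - B.card) * F A) ≤ ∑ t, F (assigned τ t) := by
  classical
  obtain ⟨f⟩ := Function.Embedding.nonempty_of_card_le (α := B) (β := β) (by simpa using hB)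
  let ρ (j : α) : Option β := if h : j ∈ B then some (f ⟨j, h⟩) else none
  have hρ (j : B) : ρ j = some (f j) := dif_pos j.2
  obtain ⟨σ, A, hAE, hσ⟩ := exists_assignment_le E fun t : β => hF.union_left (assigned ρ t)
  let τ (j : α) : Option β := if j ∈ B then ρ j else σ j
  have hτ (t : β) : assigned ρ t ∪ (E.filter fun k => σ k = some t) ⊆ assigned τ t := by
    intro j hj
    rw [Finset.mem_union, mem_assigned, Finset.mem_filter] at hj
    rw [mem_assigned]
    rcases hj with hj | ⟨hjE, hj⟩
    · have hjB : j ∈ B := by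
        by_contra hjB
        simp [ρ, hjB] at hj
      rw [← hj]
      exact if_pos hjB
    · rw [← hj]
      exact if_neg (Finset.disjoint_right.1 hBE hjE)
  refine ⟨τ, A, hAE, le_trans ?_ (hσ.trans (Finset.sum_le_sum fun t _ => hF.monotone (hτ t)))⟩
  gcongr
  refine le_trans ?_ (sum_comp_embedding_add_le f (fun t => F (assigned ρ t ∪ A))
    fun t => hF.monotone Finset.subset_union_right)
  rw [Fintype.card_coe, ← Finset.sum_coe_sort B]
  gcongr with j
  refine hF.monotone (Finset.insert_subset ?_ Finset.subset_union_right)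
  exact Finset.mem_union_left _ (mem_assigned.2 (hρ j))

theorem exists_sum_insert_add_le_sum_assigned [Fintype β] {F : Finset α → ℕ}
    (hF : MonotoneSubmodular F)
    (hcard : (Finset.univ.filter fun j => 2 ≤ F {j}).card ≤ Fintype.card β) :
    ∃ τ : α → Option β, ∃ A : Finset α, (∀ j ∈ A, F {j} = 1) ∧
      ∑ j, F (insert j A) + Fintype.card β * F A ≤
        ∑ t, F (assigned τ t) + Fintype.card α * F A := by
  set B := Finset.univ.filter fun j => 2 ≤ F {j}
  set E := Finset.univ.filter fun j => F {j} = 1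
  have hBE : Disjoint B E := Finset.disjoint_filter.2 fun j _ h => by omega
  obtain ⟨τ, A, hAE, hτ⟩ := exists_assigned_le_of_disjoint hF hBE hcard
  refine ⟨τ, A, fun j hj => (Finset.mem_filter.1 (hAE hj)).2, ?_⟩
  have hpoint (j : α) : F (insert j A) + (if j ∈ B then F A else 0) ≤
      F A + (if j ∈ E \ A then 1 else 0) + if j ∈ B then F (insert j A) else 0 := by
    have hle := hF.insert_le j A
    by_cases hjB : j ∈ B
    · simp only [if_pos hjB]
      omega
    by_cases hjA : j ∈ A
    · simp [hjA]
    simp only [B, E, Finset.mem_filter, Finset.mem_univ, true_and, Finset.mem_sdiff, hjA,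
      not_false_eq_true, and_true] at hjB ⊢
    split_ifs <;> omega
  have hsum := Finset.sum_le_sum fun j (_ : j ∈ Finset.univ) => hpoint j
  simp only [Finset.sum_add_distrib, Finset.sum_ite_mem, Finset.univ_inter, Finset.sum_const,
    smul_eq_mul, Finset.card_univ, mul_one] at hsum
  have hmul : Fintype.card β * F A = B.card * F A + (Fintype.card β - B.card) * F A := by
    rw [← add_mul, Nat.add_sub_cancel' hcard]
  omega

theorem sum_assigned_le_sum_assigned_update [Fintype β] {F : Finset α → ℕ}
    (hF : MonotoneSubmodular F) (hF₀ : F ∅ = 0) {σ : α → Option β} {t : β}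
    (ht : ∀ j, σ j ≠ some t) (j : α) :
    ∑ s, F (assigned σ s) ≤ ∑ s, F (assigned (Function.update σ j (some t)) s) := by
  set σ' := Function.update σ j (some t)
  have hempty : assigned σ t = ∅ := by simpa [assigned, Finset.filter_eq_empty_iff] using ht
  have hmem (s : β) (hs : s ≠ t) (i : α) : i ∈ assigned σ' s ↔ i ≠ j ∧ i ∈ assigned σ s := by
    rw [mem_assigned, mem_assigned]
    rcases eq_or_ne i j with rfl | hij
    · simp [σ', hs.symm]
    · simp [σ', hij]
  have hsame (s : β) (hs : s ≠ t) (hj : σ j ≠ some s) : assigned σ' s = assigned σ s := by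
    ext i
    rw [hmem s hs, and_iff_right_iff_imp, mem_assigned]
    rintro hi rfl
    exact hj hi
  have hj : F {j} ≤ F (assigned σ' t) :=
    hF.monotone (Finset.singleton_subset_iff.2 (mem_assigned.2 (Function.update_self _ _ _)))
  rcases hs : σ j with _ | s
  · refine Finset.sum_le_sum fun s _ => ?_
    rcases eq_or_ne s t with rfl | hst
    · rw [hempty, hF₀]
      exact Nat.zero_le _
    · rw [hsame s hst (by simp [hs])]
  · have hst : s ≠ t := fun h => ht j (h ▸ hs)
    have hinsert : assigned σ s ⊆ insert j (assigned σ' s) := fun i hi => by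
      rw [Finset.mem_insert, hmem s hst]
      tauto
    have hle := (hF.monotone hinsert).trans (hF.insert_le _ _)
    have hst' := Finset.mem_erase.2 ⟨hst, Finset.mem_univ s⟩
    rw [← Finset.add_sum_erase _ _ (Finset.mem_univ t), ← Finset.add_sum_erase _ _ hst',
      ← Finset.add_sum_erase _ (fun s => F (assigned σ' s)) (Finset.mem_univ t),
      ← Finset.add_sum_erase _ _ hst', hempty, hF₀, Finset.sum_congr rfl fun r hr => by
        simp only [Finset.mem_erase] at hr
        rw [← hsame r hr.2.1 (by rw [hs]; simpa using Ne.symm hr.1)]]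
    omega

theorem exists_surjective_assigned_le [Fintype β] {F : Finset α → ℕ} (hF : MonotoneSubmodular F)
    (hF₀ : F ∅ = 0) (hcard : Fintype.card β ≤ Fintype.card α) (τ : α → Option β) :
    ∃ σ : α → Option β, (∀ t, ∃ j, σ j = some t) ∧
      ∑ t, F (assigned τ t) ≤ ∑ t, F (assigned σ t) := by
  let hit (σ : α → Option β) : Finset β := Finset.univ.filter fun t => ∃ j, σ j = some t
  have mem_hit {σ : α → Option β} {t : β} : t ∈ hit σ ↔ ∃ j, σ j = some t := by simp [hit]
  obtain ⟨σ, hσ, hmax⟩ := Finset.exists_max_image (Finset.univ.filter fun σ : α → Option β =>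
      ∑ t, F (assigned τ t) ≤ ∑ t, F (assigned σ t)) (fun σ => (hit σ).card) ⟨τ, by simp⟩
  simp only [Finset.mem_filter, Finset.mem_univ, true_and] at hσ hmax
  refine ⟨σ, ?_, hσ⟩
  by_contra! hcon
  obtain ⟨t, ht⟩ := hcon
  obtain ⟨j, hj⟩ := exists_forall_ne_eq_of_not_surjective hcard ht
  have hsub : hit σ ⊂ hit (Function.update σ j (some t)) := by
    rw [Finset.ssubset_iff_of_subset fun s hs => ?_]
    · exact ⟨t, mem_hit.2 ⟨j, Function.update_self _ _ _⟩, fun h => (mem_hit.1 h).elim ht⟩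
    · obtain ⟨i, hi⟩ := mem_hit.1 hs
      rcases eq_or_ne i j with rfl | hij
      · obtain ⟨j', hne, hj'⟩ := hj s hi
        exact mem_hit.2 ⟨j', by rwa [Function.update_of_ne hne]⟩
      · exact mem_hit.2 ⟨i, by rwa [Function.update_of_ne hij]⟩
  exact (hmax _ (hσ.trans (sum_assigned_le_sum_assigned_update hF hF₀ ht j))).not_gt
    (Finset.card_lt_card hsub)

end Assigned

section Vanishing

variable {K ι : Type*} [Field K]

/-- The elements of `N` that vanish on `S`. -/
def vanishOn (N : Submodule K (ι → K)) (S : Finset ι) : Submodule K (ι → K) :=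
  N ⊓ LinearMap.ker (LinearMap.funLeft K K (Subtype.val : S → ι))

theorem mem_vanishOn {N : Submodule K (ι → K)} {S : Finset ι} {f : ι → K} :
    f ∈ vanishOn N S ↔ f ∈ N ∧ ∀ i ∈ S, f i = 0 := by
  simp [vanishOn, LinearMap.funLeft, funext_iff]

theorem vanishOn_union [DecidableEq ι] (N : Submodule K (ι → K)) (S T : Finset ι) :
    vanishOn N (S ∪ T) = vanishOn N S ⊓ vanishOn N T := by
  ext f
  simp only [Submodule.mem_inf, mem_vanishOn, Finset.mem_union]
  grind

theorem vanishOn_anti (N : Submodule K (ι → K)) {S T : Finset ι} (h : S ⊆ T) :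
    vanishOn N T ≤ vanishOn N S := fun _ hf =>
  mem_vanishOn.2 ⟨(mem_vanishOn.1 hf).1, fun i hi => (mem_vanishOn.1 hf).2 i (h hi)⟩

theorem vanishOn_le (N : Submodule K (ι → K)) (S : Finset ι) : vanishOn N S ≤ N :=
  inf_le_left

theorem finrank_vanishOn_le_finrank_vanishOn_union_add_card [Finite ι] [DecidableEq ι]
    (N : Submodule K (ι → K)) (S T : Finset ι) :
    Module.finrank K (vanishOn N S) ≤ Module.finrank K (vanishOn N (S ∪ T)) + T.card := by
  have h := finrank_le_finrank_inf_ker_add (vanishOn N S)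
    (LinearMap.funLeft K K (Subtype.val : T → ι))
  rw [Module.finrank_fintype_fun_eq_card, Fintype.card_coe] at h
  refine h.trans (Nat.add_le_add_right (Submodule.finrank_mono ?_) _)
  rw [vanishOn_union]
  exact le_inf inf_le_left (inf_le_inf_right _ (vanishOn_le N S))

/-- A three-dimensional space of functions in general position with respect to the coordinates. -/
structure InGeneralPosition (N : Submodule K (ι → K)) : Prop where
  finrank_eq : Module.finrank K N = 3
  vanishOn_eq_bot : ∀ S : Finset ι, S.card = 3 → vanishOn N S = ⊥
  sup_eq : ∀ P Q R : Finset ι, P.card = 2 → Q.card = 2 → R.card = 2 → Disjoint P Q →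
    Disjoint P R → Disjoint Q R → N ≤ vanishOn N P ⊔ vanishOn N Q ⊔ vanishOn N R

namespace InGeneralPosition

variable [Fintype ι] {N : Submodule K (ι → K)}

theorem finrank_vanishOn (hN : InGeneralPosition N) (hι : 3 ≤ Fintype.card ι) (S : Finset ι) :
    Module.finrank K (vanishOn N S) = 3 - S.card := by
  classical
  have hge := finrank_vanishOn_le_finrank_vanishOn_union_add_card N ∅ S
  have hN₀ : vanishOn N ∅ = N := by
    ext f
    simp [mem_vanishOn]
  rw [hN₀, Finset.empty_union, hN.finrank_eq] at hge
  rcases le_or_gt 3 S.card with h | h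
  · obtain ⟨T, hTS, hT⟩ := Finset.exists_subset_card_eq h
    rw [eq_bot_iff.2 ((vanishOn_anti N hTS).trans (hN.vanishOn_eq_bot T hT).le), finrank_bot,
      Nat.sub_eq_zero_of_le h]
  · obtain ⟨T, hST, hT⟩ := Finset.exists_superset_card_eq h.le hι
    have hle := finrank_vanishOn_le_finrank_vanishOn_union_add_card N S (T \ S)
    rw [Finset.union_sdiff_of_subset hST, hN.vanishOn_eq_bot T hT, finrank_bot,
      Finset.card_sdiff_of_subset hST, hT] at hle
    omega

theorem three_sub_card_le_finrank_sup (hN : InGeneralPosition N) (hι : 3 ≤ Fintype.card ι)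
    (S : Finset ι) (V : Submodule K (ι → K)) :
    3 - S.card ≤ Module.finrank K (vanishOn N S ⊔ V : Submodule K (ι → K)) := by
  rw [← hN.finrank_vanishOn hι]
  exact Submodule.finrank_mono le_sup_left

theorem subset_of_vanishOn_le (hN : InGeneralPosition N) (hι : 3 ≤ Fintype.card ι)
    {P T : Finset ι} (hP : P.card = 2) (h : vanishOn N P ≤ vanishOn N T) : T ⊆ P := by
  classical
  intro p hp
  by_contra hpP
  have hle : vanishOn N P ≤ vanishOn N (insert p P) := by
    rw [Finset.insert_eq, vanishOn_union]
    exact le_inf (h.trans (vanishOn_anti N (Finset.singleton_subset_iff.2 hp))) le_rfl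
  have hrank := Submodule.finrank_mono hle
  rw [hN.finrank_vanishOn hι, hN.finrank_vanishOn hι, Finset.card_insert_of_notMem hpP, hP] at hrank
  omega

theorem two_le_finrank (hN : InGeneralPosition N) (hι : 3 ≤ Fintype.card ι) {P Q : Finset ι}
    (hP : P.card = 2) (hQ : Q.card = 2) (hPQ : P ≠ Q) {V : Submodule K (ι → K)}
    (hPV : vanishOn N P ≤ V) (hQV : vanishOn N Q ≤ V) : 2 ≤ Module.finrank K V := by
  by_contra! hlt
  have hV : vanishOn N Q = V := Submodule.eq_of_le_of_finrank_le hQV (by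
    rw [hN.finrank_vanishOn hι, hQ]
    omega)
  have hsub := hN.subset_of_vanishOn_le hι hP (hV ▸ hPV)
  exact hPQ (Finset.eq_of_subset_of_card_le hsub (by omega)).symm

theorem mem_of_mem_of_mem (hN : InGeneralPosition N) (hι : 3 ≤ Fintype.card ι)
    {P Q R : Finset ι} (hP : P.card = 2) (hQ : Q.card = 2) (hR : R.card = 2) (hPQ : P ≠ Q)
    {V : Submodule K (ι → K)} (hPV : vanishOn N P ≤ V) (hQV : vanishOn N Q ≤ V)
    (hRV : vanishOn N R ≤ V) (hV : Module.finrank K V ≤ 2) {i : ι} (hiP : i ∈ P) (hiQ : i ∈ Q) :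
    i ∈ R := by
  have hsup : vanishOn N P ⊔ vanishOn N Q = V :=
    Submodule.eq_of_le_of_finrank_le (sup_le hPV hQV)
      (hV.trans (hN.two_le_finrank hι hP hQ hPQ le_sup_left le_sup_right))
  have hle : vanishOn N R ≤ vanishOn N {i} := by
    rw [← hsup] at hRV
    exact hRV.trans (sup_le (vanishOn_anti N (Finset.singleton_subset_iff.2 hiP))
      (vanishOn_anti N (Finset.singleton_subset_iff.2 hiQ)))
  exact hN.subset_of_vanishOn_le hι hR hle (Finset.mem_singleton_self i)

theorem three_le_finrank_sup (hN : InGeneralPosition N) (hι : 3 ≤ Fintype.card ι)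
    {P T : Finset ι} (hP : P.card = 2) (hT : T.card ≤ 1) (hTP : ¬ T ⊆ P)
    {V : Submodule K (ι → K)} (hPV : vanishOn N P ≤ V) :
    3 ≤ Module.finrank K (vanishOn N T ⊔ V : Submodule K (ι → K)) := by
  by_contra! hlt
  have hsup : vanishOn N T = vanishOn N T ⊔ V :=
    Submodule.eq_of_le_of_finrank_le le_sup_left (by
      rw [hN.finrank_vanishOn hι]
      omega)
  exact hTP (hN.subset_of_vanishOn_le hι hP (hsup ▸ hPV.trans le_sup_right))

theorem subset_of_card_eq_one (hN : InGeneralPosition N) (hι : 3 ≤ Fintype.card ι) {P S : Finset ι}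
    (hP : P.card = 2) {V : Submodule K (ι → K)} (hPV : vanishOn N P ≤ V)
    (hV : Module.finrank K V = 2) (hS : S.card = 1) (hSV : vanishOn N S ≤ V) : S ⊆ P := by
  by_contra hSP
  have hthree := hN.three_le_finrank_sup hι hP hS.le hSP hPV
  rw [sup_eq_right.2 hSV] at hthree
  omega

theorem eq_or_eq_of_disjoint (hN : InGeneralPosition N) (hι : 3 ≤ Fintype.card ι)
    {P Q R : Finset ι} (hP : P.card = 2) (hQ : Q.card = 2) (hR : R.card = 2) (hPQ : Disjoint P Q)
    {V : Submodule K (ι → K)} (hPV : vanishOn N P ≤ V) (hQV : vanishOn N Q ≤ V)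
    (hRV : vanishOn N R ≤ V) (hV : Module.finrank K V ≤ 2) : R = P ∨ R = Q := by
  by_contra! hne
  have hPR : Disjoint P R := Finset.disjoint_left.2 fun i hiP hiR =>
    Finset.disjoint_left.1 hPQ hiP
      (hN.mem_of_mem_of_mem hι hP hR hQ hne.1.symm hPV hRV hQV hV hiP hiR)
  have hQR : Disjoint Q R := Finset.disjoint_left.2 fun i hiQ hiR =>
    Finset.disjoint_right.1 hPQ hiQ
      (hN.mem_of_mem_of_mem hι hQ hR hP hne.2.symm hQV hRV hPV hV hiQ hiR)
  have hrank := Submodule.finrank_mono ((hN.sup_eq P Q R hP hQ hR hPQ hPR hQR).trans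
    (sup_le (sup_le hPV hQV) hRV))
  rw [hN.finrank_eq] at hrank
  omega

end InGeneralPosition

end Vanishing

section Relations

variable {K : Type*} [Field K] {m n a b : ℕ}

/-- The rows in which `Y` has no element in the column `j`. -/
def missingRows (Y : Finset (Fin m × Fin n)) (j : Fin n) : Finset (Fin m) :=
  (columnRows Y j)ᶜ

theorem card_columnRows_add_card_missingRows (Y : Finset (Fin m × Fin n)) (j : Fin n) :
    (columnRows Y j).card + (missingRows Y j).card = m := by
  rw [missingRows, Finset.card_add_card_compl, Fintype.card_fin]

theorem mem_columnRelations_iff_vanishOn {x : Fin m → Fin a → K} {y : Fin n → Fin b → K}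
    {Y : Finset (Fin m × Fin n)} {g : Fin n → Fin m → K} :
    g ∈ columnRelations x y Y ↔
      (∀ j, g j ∈ vanishOn (LinearMap.ker (Fintype.linearCombination K x)) (missingRows Y j)) ∧
        ∀ l, ∑ j, y j l • g j = 0 := by
  simp only [mem_columnRelations, mem_vanishOn, LinearMap.mem_ker, funext_iff, Finset.sum_apply,
    Fintype.linearCombination_apply, missingRows, Finset.mem_compl, mem_columnRows, Pi.smul_apply,
    smul_eq_mul, Pi.zero_apply, mul_comm, forall_and]
  rw [forall_comm (α := Fin m) (β := Fin b)]
  tauto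

/- The relation with the number `l` says that the `l`-th of the `b` columns that do not represent a
class is equal to the representative of its class. -/
theorem exists_forall_eq_elim_of_sum_smul_eq_zero (K : Type*) {V : Type*} [Field K]
    [AddCommGroup V] [Module K V] {e : ℕ} (he : e + b = n) {τ : Fin n → Option (Fin e)}
    {r : Fin e → Fin n} (hr : ∀ t, τ (r t) = some t) :
    ∃ y : Fin n → Fin b → K, ∀ g : Fin n → V, (∀ l, ∑ j, y j l • g j = 0) →
      ∀ j, g j = (τ j).elim 0 (g ∘ r) := by
  have hinj : Function.Injective r := fun s t h => by
    simpa [hr] using congrArg τ h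
  have hcard : ((Finset.univ.image r)ᶜ).card = b := by
    rw [Finset.card_compl, Finset.card_image_of_injective _ hinj, Finset.card_univ,
      Fintype.card_fin, Fintype.card_fin]
    omega
  let ν := ((Finset.univ.image r)ᶜ).equivFinOfCardEq hcard
  refine ⟨fun j l => (if j = ν.symm l then 1 else 0) -
    (τ (ν.symm l)).elim 0 fun t => if j = r t then 1 else 0, fun g hg j => ?_⟩
  have hg' (l : Fin b) : g (ν.symm l) = (τ (ν.symm l)).elim 0 (g ∘ r) := by
    have h := hg l
    simp only [sub_smul, Finset.sum_sub_distrib, ite_smul, one_smul, zero_smul, Finset.sum_ite_eq',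
      Finset.mem_univ, if_true, sub_eq_zero] at h
    rw [h]
    cases τ (ν.symm l) <;> simp
  by_cases hj : j ∈ Finset.univ.image r
  · obtain ⟨t, -, rfl⟩ := Finset.mem_image.1 hj
    simp [hr]
  · simpa using hg' (ν ⟨j, Finset.mem_compl.2 hj⟩)

theorem exists_finrank_columnRelations_le (x : Fin m → Fin a → K) (Y : Finset (Fin m × Fin n))
    {e : ℕ} (he : e + b = n) {τ : Fin n → Option (Fin e)} (hτ : ∀ t, ∃ j, τ j = some t) :
    ∃ y : Fin n → Fin b → K, Module.finrank K (columnRelations x y Y) ≤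
      ∑ t, Module.finrank K (vanishOn (LinearMap.ker (Fintype.linearCombination K x))
        ((assigned τ t).biUnion (missingRows Y))) := by
  choose r hr using hτ
  obtain ⟨y, hy⟩ := exists_forall_eq_elim_of_sum_smul_eq_zero K (V := Fin m → K) he hr
  refine ⟨y, ?_⟩
  have hg (g : columnRelations x y Y) (j : Fin n) : g.1 j = (τ j).elim 0 (g.1 ∘ r) :=
    hy g.1 (mem_columnRelations_iff_vanishOn.1 g.2).2 j
  have hmem (g : columnRelations x y Y) (j : Fin n) :=
    mem_vanishOn.1 ((mem_columnRelations_iff_vanishOn.1 g.2).1 j)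
  have hmem' (g : columnRelations x y Y) (t : Fin e) :
      g.1 (r t) ∈ vanishOn (LinearMap.ker (Fintype.linearCombination K x))
        ((assigned τ t).biUnion (missingRows Y)) := by
    refine mem_vanishOn.2 ⟨(hmem g _).1, fun i hi => ?_⟩
    obtain ⟨j, hj, hi⟩ := Finset.mem_biUnion.1 hi
    rw [← (hmem g j).2 i hi, hg g j, mem_assigned.1 hj]
    rfl
  let L : columnRelations x y Y →ₗ[K]
      ∀ t, vanishOn (LinearMap.ker (Fintype.linearCombination K x))
        ((assigned τ t).biUnion (missingRows Y)) :=
    LinearMap.pi fun t => LinearMap.codRestrict _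
      ((LinearMap.proj (r t)).comp (columnRelations x y Y).subtype) fun g => hmem' g t
  have hL : Function.Injective L := fun g h hgh => by
    refine Subtype.ext (funext fun j => ?_)
    rw [hg g, hg h]
    rcases τ j with _ | t
    · rfl
    · exact congrArg Subtype.val (congrFun hgh t)
  rw [← Module.finrank_pi_fintype]
  exact LinearMap.finrank_le_finrank_of_injective hL

theorem finrank_ker_add_sum_finrank_iSup_assigned {α β V : Type*} [Fintype α] [Fintype β]
    [DecidableEq β] [AddCommGroup V] [Module K V] [FiniteDimensional K V] (Z : α → Submodule K V)
    (τ : α → Option β) :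
    Module.finrank K (LinearMap.ker (LinearMap.pi fun t => ∑ j ∈ assigned τ t,
        (Z j).subtype.comp (LinearMap.proj j) : (∀ j, Z j) →ₗ[K] β → V)) +
      ∑ t, Module.finrank K (⨆ j ∈ assigned τ t, Z j : Submodule K V) =
      ∑ j, Module.finrank K (Z j) := by
  let P (t : β) : Submodule K V := ⨆ j ∈ assigned τ t, Z j
  let φ (t : β) : (∀ j, Z j) →ₗ[K] V :=
    ∑ j ∈ assigned τ t, (Z j).subtype.comp (LinearMap.proj j)
  have hφ (z : ∀ j, Z j) (t : β) : φ t z = ∑ j ∈ assigned τ t, (z j : V) := by simp [φ]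
  let Φ : (∀ j, Z j) →ₗ[K] ∀ t, P t :=
    LinearMap.pi fun t => (φ t).codRestrict (P t) fun z => by
      rw [hφ]
      exact sum_mem fun j hj => le_biSup Z hj (z j).2
  have hker : LinearMap.ker Φ = LinearMap.ker (LinearMap.pi φ) := by
    ext z
    simp [Φ, funext_iff, Subtype.ext_iff]
  have hsurj : Function.Surjective Φ := by
    intro p
    choose μ hμ using fun t => (Submodule.mem_iSup_finset_iff_exists_sum Z (p t).1).1 (p t).2
    refine ⟨fun j => (τ j).elim 0 fun t => μ t j, funext fun t => Subtype.ext ?_⟩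
    rw [← hμ t]
    refine (hφ _ t).trans (Finset.sum_congr rfl fun j hj => ?_)
    rw [mem_assigned.1 hj]
    rfl
  rw [← hker, ← Module.finrank_pi_fintype, ← Module.finrank_pi_fintype,
    ← Φ.finrank_range_add_finrank_ker, LinearMap.range_eq_top.2 hsurj, finrank_top, add_comm]

theorem exists_finrank_columnRelations_add_le (x : Fin m → Fin a → K)
    (Y : Finset (Fin m × Fin n)) (τ : Fin n → Option (Fin b)) :
    ∃ y : Fin n → Fin b → K, Module.finrank K (columnRelations x y Y) +
      ∑ t, Module.finrank K (⨆ j ∈ assigned τ t,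
        vanishOn (LinearMap.ker (Fintype.linearCombination K x)) (missingRows Y j) :
          Submodule K (Fin m → K)) ≤
      ∑ j, Module.finrank K
        (vanishOn (LinearMap.ker (Fintype.linearCombination K x)) (missingRows Y j)) := by
  let Z (j : Fin n) := vanishOn (LinearMap.ker (Fintype.linearCombination K x)) (missingRows Y j)
  refine ⟨fun j l => if τ j = some l then 1 else 0, ?_⟩
  rw [← finrank_ker_add_sum_finrank_iSup_assigned Z τ]
  refine Nat.add_le_add_right ?_ _
  refine le_trans (Submodule.finrank_mono fun g hg => ?_) (Submodule.finrank_map_le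
    (LinearMap.pi fun j => (Z j).subtype.comp (LinearMap.proj j)) _)
  rw [mem_columnRelations_iff_vanishOn] at hg
  refine ⟨fun j => ⟨g j, hg.1 j⟩, funext fun l => ?_, rfl⟩
  have h := hg.2 l
  simp only [ite_smul, one_smul, zero_smul, ← Finset.sum_filter] at h
  simpa [assigned] using h

end Relations

section Bounds

variable {n a b : ℕ}

theorem exists_lt_eq_pair_of_card_eq_two {α : Type*} [LinearOrder α] {s : Finset α}
    (hs : s.card = 2) : ∃ i i', i' < i ∧ s = {i, i'} := by
  obtain ⟨i, i', hne, rfl⟩ := Finset.card_eq_two.1 hs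
  rcases lt_or_gt_of_ne hne with h | h
  exacts [⟨i', i, h, Finset.pair_comm i i'⟩, ⟨i, i', h, rfl⟩]

theorem exists_rankBound_sdiff_mem (Y : Finset (Fin (a + 3) × Fin n)) (I : Finset (Fin (a + 3)))
    {q : ℕ} (hq : 1 ≤ q) (hI : q + I.card = 3) :
    ∃ c : ℕ → ℕ, (∀ j : Fin n, c j = (I \ missingRows Y j).card) ∧
      rankBound a b Y q c ∈ rankBounds Y a b := by
  simp only [missingRows, sdiff_compl, Finset.inf_eq_inter]
  simp only [rankBounds, Set.mem_union, Set.mem_singleton_iff, Set.mem_iUnion, exists_prop]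
  obtain h | h | h : I.card = 0 ∨ I.card = 1 ∨ I.card = 2 := by omega
  · obtain rfl : q = 3 := by omega
    obtain rfl := Finset.card_eq_zero.1 h
    exact ⟨fun _ => 0, by simp, Or.inr (Or.inl rfl)⟩
  · obtain rfl : q = 2 := by omega
    obtain ⟨i, rfl⟩ := Finset.card_eq_one.1 h
    exact ⟨fun j => entryBit Y i j, fun j => entryBit_eq_card_inter Y i j,
      Or.inr (Or.inr ⟨i, i.2, Or.inl rfl⟩)⟩
  · obtain rfl : q = 1 := by omega
    obtain ⟨i, i', hlt, rfl⟩ := exists_lt_eq_pair_of_card_eq_two h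
    exact ⟨fun j => entryBit Y i j + entryBit Y i' j,
      fun j => entryBit_add_entryBit_eq_card_inter Y hlt.ne' j,
      Or.inr (Or.inr ⟨i, i.2, Or.inr ⟨i', hlt, Or.inl rfl⟩⟩)⟩

theorem exists_rankBound_cross_mem (Y : Finset (Fin (a + 3) × Fin n)) {P Q : Finset (Fin (a + 3))}
    (hP : P.card = 2) (hQ : Q.card = 2) :
    ∃ c : ℕ → ℕ, (∀ j : Fin n, c j ≤ 1 ∧
      (P ⊆ missingRows Y j ∨ Q ⊆ missingRows Y j → c j = 0)) ∧
      rankBound a b Y 2 c ∈ rankBounds Y a b := by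
  obtain ⟨i, i', hi, rfl⟩ := exists_lt_eq_pair_of_card_eq_two hP
  obtain ⟨k, k', hk, rfl⟩ := exists_lt_eq_pair_of_card_eq_two hQ
  refine ⟨crossBit Y i i' k k', fun j => ⟨crossBit_le _ _ _ _ _ _, ?_⟩, ?_⟩
  · simp only [missingRows, Finset.insert_subset_iff, Finset.singleton_subset_iff,
      Finset.mem_compl]
    rintro (⟨h, h'⟩ | ⟨h, h'⟩) <;> simp [crossBit, entryBit_eq_ite, h, h']
  · simp only [rankBounds, Set.mem_union, Set.mem_singleton_iff, Set.mem_iUnion, exists_prop]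
    exact Or.inr (Or.inr ⟨i, i.2, Or.inr ⟨i', hi, Or.inr ⟨k, k.2, k', hk, rfl⟩⟩⟩)

end Bounds

section FewLargeColumns

variable {K : Type*} [Field K] {n a b : ℕ}

theorem exists_rankBound_min_card_union_le (Y : Finset (Fin (a + 3) × Fin n))
    (U : Finset (Fin (a + 3))) :
    ∃ (q : ℕ) (c : ℕ → ℕ), rankBound a b Y q c ∈ rankBounds Y a b ∧ q + min 3 U.card = 3 ∧
      ∀ j, 3 + min (columnRows Y j).card (a + c j) ≤
        (columnRows Y j).card + min 3 (missingRows Y j ∪ U).card := by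
  rcases lt_or_ge U.card 3 with hU | hU
  · obtain ⟨c, hc, hmem⟩ := exists_rankBound_sdiff_mem (b := b) Y U (q := 3 - U.card) (by omega)
      (by omega)
    refine ⟨_, c, hmem, by omega, fun j => ?_⟩
    have hcol := card_columnRows_add_card_missingRows Y j
    have hunion := Finset.card_sdiff_add_card U (missingRows Y j)
    rw [← hc, Finset.union_comm] at hunion
    omega
  · refine ⟨0, _, Or.inl rfl, by omega, fun j => ?_⟩
    have hunion := Finset.card_le_card (Finset.subset_union_right : U ⊆ missingRows Y j ∪ U)
    omega

theorem exists_rankBound_le_of_card_large_le (x : Fin (a + 3) → Fin a → K)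
    (hN : InGeneralPosition (LinearMap.ker (Fintype.linearCombination K x)))
    (Y : Finset (Fin (a + 3) × Fin n)) {e : ℕ} (he : e + b = n)
    (hcard : (Finset.univ.filter fun j => 2 ≤ (missingRows Y j).card).card ≤ e) :
    ∃ y : Fin n → Fin b → K, ∃ r ∈ rankBounds Y a b, r ≤ columnRank x y Y := by
  let F (A : Finset (Fin n)) := min 3 (A.biUnion (missingRows Y)).card
  have hF : MonotoneSubmodular F := (MonotoneSubmodular.card_biUnion (missingRows Y)).min_left 3
  obtain ⟨τ, A, -, hτ⟩ := exists_sum_insert_add_le_sum_assigned (β := Fin e) hF (by simpa [F])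
  obtain ⟨σ, hσ, hτσ⟩ := exists_surjective_assigned_le hF (by simp [F])
    (by simpa using Nat.le.intro he) τ
  obtain ⟨y, hy⟩ := exists_finrank_columnRelations_le x Y he hσ
  obtain ⟨q, c, hmem, hq, hc⟩ :=
    exists_rankBound_min_card_union_le (b := b) Y (A.biUnion (missingRows Y))
  refine ⟨y, _, hmem, ?_⟩
  have hnull : Module.finrank K (columnRelations x y Y) + ∑ t, F (assigned σ t) ≤ e * 3 := by
    refine (Nat.add_le_add_right hy _).trans ?_
    rw [← Finset.sum_add_distrib]
    refine (Finset.sum_le_card_nsmul _ _ 3 fun t _ => ?_).trans (by simp)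
    rw [hN.finrank_vanishOn (by simp)]
    dsimp only [F]
    omega
  have hrank := columnRank_add_finrank_columnRelations x y Y
  rw [← sum_card_columnRows] at hrank
  have hpoint (j : Fin n) : 3 + min (columnRows Y j).card (a + c j) ≤
      (columnRows Y j).card + F (insert j A) := by
    simpa only [F, Finset.biUnion_insert] using hc j
  have hsum := Finset.sum_le_sum fun j (_ : j ∈ Finset.univ) => hpoint j
  simp only [Finset.sum_add_distrib, Finset.sum_const, Finset.card_univ,
    Fintype.card_fin, smul_eq_mul] at hsum hτ
  rw [rankBound_eq_sum_card_columnRows]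
  have hq' (k : ℕ) : k * q + k * F A = k * 3 := by rw [← mul_add, hq]
  have hn : n * q = q * b + e * q := by rw [← he]; ring
  have := hq' e
  have := hq' n
  omega

end FewLargeColumns

section FewSmallColumns

variable {K : Type*} [Field K] {n a b : ℕ}

/-- One of the bounds `rankBounds` for `Y` has multiplicity `q = dim V` and capacities `c j` for
which `min (3 - |missingRows Y j|) (c j)` is at most the increase of the dimension when `V` is
joined with the elements of `N` that vanish on `missingRows Y j`. -/
def HasFittingRankBound (b : ℕ) (N V : Submodule K (Fin (a + 3) → K))
    (Y : Finset (Fin (a + 3) × Fin n)) : Prop :=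
  ∃ c : ℕ → ℕ, rankBound a b Y (Module.finrank K V) c ∈ rankBounds Y a b ∧ ∀ j : Fin n,
    Module.finrank K V + min (3 - (missingRows Y j).card) (c j) ≤
      Module.finrank K (vanishOn N (missingRows Y j) ⊔ V : Submodule K (Fin (a + 3) → K))

variable {N V : Submodule K (Fin (a + 3) → K)} (hN : InGeneralPosition N)
  (Y : Finset (Fin (a + 3) × Fin n)) {P Q : Finset (Fin (a + 3))}

include hN

theorem hasFittingRankBound_of_finrank_eq_one (hP : P.card = 2) (hPV : vanishOn N P ≤ V)
    (hV : Module.finrank K V = 1) : HasFittingRankBound b N V Y := by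
  have hι : 3 ≤ Fintype.card (Fin (a + 3)) := by simp
  obtain ⟨c, hc, hmem⟩ := exists_rankBound_sdiff_mem (b := b) Y P (q := 1) le_rfl (by omega)
  refine ⟨c, hV ▸ hmem, fun j => ?_⟩
  rw [hV, hc]
  set S := missingRows Y j
  have hS := hN.three_sub_card_le_finrank_sup hι S V
  have hle := Submodule.finrank_mono (le_sup_right : V ≤ vanishOn N S ⊔ V)
  have hsdiff := Finset.card_le_card (Finset.sdiff_subset : P \ S ⊆ P)
  by_cases hSP : S ⊆ P
  · have hcard := Finset.card_sdiff_of_subset hSP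
    omega
  · by_cases hS₁ : S.card ≤ 1
    · have := hN.three_le_finrank_sup hι hP hS₁ hSP hPV
      omega
    by_cases hS₂ : S.card = 2
    · have := hN.two_le_finrank hι hS₂ hP (fun h => hSP h.le)
        (le_sup_left : _ ≤ vanishOn N S ⊔ V) (hPV.trans le_sup_right)
      omega
    · omega

theorem hasFittingRankBound_of_finrank_eq_two (hV : Module.finrank K V = 2) {c : ℕ → ℕ}
    (hmem : rankBound a b Y 2 c ∈ rankBounds Y a b) (hc : ∀ j : Fin n, c j ≤ 1)
    (hzero : ∀ j : Fin n, vanishOn N (missingRows Y j) ≤ V → 1 ≤ (missingRows Y j).card →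
      (missingRows Y j).card ≤ 2 → c j = 0) : HasFittingRankBound b N V Y := by
  refine ⟨c, hV ▸ hmem, fun j => ?_⟩
  have hcj := hc j
  have hS := hN.three_sub_card_le_finrank_sup (by simp) (missingRows Y j) V
  by_cases hjV : vanishOn N (missingRows Y j) ≤ V
  · have hcj₀ := hzero j hjV
    rw [sup_eq_right.2 hjV] at hS ⊢
    omega
  · have hlt := Submodule.finrank_lt_finrank_of_lt
      (right_lt_sup.2 hjV : V < vanishOn N (missingRows Y j) ⊔ V)
    omega

theorem hasFittingRankBound_of_disjoint (hP : P.card = 2) (hQ : Q.card = 2) (hPQ : Disjoint P Q)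
    (hPV : vanishOn N P ≤ V) (hQV : vanishOn N Q ≤ V) (hV : Module.finrank K V = 2) :
    HasFittingRankBound b N V Y := by
  have hι : 3 ≤ Fintype.card (Fin (a + 3)) := by simp
  obtain ⟨c, hc, hmem⟩ := exists_rankBound_cross_mem (b := b) Y hP hQ
  refine hasFittingRankBound_of_finrank_eq_two hN Y hV hmem (fun j => (hc j).1)
    fun j hjV h₁ h₂ => (hc j).2 ?_
  obtain h | h : (missingRows Y j).card = 1 ∨ (missingRows Y j).card = 2 := by omega
  · have hempty := hPQ (hN.subset_of_card_eq_one hι hP hPV hV h hjV)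
      (hN.subset_of_card_eq_one hι hQ hQV hV h hjV)
    simp [Finset.subset_empty.1 hempty] at h
  · exact (hN.eq_or_eq_of_disjoint hι hP hQ h hPQ hPV hQV hjV hV.le).imp (·.ge) (·.ge)

theorem hasFittingRankBound_of_mem_of_mem (hP : P.card = 2) (hQ : Q.card = 2) (hPQ : P ≠ Q)
    (hPV : vanishOn N P ≤ V) (hQV : vanishOn N Q ≤ V) (hV : Module.finrank K V = 2)
    {i : Fin (a + 3)} (hiP : i ∈ P) (hiQ : i ∈ Q) : HasFittingRankBound b N V Y := by
  have hι : 3 ≤ Fintype.card (Fin (a + 3)) := by simp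
  obtain ⟨c, hc, hmem⟩ := exists_rankBound_sdiff_mem (b := b) Y {i} (q := 2) (by omega) (by simp)
  refine hasFittingRankBound_of_finrank_eq_two hN Y hV hmem
    (fun j => hc j ▸ Finset.card_le_card Finset.sdiff_subset) fun j hjV h₁ h₂ => ?_
  suffices hi : i ∈ missingRows Y j by simp [hc, hi]
  obtain h | h : (missingRows Y j).card = 1 ∨ (missingRows Y j).card = 2 := by omega
  · have hsub := Finset.subset_inter (hN.subset_of_card_eq_one hι hP hPV hV h hjV)
      (hN.subset_of_card_eq_one hι hQ hQV hV h hjV)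
    have hinter : (P ∩ Q).card ≤ 1 := by
      by_contra! hlt
      have hP' := Finset.eq_of_subset_of_card_le (Finset.inter_subset_left : P ∩ Q ⊆ P) (by omega)
      have hQ' := Finset.eq_of_subset_of_card_le (Finset.inter_subset_right : P ∩ Q ⊆ Q) (by omega)
      exact hPQ (hP'.symm.trans hQ')
    rw [Finset.eq_of_subset_of_card_le hsub (hinter.trans h.ge)]
    exact Finset.mem_inter.2 ⟨hiP, hiQ⟩
  · exact hN.mem_of_mem_of_mem hι hP hQ h hPQ hPV hQV hjV hV.le hiP hiQ

theorem hasFittingRankBound_biSup {A : Finset (Fin n)}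
    (hA : ∀ j ∈ A, (missingRows Y j).card = 2) :
    HasFittingRankBound b N (⨆ k ∈ A, vanishOn N (missingRows Y k)) Y := by
  have hι : 3 ≤ Fintype.card (Fin (a + 3)) := by simp
  set V := ⨆ k ∈ A, vanishOn N (missingRows Y k)
  have hAV (k : Fin n) (hk : k ∈ A) : vanishOn N (missingRows Y k) ≤ V :=
    le_biSup (fun k => vanishOn N (missingRows Y k)) hk
  have hle : Module.finrank K V ≤ 3 :=
    (Submodule.finrank_mono (iSup₂_le fun k _ => vanishOn_le N _)).trans hN.finrank_eq.le
  have hne (h : Module.finrank K V ≠ 0) : A.Nonempty :=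
    A.eq_empty_or_nonempty.resolve_left fun hA₀ => h (by simp [V, hA₀])
  obtain h | h | h | h : Module.finrank K V = 0 ∨ Module.finrank K V = 1 ∨
      Module.finrank K V = 2 ∨ Module.finrank K V = 3 := by omega
  · refine ⟨fun _ => 3, by rw [h]; exact Or.inl rfl, fun j => ?_⟩
    have := hN.three_sub_card_le_finrank_sup hι (missingRows Y j) V
    omega
  · obtain ⟨k, hk⟩ := hne (by omega)
    exact hasFittingRankBound_of_finrank_eq_one hN Y (hA k hk) (hAV k hk) h
  · obtain ⟨k, hk, l, hl, hkl⟩ : ∃ k ∈ A, ∃ l ∈ A, missingRows Y k ≠ missingRows Y l := by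
      by_contra! hsame
      obtain ⟨k, hk⟩ := hne (by omega)
      have hVk : V ≤ vanishOn N (missingRows Y k) :=
        iSup₂_le fun l hl => (congrArg (vanishOn N) (hsame l hl k hk)).le
      have := Submodule.finrank_mono hVk
      rw [hN.finrank_vanishOn hι, hA k hk] at this
      omega
    by_cases hdisj : Disjoint (missingRows Y k) (missingRows Y l)
    · exact hasFittingRankBound_of_disjoint hN Y (hA k hk) (hA l hl) hdisj (hAV k hk) (hAV l hl) h
    · obtain ⟨i, hik, hil⟩ := Finset.not_disjoint_iff.1 hdisj
      exact hasFittingRankBound_of_mem_of_mem hN Y (hA k hk) (hA l hl) hkl (hAV k hk) (hAV l hl) h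
        hik hil
  · obtain ⟨c, hc, hmem⟩ := exists_rankBound_sdiff_mem (b := b) Y ∅ (q := 3) (by omega) (by simp)
    refine ⟨c, by rwa [h], fun j => ?_⟩
    rw [hc, Finset.empty_sdiff, Finset.card_empty, Nat.min_zero]
    exact Submodule.finrank_mono le_sup_right

omit hN

theorem exists_rankBound_le_of_card_small_le (x : Fin (a + 3) → Fin a → K)
    (hN : InGeneralPosition (LinearMap.ker (Fintype.linearCombination K x)))
    (hcard : (Finset.univ.filter fun j => (missingRows Y j).card ≤ 1).card ≤ b) :
    ∃ y : Fin n → Fin b → K, ∃ r ∈ rankBounds Y a b, r ≤ columnRank x y Y := by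
  have hι : 3 ≤ Fintype.card (Fin (a + 3)) := by simp
  let Z (j : Fin n) := vanishOn (LinearMap.ker (Fintype.linearCombination K x)) (missingRows Y j)
  let F (A : Finset (Fin n)) := Module.finrank K (⨆ k ∈ A, Z k : Submodule K (Fin (a + 3) → K))
  have hF : MonotoneSubmodular F := MonotoneSubmodular.finrank_iSup Z
  have hsingleton (j : Fin n) : F {j} = Module.finrank K (Z j) := by
    dsimp only [F]
    rw [Finset.iSup_singleton]
  have hF₁ (j : Fin n) : F {j} = 3 - (missingRows Y j).card :=
    (hsingleton j).trans (hN.finrank_vanishOn hι _)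
  obtain ⟨τ, A, hA, hτ⟩ := exists_sum_insert_add_le_sum_assigned (β := Fin b) hF (by
    rw [Fintype.card_fin]
    refine (Finset.card_le_card fun j => ?_).trans hcard
    simp only [hF₁, Finset.mem_filter, Finset.mem_univ, true_and]
    omega)
  have hA₂ (j : Fin n) (hj : j ∈ A) : (missingRows Y j).card = 2 := by
    have := hA j hj
    rw [hF₁] at this
    omega
  obtain ⟨c, hmem, hc⟩ := hasFittingRankBound_biSup (b := b) hN Y hA₂
  obtain ⟨y, hy⟩ := exists_finrank_columnRelations_add_le x Y τ
  refine ⟨y, _, hmem, ?_⟩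
  have hpoint (j : Fin n) : F {j} + min (columnRows Y j).card (a + c j) + F A ≤
      (columnRows Y j).card + F (insert j A) := by
    have hcol := card_columnRows_add_card_missingRows Y j
    have hcj : F A + min (3 - (missingRows Y j).card) (c j) ≤ F (insert j A) := by
      dsimp only [F]
      rw [Finset.iSup_insert]
      exact hc j
    rw [hF₁]
    omega
  have hsum := Finset.sum_le_sum fun j (_ : j ∈ Finset.univ) => hpoint j
  have hnull : Module.finrank K (columnRelations x y Y) + ∑ t, F (assigned τ t) ≤ ∑ j, F {j} := by
    simpa only [hsingleton] using hy
  have hrank := columnRank_add_finrank_columnRelations x y Y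
  rw [← sum_card_columnRows] at hrank
  simp only [Finset.sum_add_distrib, Finset.sum_const, Finset.card_univ,
    Fintype.card_fin, smul_eq_mul] at hsum hτ
  rw [rankBound_eq_sum_card_columnRows, mul_comm]
  change b * F A + _ ≤ _
  omega

theorem exists_rankBound_le_columnRank (x : Fin (a + 3) → Fin a → K)
    (hN : InGeneralPosition (LinearMap.ker (Fintype.linearCombination K x))) (hb : b ≤ n) :
    ∃ y : Fin n → Fin b → K, ∃ r ∈ rankBounds Y a b, r ≤ columnRank x y Y := by
  by_cases h : (Finset.univ.filter fun j => (missingRows Y j).card ≤ 1).card ≤ b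
  · exact exists_rankBound_le_of_card_small_le Y x hN h
  · refine exists_rankBound_le_of_card_large_le x hN Y (e := n - b) (by omega) ?_
    have := Finset.card_filter_add_card_filter_not (s := Finset.univ)
      fun j : Fin n => (missingRows Y j).card ≤ 1
    simp only [not_le, Finset.card_univ, Fintype.card_fin] at this
    change (Finset.univ.filter fun j => 1 < (missingRows Y j).card).card ≤ n - b
    omega

end FewSmallColumns

section Parabola

variable {K : Type*} [Field K]

theorem exists_linearCombination_ker_eq {a d : ℕ} (N : Submodule K (Fin (a + d) → K))
    (hN : Module.finrank K N = d) :
    ∃ x : Fin (a + d) → Fin a → K, LinearMap.ker (Fintype.linearCombination K x) = N := by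
  have h : Module.finrank K ((Fin (a + d) → K) ⧸ N) = Module.finrank K (Fin a → K) := by
    have := N.finrank_quotient_add_finrank
    rw [hN, Module.finrank_fintype_fun_eq_card, Fintype.card_fin] at this
    rw [Module.finrank_fintype_fun_eq_card, Fintype.card_fin]
    omega
  let φ := LinearEquiv.ofFinrankEq _ _ h
  let Φ := φ.toLinearMap.comp N.mkQ
  refine ⟨fun i => Φ (Pi.single i 1), ?_⟩
  have : Fintype.linearCombination K (fun i => Φ (Pi.single i 1)) = Φ := by
    refine LinearMap.pi_ext' fun i => LinearMap.ext_ring ?_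
    simp [Fintype.linearCombination_apply_single]
  rw [this, LinearMap.ker_comp, LinearEquiv.ker, Submodule.comap_bot, Submodule.ker_mkQ]

/-- The map that sends the coefficients of a quadratic polynomial to its values at the points
`t i`. -/
def quadraticValues {ι : Type*} (t : ι → K) : (Fin 3 → K) →ₗ[K] (ι → K) :=
  LinearMap.pi fun i => LinearMap.proj 0 + t i • LinearMap.proj 1 + (t i) ^ 2 • LinearMap.proj 2

theorem quadraticValues_apply {ι : Type*} (t : ι → K) (f : Fin 3 → K) (i : ι) :
    quadraticValues t f i = f 0 + t i * f 1 + t i ^ 2 * f 2 := by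
  simp [quadraticValues]

theorem eq_zero_of_quadraticValues_eq_zero {ι : Type*} {t : ι → K} (ht : Function.Injective t)
    {f : Fin 3 → K} {i j k : ι} (hij : i ≠ j) (hik : i ≠ k) (hjk : j ≠ k)
    (hi : quadraticValues t f i = 0) (hj : quadraticValues t f j = 0)
    (hk : quadraticValues t f k = 0) : f = 0 := by
  refine Matrix.eq_zero_of_mulVec_eq_zero (M := Matrix.vandermonde (t ∘ ![i, j, k])) ?_ ?_
  · refine Matrix.det_vandermonde_ne_zero_iff.2 (ht.comp (List.nodup_ofFn.1 ?_))
    simp [hij, hik, hjk]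
  · rw [quadraticValues_apply] at hi hj hk
    ext l
    fin_cases l <;> simp [Matrix.mulVec, dotProduct, Fin.sum_univ_three, Matrix.vandermonde_apply,
      hi, hj, hk]

/-- The coefficients of the monic quadratic polynomial with roots `u` and `v`. -/
def rootPair {R : Type*} [CommRing R] (u v : R) : Fin 3 → R :=
  ![u * v, -(u + v), 1]

/-- The matrix whose rows are the coefficients of the quadratic polynomials with roots `w 0, w 1`,
with roots `w 2, w 3` and with roots `w 4, w 5`. -/
def rootPairs {R : Type*} [CommRing R] (w : Fin 6 → R) : Matrix (Fin 3) (Fin 3) R :=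
  Matrix.of ![rootPair (w 0) (w 1), rootPair (w 2) (w 3), rootPair (w 4) (w 5)]

theorem map_rootPairs {R R' : Type*} [CommRing R] [CommRing R'] (φ : R →+* R') (w : Fin 6 → R) :
    (rootPairs w).map φ = rootPairs (φ ∘ w) := by
  ext i j
  fin_cases i <;> fin_cases j <;> simp [rootPairs, rootPair]

theorem quadraticValues_rootPair_mem {ι : Type*} [DecidableEq ι] (t : ι → K) (i j : ι) :
    quadraticValues t (rootPair (t i) (t j)) ∈
      vanishOn (LinearMap.range (quadraticValues t)) {i, j} := by
  refine mem_vanishOn.2 ⟨⟨_, rfl⟩, fun k hk => ?_⟩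
  have hvalue : quadraticValues t (rootPair (t i) (t j)) k = (t k - t i) * (t k - t j) := by
    rw [quadraticValues_apply]
    simp only [rootPair, Matrix.cons_val]
    ring
  rw [hvalue]
  rcases Finset.mem_insert.1 hk with rfl | hk
  · simp
  · simp [Finset.mem_singleton.1 hk]

theorem range_quadraticValues_le_sup {ι : Type*} [DecidableEq ι] {t : ι → K}
    {p p' q q' r r' : ι} (hdet : (rootPairs (t ∘ ![p, p', q, q', r, r'])).det ≠ 0) :
    LinearMap.range (quadraticValues t) ≤
      vanishOn (LinearMap.range (quadraticValues t)) {p, p'} ⊔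
      vanishOn (LinearMap.range (quadraticValues t)) {q, q'} ⊔
      vanishOn (LinearMap.range (quadraticValues t)) {r, r'} := by
  rintro _ ⟨f, rfl⟩
  set M := rootPairs (t ∘ ![p, p', q, q', r, r'])
  have hunit := (Matrix.isUnit_iff_isUnit_det M).2 (isUnit_iff_ne_zero.2 hdet)
  obtain ⟨c, hc⟩ : ∃ c, Matrix.vecMul c M = f := Matrix.vecMul_surjective_iff_isUnit.2 hunit f
  rw [← hc, Matrix.vecMul_eq_sum, Fin.sum_univ_three, map_add, map_add, map_smul, map_smul,
    map_smul]
  have hmem (k : Fin 3) {i j : ι} (h : M k = rootPair (t i) (t j)) :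
      c k • quadraticValues t (M k) ∈ vanishOn (LinearMap.range (quadraticValues t)) {i, j} :=
    Submodule.smul_mem _ _ (h ▸ quadraticValues_rootPair_mem t i j)
  exact Submodule.add_mem_sup (Submodule.add_mem_sup (hmem 0 rfl) (hmem 1 rfl)) (hmem 2 rfl)

theorem inGeneralPosition_range_quadraticValues {ι : Type*} [Fintype ι]
    (hι : 3 ≤ Fintype.card ι) {t : ι → K} (ht : Function.Injective t)
    (hdet : ∀ w : Fin 6 → ι, Function.Injective w → (rootPairs (t ∘ w)).det ≠ 0) :
    InGeneralPosition (LinearMap.range (quadraticValues t)) where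
  finrank_eq := by
    classical
    obtain ⟨S, -, hS⟩ := Finset.exists_subset_card_eq (s := (Finset.univ : Finset ι)) hι
    obtain ⟨i, j, k, hij, hik, hjk, -⟩ := Finset.card_eq_three.1 hS
    have hinj : Function.Injective (quadraticValues t) :=
      LinearMap.ker_eq_bot.1 <| LinearMap.ker_eq_bot'.2 fun f hf =>
        eq_zero_of_quadraticValues_eq_zero ht hij hik hjk (congrFun hf i) (congrFun hf j)
          (congrFun hf k)
    rw [LinearMap.finrank_range_of_inj hinj, Module.finrank_fin_fun]
  vanishOn_eq_bot S hS := by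
    classical
    obtain ⟨i, j, k, hij, hik, hjk, rfl⟩ := Finset.card_eq_three.1 hS
    refine eq_bot_iff.2 fun f hf => ?_
    obtain ⟨⟨f, rfl⟩, hf⟩ := mem_vanishOn.1 hf
    rw [eq_zero_of_quadraticValues_eq_zero ht hij hik hjk (hf i (by simp)) (hf j (by simp))
      (hf k (by simp)), map_zero]
    exact Submodule.zero_mem _
  sup_eq P Q R hP hQ hR hPQ hPR hQR := by
    classical
    obtain ⟨p, p', hp, rfl⟩ := Finset.card_eq_two.1 hP
    obtain ⟨q, q', hq, rfl⟩ := Finset.card_eq_two.1 hQ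
    obtain ⟨r, r', hr, rfl⟩ := Finset.card_eq_two.1 hR
    simp only [Finset.disjoint_insert_left, Finset.disjoint_singleton_left, Finset.mem_insert,
      Finset.mem_singleton, not_or] at hPQ hPR hQR
    have hw : [p, p', q, q', r, r'].Nodup := by grind
    exact range_quadraticValues_le_sup (hdet _ (List.nodup_ofFn.1 hw))

theorem exists_injective_rootPairs_det_ne_zero (ι : Type*) [Finite ι] [Infinite K] :
    ∃ t : ι → K, Function.Injective t ∧
      ∀ w : Fin 6 → ι, Function.Injective w → (rootPairs (t ∘ w)).det ≠ 0 := by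
  classical
  cases nonempty_fintype ι
  let p : MvPolynomial ι K :=
    (∏ z : ι × ι, if z.1 = z.2 then 1 else MvPolynomial.X z.1 - MvPolynomial.X z.2) *
      ∏ w : Fin 6 → ι, if Function.Injective w then (rootPairs (MvPolynomial.X ∘ w)).det else 1
  have hdet (t : ι → K) (w : Fin 6 → ι) :
      MvPolynomial.eval t (rootPairs (MvPolynomial.X ∘ w)).det = (rootPairs (t ∘ w)).det := by
    rw [RingHom.map_det, RingHom.mapMatrix_apply, map_rootPairs]
    congr 2
    ext k
    simp
  have hp : p ≠ 0 := by
    refine mul_ne_zero (Finset.prod_ne_zero_iff.2 fun z _ => ?_)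
      (Finset.prod_ne_zero_iff.2 fun w _ => ?_)
    · split_ifs with h
      · exact one_ne_zero
      · exact sub_ne_zero.2 fun he => h (MvPolynomial.X_injective he)
    · split_ifs with h
      · intro h₀
        -- The polynomials `T ^ 2`, `T ^ 2 - T` and `T ^ 2 - 1` are linearly independent.
        have h₁ := hdet (Function.extend w ![0, 0, 1, 0, 1, -1] 0) w
        rw [Function.extend_comp h, h₀, map_zero] at h₁
        simp [rootPairs, rootPair, Matrix.det_fin_three] at h₁
      · exact one_ne_zero
  obtain ⟨t, ht⟩ : ∃ t, MvPolynomial.eval t p ≠ 0 := by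
    by_contra! h
    exact hp (MvPolynomial.funext fun t => by rw [h t, map_zero])
  rw [map_mul, mul_ne_zero_iff, map_prod, map_prod, Finset.prod_ne_zero_iff,
    Finset.prod_ne_zero_iff] at ht
  refine ⟨t, fun i j hij => ?_, fun w hw => ?_⟩
  · by_contra hne
    simpa [hne, hij] using ht.1 (i, j) (Finset.mem_univ _)
  · simpa only [if_pos hw, hdet] using ht.2 w (Finset.mem_univ _)

theorem exists_inGeneralPosition_ker [Infinite K] (a : ℕ) :
    ∃ x : Fin (a + 3) → Fin a → K,
      InGeneralPosition (LinearMap.ker (Fintype.linearCombination K x)) := by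
  obtain ⟨t, ht, hdet⟩ := exists_injective_rootPairs_det_ne_zero (K := K) (Fin (a + 3))
  have hN := inGeneralPosition_range_quadraticValues (by simp) ht hdet
  obtain ⟨x, hx⟩ := exists_linearCombination_ker_eq _ hN.finrank_eq
  exact ⟨x, hx ▸ hN⟩

end Parabola

theorem eRk_eq_of_isLeast_rankBounds {m n a b : ℕ} (hb : b ≤ n) (hma : m - a ≤ 3)
    (X : Finset (Fin m × Fin n)) {r : ℕ} (hr : IsLeast (rankBounds X a b) r) :
    (bipartiteRigidityMatroid m n a b).eRk X = (r : ℕ∞) := by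
  have hm : m ≤ a + 3 := by omega
  rw [bipartiteRigidityMatroid_eRk, Nat.cast_inj]
  rw [← rankBounds_padRows hm] at hr
  apply le_antisymm
  · let x (i : Fin (a + 3)) (t : Fin a) : RigidityField m n a b :=
      if h : (i : ℕ) < m then rigidityX ⟨i, h⟩ t else 0
    have hx : (fun i => x (Fin.castLE hm i)) = rigidityX := by
      funext i t
      simp [x]
    have h := columnRank_le_of_mem_rankBounds x rigidityY (padRows hm X) hr.1
    rwa [columnRank_padRows, hx] at h
  · obtain ⟨x, hx⟩ := exists_inGeneralPosition_ker (K := ℂ) a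
    obtain ⟨y, s, hs, hle⟩ := exists_rankBound_le_columnRank (padRows hm X) x hx hb
    rw [columnRank_padRows] at hle
    exact (hr.2 hs).trans (hle.trans (columnRank_le_generic _ y X))

/-- There is one deterministic Turing machine `M` and one polynomial `p` such that for all
`0 ≤ a ≤ m` and `0 ≤ b ≤ n` with `m - a ≤ 3` and all `X ⊆ [m] × [n]`, the machine `M`, given
`(m, n, a, b, X)`, outputs the rank of `X` in `ℬ_{m,n}(a,b)` (in unary) within `p (m + n)` steps. -/
theorem theorem1p2 :
    ∃ (M : Turing.TM2ComputableAux Computability.Γ' Bool) (p : Polynomial ℕ),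
      ∀ m n a b : ℕ, a ≤ m → b ≤ n → m - a ≤ 3 → ∀ X : Finset (Fin m × Fin n),
        ∃ r : ℕ, (bipartiteRigidityMatroid m n a b).eRk (X : Set (Fin m × Fin n)) = (r : ℕ∞) ∧
          HaltsWithOutput M (encodeInput m n a b X) (Computability.unaryEncodeNat r)
            (p.eval (m + n)) := by
  obtain ⟨M, p, h⟩ := exists_machine_isLeast_rankBounds
  refine ⟨M, p, fun m n a b ha hb hma X => ?_⟩
  obtain ⟨r, hr, hM⟩ := h m n a b ha hb hma X
  exact ⟨r, eRk_eq_of_isLeast_rankBounds hb hma X hr, hM⟩
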